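/- **Setting.** Let $N\ge 1$, $\omega=e^{2\pi i/N}$, $\epsilon=(-1)^N$, $n\ge 2$. On $\mathcal V=(\mathbb C^N)^{\otimes n}$ with basis $|\gamma_1,\dots,\gamma_n\rangle$, $\gamma_k\in\mathbb Z_N$, let $\mathbf u_k,\mathbf v_k$ act on the $k$-th factor by $\mathbf u|\gamma\rangle=\omega^\gamma|\gamma\rangle$, $\mathbf v|\gamma\rangle=|\gamma+1\rangle$. For complex $a_k,b_k,c_k,d_k,\kappa_k$ put $$L_k(\lambda)=\begin{pmatrix}1+\lambda\kappa_k\mathbf v_k&\lambda\mathbf u_k^{-1}(a_k-b_k\mathbf v_k)\\ \mathbf u_k(c_k-d_k\mathbf v_k)&\lambda a_kc_k+\mathbf v_kb_kd_k/\kappa_k\end{pmatrix},\qquad L_1(\lambda)\cdots L_n(\lambda)=\begin{pmatrix}A_n&B_n\\C_n&D_n\end{pmatrix}(\lambda),$$ $\mathbf t_n=A_n+D_n$, $\mathbf V_n=\mathbf v_1\cdots\mathbf v_n$, $F_m(\lambda)=(b_m+\omega a_m\kappa_m\lambda)(\lambda c_m+d_m/\kappa_m)$. *Amplitudes.* Let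 $\mathcal T_m(\Lambda)=\mathcal L_1(\Lambda)\cdots\mathcal L_m(\Lambda)$ with $$\mathcal L_k(\Lambda)=\begin{pmatrix}1-\epsilon\kappa_k^N\Lambda&-\epsilon\Lambda(a_k^N-b_k^N)\\c_k^N-d_k^N&b_k^Nd_k^N/\kappa_k^N-\epsilon\Lambda a_k^Nc_k^N\end{pmatrix}$$ and let $\mathcal B_m$ be the upper right entry of $\mathcal T_m$. Fix any numbers $r_k$, $r_{m,s}$ ($0\le s<m\le n$) with $r_k^N=a_k^N-b_k^N$, $r_{1,0}=r_1$ and $\mathcal B_m(\Lambda)=(-\epsilon)^m\Lambda\, r_{m,0}^N\prod_{s=1}^{m-1}(\Lambda-\epsilon r_{m,s}^N)$ for $1\le m\le n$. Put $\tilde r_m=\prod_{s=0}^{m-1}r_{m,s}$. *Standing assumptions.* $a_k,b_k,\kappa_k\ne0$ for all $k$; $c_k,d_k\neq 0$ for $k\ge2$; $r_k\ne0$ for all $k$; for $2\le m\le n$ all $r_{m,s}\ne0$ and $r_{m,1}^N,\dots,r_{m,m-1}^N$ are distinct; $\det\mathcal T_n(\epsilon r_{m,s}^N)\ne0$ for $2\le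 m\le n$, $1\le s\le m-1$. *Fermat points and $w_p$.* For $p=(x,y)$ with $x^N+y^N=1$, $y\neq0$, let $w_p:\mathbb Z_N\to\mathbb C$ be given by $w_p(0)=1$, $w_p(\gamma)/w_p(\gamma-1)=y/(1-\omega^\gamma x)$. Let $p_k=(r_k/a_k,\,b_k/a_k)$; $p^{m,s}_{m',s'}=(r_{m,s}/r_{m',s'},\,y^{m,s}_{m',s'})$ and $\tilde p_{m,s}=(d_m/(\kappa_mc_mr_{m,s}),\,\tilde y_{m,s})$ with any fixed choice of $y^{m,s}_{m',s'}$ ($m'\in\{m,m-1\}$, $(m',s')\ne(m,s)$) and $\tilde y_{m,s}$ putting these points on the Fermat curve ($s,s'\ge1$); $$p_{m,0}=\Big(\frac{r_{m-1,0}a_mc_m}{r_{m,0}},\frac{\kappa_1\cdots\kappa_{m-1}r_m}{r_{m,0}}\Big),\quad \tilde p_m=\Big(\frac{r_m}{\tilde r_m},\frac{b_md_m\tilde r_{m-1}}{\kappa_m\tilde r_m}\Big),\quad p_{m,l}=\Big(\frac{a_m\kappa_mr_{m,l}}{b_m},y_{m,l}\Big),$$ $$y_{m,l}=\frac{\tilde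 r_m r_{m+1,0}r_m}{\tilde r_{m-1}r_{m,0}r_{m+1}b_mc_m\tilde y_{m,l}}\prod_{s\ne l,\,1\le s\le m-1}\frac{y^{m,l}_{m,s}}{y^{m,s}_{m,l}}\cdot\frac{\prod_{k=1}^{m}y^{m+1,k}_{m,l}}{\prod_{s=1}^{m-2}y^{m,l}_{m-1,s}},\qquad 1\le l\le m-1,\ m\le n-1 .$$ *Vectors.* Let $\psi^{(k)}_\rho=\sum_\gamma w_{p_k}(\gamma-\rho)|\gamma\rangle$, $\Psi_{\rho_{1,0}}=\psi^{(1)}_{\rho_{1,0}}$, and for $\boldsymbol\rho_m=(\rho_{m,0},\dots,\rho_{m,m-1})\in\mathbb Z_N^m$, $m\ge2$, with $\tilde\rho_m=\sum_k\rho_{m,k}$, $$\Psi_{\boldsymbol\rho_m}=\sum_{\boldsymbol\rho_{m-1},\rho_m}Q(\boldsymbol\rho_{m-1},\rho_m|\boldsymbol\rho_m)\Psi_{\boldsymbol\rho_{m-1}}\otimes\psi^{(m)}_{\rho_m},$$ $$Q=\frac{\omega^{(\tilde\rho_m-\tilde\rho_{m-1})(\rho_m-\rho_{m,0})}}{w_{p_{m,0}}(\rho_{m,0}-\rho_{m-1,0}-1)\,w_{\tilde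 p_m}(\tilde\rho_m-\rho_m-1)}\cdot\frac{\prod_{l=1}^{m-2}\prod_{k=1}^{m-1}w_{p^{m,k}_{m-1,l}}(\rho_{m-1,l}-\rho_{m,k})}{\prod_{j\ne l}w_{p^{m-1,l}_{m-1,j}}(\rho_{m-1,j}-\rho_{m-1,l})}\prod_{l=1}^{m-2}\frac{w_{p_{m-1,l}}(-\rho_{m-1,l})}{w_{\tilde p_{m-1,l}}(\rho_{m-1,l})}$$ ($1\le j,l\le m-2$). Write $\lambda_{n,k}=-r_{n,k}\omega^{-\rho_{n,k}}$, $\boldsymbol\rho_n'=(\rho_{n,1},\dots,\rho_{n,n-1})$; superscripts $\pm k$ mean $\rho_{n,k}\mapsto\rho_{n,k}\pm1$. Let $\tilde\Psi_{\rho,\boldsymbol\rho_n'}=\sum_{\rho_{n,0}}\omega^{-\rho\rho_{n,0}}\Psi_{\boldsymbol\rho_n}$. **Theorem.** Under the standing assumptions: 1. $A_n(\omega\lambda)D_n(\lambda)-C_n(\omega\lambda)B_n(\lambda)=\mathbf V_n\prod_{m=1}^nF_m(\lambda)$, and, for $1\le k\le n-1$, $$D_n(\lambda_{n,k})\Psi_{\boldsymbol\rho_n}=\tilde\varphi_k(\boldsymbol\rho_n')\Psi_{\boldsymbol\rho_n^{+0,-k}},\qquad\tilde\varphi_k(\boldsymbol\rho'_n)=-\frac{r_n}{\tilde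 r_{n-1}}\frac{\omega^{\tilde\rho_n-\rho_{n,0}-1}}{\prod_{s=1}^{n-2}y^{n,k}_{n-1,s}}\prod_{m=1}^{n-1}F_m(\lambda_{n,k}).$$ For all $\lambda$, $$D_n(\lambda)\Psi_{\boldsymbol\rho_n}=\sum_{k=1}^{n-1}\Big(\prod_{s\ne k}\tfrac{\lambda-\lambda_{n,s}}{\lambda_{n,k}-\lambda_{n,s}}\Big)\tfrac{\lambda}{\lambda_{n,k}}\tilde\varphi_k(\boldsymbol\rho_n')\Psi_{\boldsymbol\rho_n^{+0,-k}}+\prod_{s=1}^{n-1}\Big(1-\tfrac{\lambda}{\lambda_{n,s}}\Big)\prod_{m=1}^n\tfrac{b_md_m}{\kappa_m}\,\Psi_{\boldsymbol\rho_n^{+0}}+\lambda\prod_{m=1}^na_mc_m\prod_{s=1}^{n-1}(\lambda-\lambda_{n,s})\,\Psi_{\boldsymbol\rho_n}.$$ 2. The $\tilde\Psi_{\rho,\boldsymbol\rho_n'}$ form a basis of $\mathcal V$, and $\mathbf V_n\tilde\Psi_{\rho,\boldsymbol\rho_n'}=\omega^\rho\tilde\Psi_{\rho,\boldsymbol\rho_n'}$.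 3. Let $\Phi\ne0$ satisfy $\mathbf t_n(\lambda)\Phi=t(\lambda)\Phi$ for all $\lambda$. Then there is a unique $\rho\in\mathbb Z_N$ with $\mathbf V_n\Phi=\omega^\rho\Phi$; moreover $t(\lambda)=E_0+E_1\lambda+\dots+E_n\lambda^n$ with $$E_0=1+\omega^\rho\prod_m b_md_m/\kappa_m,\qquad E_n=\prod_m a_mc_m+\omega^\rho\prod_m\kappa_m,\qquad(*)$$ and $\Phi=\sum_{\boldsymbol\rho_n'}Q(\boldsymbol\rho_n')\tilde\Psi_{\rho,\boldsymbol\rho_n'}$ for a unique $Q$. The function $\tilde Q(\boldsymbol\rho_n')=Q(\boldsymbol\rho'_n)\prod_{s\ne s'}w_{p^{n,s'}_{n,s}}(\rho_{n,s}-\rho_{n,s'})$ satisfies, for $k=1,\dots,n-1$, $$t(\lambda_{n,k})\tilde Q(\boldsymbol\rho_n')=\Delta_+(\lambda_{n,k})\tilde Q(\boldsymbol\rho_n'^{+k})+\Delta_-(\omega\lambda_{n,k})\tilde Q(\boldsymbol\rho_n'^{-k}),\qquad(**)$$ $$\Delta_+(\lambda)=\frac{\omega^\rho}{\chi_k}\Big(\frac\lambda\omega\Big)^{1-n}\prod_{m=1}^{n-1}F_m(\lambda/\omega),\qquad\Delta_-(\lambda)=\chi_k\Big(\frac\lambda\omega\Big)^{n-1}F_n(\lambda/\omega),$$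 $$\chi_k=\frac{r_{n,0}\tilde r_{n-1}}{r_n\tilde r_n}\Big(\prod_{s\ne k}\frac{y^{n,s}_{n,k}}{y^{n,k}_{n,s}}\Big)\prod_{s=1}^{n-2}y^{n,k}_{n-1,s}.$$ 4. Conversely, let $\rho\in\mathbb Z_N$ and let $t$ be a polynomial of degree at most $n$ satisfying $(*)$. Let $\mathcal E$ be the space of all $\Phi$ with $\mathbf V_n\Phi=\omega^\rho\Phi$ and $\mathbf t_n(\lambda)\Phi=t(\lambda)\Phi$ for all $\lambda$. Then the vector with coefficients $Q$ lies in $\mathcal E$ if and only if $\tilde Q$ satisfies $(**)$, and these equations separate. Let $\mathcal S_k$ be the space of solutions $\tilde q_k:\mathbb Z_N\to\mathbb C$ of the Baxter equation $$t(\lambda_{n,k})\tilde q_k(\rho_{n,k})=\Delta_+(\lambda_{n,k})\tilde q_k(\rho_{n,k}+1)+\Delta_-(\omega\lambda_{n,k})\tilde q_k(\rho_{n,k}-1),\qquad \rho_{n,k}\in\mathbb Z_N.$$ For nonzero $\tilde q_k\in\mathcal S_k$, $\tilde Q=\prod_{k=1}^{n-1}\tilde q_k(\rho_{n,k})$ gives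 an eigenvector $\Phi\neq0$ in $\mathcal E$; the separated vectors obtained from $\tilde q_k\in\mathcal S_k$ span $\mathcal E$; $\mathcal E\ne0$ if and only if $\mathcal S_k\neq0$ for every $k$. If $\dim\mathcal E=1$, or if $\dim\mathcal S_k\le1$ for all but at most one $k$, then every $\Phi\in\mathcal E$ is separated: $\tilde Q=\prod_k\tilde q_k(\rho_{n,k})$ with $\tilde q_k\in\mathcal S_k$. -/

import Mathlib

open scoped BigOperators

namespace BBS

noncomputable section

/-! ### Roots of unity and the cyclic function `w_p` -/

/-- `ω = exp (2πi/N)`. -/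
def omega (N : ℕ) : ℂ := Complex.exp (2 * Real.pi * Complex.I / N)

/-- `ω ^ j` for a residue `j` modulo `N`. -/
def omPow {N : ℕ} (j : ZMod N) : ℂ := omega N ^ j.val

theorem omPow_eq_stdAddChar {N : ℕ} [NeZero N] (j : ZMod N) :
    omPow j = ZMod.stdAddChar j := by
  conv_rhs => rw [← ZMod.natCast_zmod_val j]
  have h := ZMod.stdAddChar_coe (N := N) (j.val : ℤ)
  rw [Int.cast_natCast] at h
  rw [h, omPow, omega, ← Complex.exp_nat_mul]
  congr 1
  push_cast
  ring

/-- The cyclic function `w_p(γ)`, `p = (x, y)`: the solution of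
`w_p(γ) / w_p(γ - 1) = y / (1 - ω ^ γ x)`, `w_p(0) = 1`. -/
def cyc {N : ℕ} (p : ℂ × ℂ) (γ : ZMod N) : ℂ :=
  ∏ j ∈ Finset.range γ.val, p.2 / (1 - omega N ^ (j + 1) * p.1)

theorem omega_isPrimitiveRoot {N : ℕ} [NeZero N] : IsPrimitiveRoot (omega N) N := by
  have := Complex.isPrimitiveRoot_exp N (NeZero.ne N)
  simpa [omega] using this

/-- The difference equation of `w_p`, for a point `p` of the Fermat curve with `y ≠ 0`. -/
theorem cyc_rec {N : ℕ} [NeZero N] (p : ℂ × ℂ) (hp : p.1 ^ N + p.2 ^ N = 1) (hy : p.2 ≠ 0)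
    (γ : ZMod N) : cyc p γ * (1 - omPow γ * p.1) = p.2 * cyc p (γ - 1) := by
  have hN : 0 < N := Nat.pos_of_ne_zero (NeZero.ne N)
  have hω : omega N ^ N = 1 := by
    have := Complex.isPrimitiveRoot_exp N (NeZero.ne N)
    exact this.pow_eq_one
  have hne : ∀ j : ℕ, 1 - omega N ^ j * p.1 ≠ 0 := by
    intro j h
    have h1 : (omega N ^ j * p.1) ^ N = 1 := by
      rw [← sub_eq_zero.mp h, one_pow]
    rw [mul_pow, ← pow_mul, mul_comm j N, pow_mul, hω, one_pow, one_mul] at h1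
    rw [h1] at hp
    exact hy (pow_eq_zero_iff (NeZero.ne N) |>.mp (by simpa using hp))
  by_cases h0 : γ = 0
  · subst h0
    have hprod : ∏ j ∈ Finset.range N, (1 - omega N ^ j * p.1) = 1 - p.1 ^ N := by
      have h := (omega_isPrimitiveRoot (N := N)).pow_sub_pow_eq_prod_sub_mul (1 : ℂ) p.1 hN
      rw [one_pow] at h
      rw [h]
      refine Finset.prod_nbij (fun j => omega N ^ j) ?_ ?_ ?_ ?_
      · intro j _
        rw [Polynomial.mem_nthRootsFinset hN, ← pow_mul, mul_comm j N, pow_mul, hω, one_pow]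
      · intro i hi j hj hij
        exact omega_isPrimitiveRoot.pow_inj (Finset.mem_range.mp hi) (Finset.mem_range.mp hj) hij
      · intro z hz
        obtain ⟨i, hi, rfl⟩ := (omega_isPrimitiveRoot (N := N)).eq_pow_of_pow_eq_one
          ((Polynomial.mem_nthRootsFinset hN _).mp hz)
        exact ⟨i, by simpa using hi, rfl⟩
      · intro j _
        rfl
    have hv : ((0 : ZMod N) - 1).val = N - 1 := by
      obtain ⟨k, rfl⟩ : ∃ k, N = k + 1 := ⟨N - 1, by omega⟩
      simp [ZMod.val_neg_one]
    obtain ⟨k, hk⟩ : ∃ k, N = k + 1 := ⟨N - 1, by omega⟩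
    rw [cyc, cyc, hv, omPow]
    simp only [ZMod.val_zero, Finset.range_zero, Finset.prod_empty, pow_zero, one_mul]
    rw [Finset.prod_div_distrib, Finset.prod_const, Finset.card_range]
    have h2 : (∏ j ∈ Finset.range (N - 1), (1 - omega N ^ (j + 1) * p.1)) * (1 - p.1) = p.2 ^ N := by
      have : ∏ j ∈ Finset.range (N - 1 + 1), (1 - omega N ^ j * p.1) = 1 - p.1 ^ N := by
        rwa [Nat.sub_add_cancel hN]
      rw [Finset.prod_range_succ', pow_zero, one_mul] at this
      rw [this]; linear_combination -hp
    rw [← mul_div_assoc, ← pow_succ', Nat.sub_add_cancel hN, eq_div_iff, ← h2]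
    · ring
    · exact Finset.prod_ne_zero_iff.mpr fun j _ => hne _
  · have hv : γ.val = (γ - 1).val + 1 := by
      have hN1 : N ≠ 1 := by
        rintro rfl
        exact h0 (Subsingleton.elim _ _)
      have : Fact (1 < N) := ⟨by omega⟩
      have hpos : γ.val ≠ 0 := by rwa [Ne, ZMod.val_eq_zero]
      rw [ZMod.val_sub (by rw [ZMod.val_one]; omega), ZMod.val_one]
      omega
    rw [cyc, cyc, omPow, hv, Finset.prod_range_succ, mul_assoc,
      div_mul_cancel₀ _ (hne _), mul_comm]

/-! ### The chain: Weyl operators, L-operators, monodromy -/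

/-- The five parameters of each site; the sites of an `n`-site chain are `1, …, n`. -/
structure SiteParams where
  a : ℕ → ℂ
  b : ℕ → ℂ
  c : ℕ → ℂ
  d : ℕ → ℂ
  κ : ℕ → ℂ

/-- The space of states `V₁ ⊗ ⋯ ⊗ Vₙ` in the basis `|γ₁⟩ ⊗ ⋯ ⊗ |γₙ⟩`, `γ ∈ (ℤ/N)ⁿ`
(a vector is the function of its coordinates). The coordinate with index `k : Fin n` belongs to
site `k + 1`. -/
abbrev States (N n : ℕ) : Type := (Fin n → ZMod N) → ℂ

/-- `u |γ⟩ = ω ^ γ |γ⟩` at one site. -/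
def uOp {N n : ℕ} (k : Fin n) : Module.End ℂ (States N n) where
  toFun f := fun γ => omPow (γ k) * f γ
  map_add' f g := by funext γ; simp [mul_add]
  map_smul' z f := by funext γ; simp [mul_left_comm]

/-- `u⁻¹ |γ⟩ = ω ^ (-γ) |γ⟩` at one site. -/
def uInvOp {N n : ℕ} (k : Fin n) : Module.End ℂ (States N n) where
  toFun f := fun γ => omPow (-(γ k)) * f γ
  map_add' f g := by funext γ; simp [mul_add]
  map_smul' z f := by funext γ; simp [mul_left_comm]

/-- `v |γ⟩ = |γ + 1⟩` at one site. -/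
def vOp {N n : ℕ} (k : Fin n) : Module.End ℂ (States N n) where
  toFun f := fun γ => f (γ - Pi.single k 1)
  map_add' f g := by funext γ; simp
  map_smul' z f := by funext γ; simp

/-- The cyclic L-operator of one site, a `2 × 2` matrix of operators on the states. -/
def lOp {N n : ℕ} (P : SiteParams) (k : Fin n) (l : ℂ) :
    Matrix (Fin 2) (Fin 2) (Module.End ℂ (States N n)) :=
  let a := P.a (k + 1)
  let b := P.b (k + 1)
  let c := P.c (k + 1)
  let d := P.d (k + 1)
  let κ := P.κ (k + 1)
  !![1 + (l * κ) • vOp k, l • (uInvOp k * (a • 1 - b • vOp k));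
     uOp k * (c • 1 - d • vOp k), (l * a * c) • 1 + (b * d / κ) • vOp k]

/-- The monodromy matrix `Tₙ(λ) = L₁(λ) ⋯ Lₙ(λ)`, with entries `Aₙ, Bₙ; Cₙ, Dₙ`. -/
def monodromy (N n : ℕ) (P : SiteParams) (l : ℂ) :
    Matrix (Fin 2) (Fin 2) (Module.End ℂ (States N n)) :=
  (List.ofFn fun k : Fin n => lOp P k l).prod

def opA (N n : ℕ) (P : SiteParams) (l : ℂ) : Module.End ℂ (States N n) := monodromy N n P l 0 0
def opB (N n : ℕ) (P : SiteParams) (l : ℂ) : Module.End ℂ (States N n) := monodromy N n P l 0 1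
def opC (N n : ℕ) (P : SiteParams) (l : ℂ) : Module.End ℂ (States N n) := monodromy N n P l 1 0
def opD (N n : ℕ) (P : SiteParams) (l : ℂ) : Module.End ℂ (States N n) := monodromy N n P l 1 1

/-- The transfer matrix `tₙ(λ) = Aₙ(λ) + Dₙ(λ)` of the periodic chain. -/
def transfer (N n : ℕ) (P : SiteParams) (l : ℂ) : Module.End ℂ (States N n) :=
  opA N n P l + opD N n P l

/-- The charge operator `𝐕ₙ = v₁ v₂ ⋯ vₙ`. -/
def chargeOp (N n : ℕ) : Module.End ℂ (States N n) :=
  (List.ofFn fun k : Fin n => vOp k).prod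

/-- `F_m(λ) = (b_m + ω a_m κ_m λ) (λ c_m + d_m / κ_m)`. -/
def F (N : ℕ) (P : SiteParams) (m : ℕ) (l : ℂ) : ℂ :=
  (P.b m + omega N * P.a m * P.κ m * l) * (l * P.c m + P.d m / P.κ m)

/-! ### The classical chain, the amplitudes and the Fermat curve points -/

/-- `ε = (-1)^N`. -/
def eps (N : ℕ) : ℂ := (-1) ^ N

/-- The classical L-operator of site `k`, as a function of `Λ = λ^N`. -/
def classicalL (N : ℕ) (P : SiteParams) (k : ℕ) (Λ : ℂ) : Matrix (Fin 2) (Fin 2) ℂ :=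
  !![1 - eps N * P.κ k ^ N * Λ, -eps N * Λ * (P.a k ^ N - P.b k ^ N);
     P.c k ^ N - P.d k ^ N,
     P.b k ^ N * P.d k ^ N / P.κ k ^ N - eps N * Λ * P.a k ^ N * P.c k ^ N]

/-- The classical monodromy `𝓣_m(Λ) = 𝓛₁(Λ) ⋯ 𝓛_m(Λ)`. -/
def classicalT (N : ℕ) (P : SiteParams) (m : ℕ) (Λ : ℂ) : Matrix (Fin 2) (Fin 2) ℂ :=
  (List.ofFn fun k : Fin m => classicalL N P (k + 1) Λ).prod

/-- A choice of the roots that enter the construction: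
`rs k` is `r_k`, `r m s` is `r_{m,s}`, `y m s m' s'` is `y^{m,s}_{m',s'}` (upper indices first)
and `yt m s` is `ỹ_{m,s}`. The equations for them are in `IsSolution`. -/
structure Amplitudes where
  rs : ℕ → ℂ
  r : ℕ → ℕ → ℂ
  y : ℕ → ℕ → ℕ → ℕ → ℂ
  yt : ℕ → ℕ → ℂ

/-- `r̃_m = r_{m,0} r_{m,1} ⋯ r_{m,m-1}`. -/
def Amplitudes.rt (S : Amplitudes) (m : ℕ) : ℂ := ∏ s ∈ Finset.range m, S.r m s

/-- The equations that determine the amplitudes and the free Fermat coordinates, up to `N`-th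
roots of unity, by the parameters of an `n`-site chain. -/
structure IsSolution (N n : ℕ) (P : SiteParams) (S : Amplitudes) : Prop where
  site : ∀ k ∈ Finset.Icc 1 n, S.rs k ^ N = P.a k ^ N - P.b k ^ N
  one : S.r 1 0 = S.rs 1
  /-- `𝓑_m(Λ) = (-ε)^m Λ r_{m,0}^N ∏_{s=1}^{m-1} (Λ - ε r_{m,s}^N)` -/
  classicalB : ∀ m ∈ Finset.Icc 1 n, ∀ Λ : ℂ,
    classicalT N P m Λ 0 1 =
      (-eps N) ^ m * Λ * S.r m 0 ^ N * ∏ s ∈ Finset.Ico 1 m, (Λ - eps N * S.r m s ^ N)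
  /-- `p^{m,s}_{m,s'}` lies on the Fermat curve -/
  y_same : ∀ m ∈ Finset.Icc 2 n, ∀ s ∈ Finset.Ico 1 m, ∀ s' ∈ Finset.Ico 1 m, s ≠ s' →
    (S.r m s / S.r m s') ^ N + S.y m s m s' ^ N = 1
  /-- `p^{m,s}_{m-1,s'}` lies on the Fermat curve -/
  y_prev : ∀ m ∈ Finset.Icc 2 n, ∀ s ∈ Finset.Ico 1 m, ∀ s' ∈ Finset.Ico 1 (m - 1),
    (S.r m s / S.r (m - 1) s') ^ N + S.y m s (m - 1) s' ^ N = 1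
  /-- `p̃_{m,s}` lies on the Fermat curve -/
  yt_fermat : ∀ m ∈ Finset.Icc 2 n, ∀ s ∈ Finset.Ico 1 m,
    (P.d m / (P.κ m * P.c m * S.r m s)) ^ N + S.yt m s ^ N = 1

/-- Non-degeneracy of an `n`-site chain: the parameters by which the construction divides and the
`r_m` do not vanish, the polynomials `𝓑_m(Λ) / Λ`, `2 ≤ m ≤ n`, have degree `m - 1` and simple
nonzero zeros `ε r_{m,s}^N`, and `det 𝓣ₙ` does not vanish at these zeros. -/
structure IsNondegenerate (N n : ℕ) (P : SiteParams) (S : Amplitudes) : Prop where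
  a_ne : ∀ k ∈ Finset.Icc 1 n, P.a k ≠ 0
  b_ne : ∀ k ∈ Finset.Icc 1 n, P.b k ≠ 0
  κ_ne : ∀ k ∈ Finset.Icc 1 n, P.κ k ≠ 0
  c_ne : ∀ k ∈ Finset.Icc 2 n, P.c k ≠ 0
  d_ne : ∀ k ∈ Finset.Icc 2 n, P.d k ≠ 0
  rs_ne : ∀ k ∈ Finset.Icc 1 n, S.rs k ≠ 0
  r_ne : ∀ m ∈ Finset.Icc 2 n, ∀ s ∈ Finset.range m, S.r m s ≠ 0
  simple : ∀ m ∈ Finset.Icc 2 n, ∀ s ∈ Finset.Ico 1 m, ∀ s' ∈ Finset.Ico 1 m, s ≠ s' →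
    S.r m s ^ N ≠ S.r m s' ^ N
  det_ne : ∀ m ∈ Finset.Icc 2 n, ∀ s ∈ Finset.Ico 1 m,
    (classicalT N P n (eps N * S.r m s ^ N)).det ≠ 0

/-- The point `p_k = (r_k / a_k, b_k / a_k)`. -/
def ptSite (P : SiteParams) (S : Amplitudes) (k : ℕ) : ℂ × ℂ :=
  (S.rs k / P.a k, P.b k / P.a k)

/-- The point `p^{m,s}_{m',s'}`. -/
def ptRatio (S : Amplitudes) (m s m' s' : ℕ) : ℂ × ℂ := (S.r m s / S.r m' s', S.y m s m' s')

/-- The point `p̃_{m,s}`. -/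
def ptTilde (P : SiteParams) (S : Amplitudes) (m s : ℕ) : ℂ × ℂ :=
  (P.d m / (P.κ m * P.c m * S.r m s), S.yt m s)

/-- The coordinate `y_{m,l}`, `1 ≤ l ≤ m - 1`. -/
def yPlain (P : SiteParams) (S : Amplitudes) (m l : ℕ) : ℂ :=
  S.rt m * S.r (m + 1) 0 * S.rs m /
      (S.rt (m - 1) * S.r m 0 * S.rs (m + 1) * P.b m * P.c m * S.yt m l) *
    (∏ s ∈ (Finset.Ico 1 m).erase l, S.y m l m s / S.y m s m l) *
    ((∏ k ∈ Finset.Icc 1 m, S.y (m + 1) k m l) / ∏ s ∈ Finset.Ico 1 (m - 1), S.y m l (m - 1) s)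

/-- The point `p_{m,l}`, `1 ≤ l ≤ m - 1`. -/
def ptPlain (P : SiteParams) (S : Amplitudes) (m l : ℕ) : ℂ × ℂ :=
  (P.a m * P.κ m * S.r m l / P.b m, yPlain P S m l)

/-- The point `p_{m,0}`. -/
def ptZero (P : SiteParams) (S : Amplitudes) (m : ℕ) : ℂ × ℂ :=
  (S.r (m - 1) 0 * P.a m * P.c m / S.r m 0,
   (∏ k ∈ Finset.Ico 1 m, P.κ k) * S.rs m / S.r m 0)

/-- The point `p̃_m`. -/
def ptTot (P : SiteParams) (S : Amplitudes) (m : ℕ) : ℂ × ℂ :=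
  (S.rs m / S.rt m, P.b m * P.d m * S.rt (m - 1) / (P.κ m * S.rt m))

/-! ### The eigenvectors of `Bₙ(λ)` -/

/-- The one-site vector `ψ^{(k)}_ρ = ∑_γ w_{p_k}(γ - ρ) |γ⟩`. -/
def psiSite {N : ℕ} (P : SiteParams) (S : Amplitudes) (k : ℕ) (ρ γ : ZMod N) : ℂ :=
  cyc (ptSite P S k) (γ - ρ)

/-- The kernel `Q(ρ_{n-1}, ρ_n | 𝛒_n)` for `n = m + 2`. -/
def kernelQ {N : ℕ} (P : SiteParams) (S : Amplitudes) (m : ℕ)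
    (σ : Fin (m + 1) → ZMod N) (τ : ZMod N) (ρ : Fin (m + 2) → ZMod N) : ℂ :=
  omPow ((∑ i, ρ i - ∑ i, σ i) * (τ - ρ 0)) /
      (cyc (ptZero P S (m + 2)) (ρ 0 - σ 0 - 1) * cyc (ptTot P S (m + 2)) (∑ i, ρ i - τ - 1)) *
    ((∏ l : Fin m, ∏ k : Fin (m + 1),
        cyc (ptRatio S (m + 2) (k + 1) (m + 1) (l + 1)) (σ l.succ - ρ k.succ)) /
      ∏ l : Fin m, ∏ j ∈ Finset.univ.erase l,
        cyc (ptRatio S (m + 1) (l + 1) (m + 1) (j + 1)) (σ j.succ - σ l.succ)) *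
    ∏ l : Fin m, cyc (ptPlain P S (m + 1) (l + 1)) (-(σ l.succ)) /
      cyc (ptTilde P S (m + 1) (l + 1)) (σ l.succ)

/-- The vectors `Ψ_{𝛒_n}`, `𝛒_n = (ρ_{n,0}, …, ρ_{n,n-1})`, built recursively from
`Ψ_{ρ_{1,0}} = ψ^{(1)}_{ρ_{1,0}}` (the value for `n = 0` is irrelevant). -/
def Psi {N : ℕ} [NeZero N] (P : SiteParams) (S : Amplitudes) :
    (n : ℕ) → (Fin n → ZMod N) → States N n
  | 0, _ => 0
  | 1, ρ => fun γ => psiSite P S 1 (ρ 0) (γ 0)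
  | m + 2, ρ => fun γ => ∑ σ : Fin (m + 1) → ZMod N, ∑ τ : ZMod N,
      kernelQ P S m σ τ ρ * Psi P S (m + 1) σ (Fin.init γ) *
        psiSite P S (m + 2) τ (γ (Fin.last (m + 1)))

/-- The Fourier transform `Ψ̃_{ρ,𝛒'_n} = ∑_{ρ_{n,0}} ω^{-ρ ρ_{n,0}} Ψ_{𝛒_n}`, `n = M + 1`,
`𝛒'_n = (ρ_{n,1}, …, ρ_{n,n-1})`. -/
def PsiTilde {N : ℕ} [NeZero N] (P : SiteParams) (S : Amplitudes) (M : ℕ) (ρ : ZMod N)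
    (ρ' : Fin M → ZMod N) : States N (M + 1) :=
  ∑ ρ₀ : ZMod N, omPow (-(ρ * ρ₀)) • Psi P S (M + 1) (Fin.cons ρ₀ ρ')

/-- `λ_{n,k} = -r_{n,k} ω^{-ρ_{n,k}}` as a function of `ρ_{n,k}`. -/
def lam {N : ℕ} (S : Amplitudes) (n k : ℕ) (j : ZMod N) : ℂ := -S.r n k * omPow (-j)

/-- The factor `φ̃_k(𝛒'_n)` for `n = M + 1`; the index `k : Fin M` stands for the root with
number `k + 1`. -/
def phiTilde {N : ℕ} (P : SiteParams) (S : Amplitudes) (M : ℕ) (k : Fin M)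
    (ρ' : Fin M → ZMod N) : ℂ :=
  -(S.rs (M + 1) / S.rt M) *
    (omPow (∑ i, ρ' i - 1) / ∏ s ∈ Finset.Ico 1 M, S.y (M + 1) (k + 1) M s) *
    ∏ m ∈ Finset.Icc 1 M, F N P m (lam S (M + 1) (k + 1) (ρ' k))

/-! ### Separation of variables and the Baxter equations -/

/-- The Sklyanin weight `∏_{s ≠ s'} w_{p_{n,s}^{n,s'}}(ρ_{n,s} - ρ_{n,s'})` for `n = M + 1`. -/
def sklyanin {N : ℕ} (S : Amplitudes) (M : ℕ) (ρ' : Fin M → ZMod N) : ℂ :=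
  ∏ s : Fin M, ∏ s' ∈ Finset.univ.erase s,
    cyc (ptRatio S (M + 1) (s' + 1) (M + 1) (s + 1)) (ρ' s - ρ' s')

/-- The vector `∑_{𝛒'} Q(𝛒') Ψ̃_{ρ,𝛒'}`. -/
def combine {N : ℕ} [NeZero N] (P : SiteParams) (S : Amplitudes) (M : ℕ) (ρ : ZMod N)
    (Q : (Fin M → ZMod N) → ℂ) : States N (M + 1) :=
  ∑ ρ' : Fin M → ZMod N, Q ρ' • PsiTilde P S M ρ ρ'

/-- The constant `χ_k`, for an `n`-site chain. -/
def chi (S : Amplitudes) (n k : ℕ) : ℂ :=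
  S.r n 0 * S.rt (n - 1) / (S.rs n * S.rt n) *
    (∏ s ∈ (Finset.Ico 1 n).erase k, S.y n s n k / S.y n k n s) *
    ∏ s ∈ Finset.Ico 1 (n - 1), S.y n k (n - 1) s

/-- `Δ₊(λ) = (ω^ρ / χ_k) (λ/ω)^{1-n} ∏_{m=1}^{n-1} F_m(λ/ω)`. -/
def deltaPlus {N : ℕ} (P : SiteParams) (S : Amplitudes) (n k : ℕ) (ρ : ZMod N) (l : ℂ) : ℂ :=
  omPow ρ / chi S n k * (l / omega N) ^ (1 - (n : ℤ)) *
    ∏ m ∈ Finset.Ico 1 n, F N P m (l / omega N)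

/-- `Δ₋(λ) = χ_k (λ/ω)^{n-1} F_n(λ/ω)`. -/
def deltaMinus (N : ℕ) (P : SiteParams) (S : Amplitudes) (n k : ℕ) (l : ℂ) : ℂ :=
  chi S n k * (l / omega N) ^ (n - 1) * F N P n (l / omega N)

/-- The solutions `q̃_k : ℤ/N → ℂ` of the `k`-th Baxter equation
`t(λ_{n,k}) q̃(ρ_{n,k}) = Δ₊(λ_{n,k}) q̃(ρ_{n,k} + 1) + Δ₋(ω λ_{n,k}) q̃(ρ_{n,k} - 1)`. -/
def baxterSpace {N : ℕ} (P : SiteParams) (S : Amplitudes) (n k : ℕ) (ρ : ZMod N) (t : ℂ → ℂ) :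
    Submodule ℂ (ZMod N → ℂ) where
  carrier := {q | ∀ j : ZMod N, t (lam S n k j) * q j =
    deltaPlus P S n k ρ (lam S n k j) * q (j + 1) +
      deltaMinus N P S n k (omega N * lam S n k j) * q (j - 1)}
  zero_mem' := by intro j; simp
  add_mem' := by
    intro p q hp hq j
    have h1 := hp j
    have h2 := hq j
    simp only [Pi.add_apply, mul_add]
    rw [h1, h2]
    ring
  smul_mem' := by
    intro z q hq j
    have h1 := hq j
    simp only [Pi.smul_apply, smul_eq_mul]
    rw [mul_left_comm, h1]
    ring

/-- `E(λ) = E₀ + E₁ λ + ⋯ + E_n λⁿ` with `E₀ = 1 + ω^ρ ∏ b_m d_m / κ_m` and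
`E_n = ∏ a_m c_m + ω^ρ ∏ κ_m`. -/
def IsEigenPoly {N : ℕ} (P : SiteParams) (n : ℕ) (ρ : ZMod N) (E : Polynomial ℂ) : Prop :=
  E.natDegree ≤ n ∧
  E.coeff 0 = 1 + omPow ρ * ∏ m ∈ Finset.Icc 1 n, P.b m * P.d m / P.κ m ∧
  E.coeff n = (∏ m ∈ Finset.Icc 1 n, P.a m * P.c m) + omPow ρ * ∏ m ∈ Finset.Icc 1 n, P.κ m

/-- The common eigenspace of `𝐕ₙ` with eigenvalue `ω^ρ` and of all `tₙ(λ)` with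
eigenvalues `t(λ)`. -/
def jointEigenspace {N : ℕ} (P : SiteParams) (n : ℕ) (ρ : ZMod N) (t : ℂ → ℂ) :
    Submodule ℂ (States N n) :=
  (chargeOp N n).eigenspace (omPow ρ) ⊓ ⨅ l : ℂ, (transfer N n P l).eigenspace (t l)

end

end BBS

open BBS

namespace BBS

/-! ### Roots of unity and the cyclic function -/

section Cyclic

variable {N : ℕ} [NeZero N]

/-! The theorem rests on a description of $A_n$, $B_n$, $D_n$ on the vectors $\Psi$ by their values
at finitely many points. As polynomials in $\lambda$, $A_n$ and $D_n$ have degree $n$ and explicit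
extreme coefficients built from $1$ and $\mathbf V_n$ (`monodromy_polyEnds`), so on a vector $\Psi$
they are fixed by their values at the $n-1$ nodes $\lambda_{n,k}$, the zeros of the eigenvalue of
$B_n(\lambda)/\lambda$ (`PolyEnds.eq_interp`).

By induction on the number of sites (`ActsOnPsi`), $\mathbf V$ shifts $\rho_0$, $B$ is diagonal, and
$A$ at the $k$-th node shifts $\rho_k$. For the inductive step, $\psi_\tau$ is an eigenvector of the
entry $u^{-1}(a-bv)$ of the new L-operator and $v$ shifts $\tau$. The eigenvalue equation for $B$
thus becomes a scalar polynomial identity for the kernel $Q$, which is checked at both ends and at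
the old nodes (`kernelQ_sub_tau`, `kernelQ_sub_zero`, `kernelQ_node`, combined in `opB_recursion`).
These three relations are the recursions of the functions $w_p$. At a zero of the new eigenvalue the
same identity expresses $A$ of the shorter chain through its $B$, which gives the shift by $A$ of
the longer chain (`ActsOnPsi.A_succ`).

The recursions of $w_p$ need points on the Fermat curve with nonzero $y$. For the points that are
not on it by choice, the curve equation comes from the classical chain: from the extreme
coefficients of the recursion for $\mathcal B_m$ (`classicalB_ends`), and from the relation between
$\mathcal B_{m+1}$, $\mathcal B_{m-1}$ and $\det\mathcal L_m$ at a zero of $\mathcal B_m$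
(`yPlain_pow`).

No exchange relations beyond the quantum determinant are used. Its column form is the first claim.
Its row form, applied to $\Psi$ with $\rho_k$ lowered, where the $B$ term vanishes, gives $D$ at the
nodes (`opD_nodes`). Distinct eigenvalues of $B$ and the nonvanishing of $Q$ make the $\Psi$ a
basis, and the Fourier transform in $\rho_0$ diagonalises $\mathbf V_n$.

For fixed charge, each coefficient of $\mathbf t_n(\lambda)\Phi$ is a polynomial whose extreme
coefficients already agree with those of $t(\lambda)Q$ by $(*)$. The eigenvalue equation is
therefore equivalent to its values at the nodes, and multiplication by the Sklyanin weight turns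
these into $(**)$ (`sklyanin_mul_transferCoeff`, `transfer_combine_iff`). The $k$-th equation
involves only the $k$-th variable, so the solutions form the tensor product of the spaces $\mathcal
S_k$ (`mem_span_sepProd`), and all statements about separation follow. -/

theorem omPow_add (i j : ZMod N) : omPow (i + j) = omPow i * omPow j := by
  simp only [omPow_eq_stdAddChar, AddChar.map_add_eq_mul]

theorem omPow_zero : omPow (0 : ZMod N) = 1 := by
  simp only [omPow_eq_stdAddChar, AddChar.map_zero_eq_one]

theorem omPow_ne_zero (j : ZMod N) : omPow j ≠ 0 :=
  pow_ne_zero _ (omega_isPrimitiveRoot.ne_zero (NeZero.ne N))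

theorem omPow_neg (j : ZMod N) : omPow (-j) = (omPow j)⁻¹ := by
  refine eq_inv_of_mul_eq_one_left ?_
  rw [← omPow_add, neg_add_cancel, omPow_zero]

theorem omPow_sub (i j : ZMod N) : omPow (i - j) = omPow i / omPow j := by
  rw [sub_eq_add_neg, omPow_add, omPow_neg, div_eq_mul_inv]

theorem omPow_one : omPow (1 : ZMod N) = omega N := by
  by_cases h : N = 1
  · subst h
    simp [omPow, omega, Subsingleton.elim (1 : ZMod 1) 0]
  · have : Fact (1 < N) := ⟨by have := NeZero.ne N; omega⟩
    rw [omPow, ZMod.val_one, pow_one]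

theorem omega_ne_zero : omega N ≠ 0 := omega_isPrimitiveRoot.ne_zero (NeZero.ne N)

theorem omPow_pow (j : ZMod N) : omPow j ^ N = 1 := by
  rw [omPow, ← pow_mul, mul_comm, pow_mul, omega_isPrimitiveRoot.pow_eq_one, one_pow]

theorem omPow_injective : Function.Injective (omPow : ZMod N → ℂ) := by
  intro i j h
  exact ZMod.val_injective N (omega_isPrimitiveRoot.pow_inj (ZMod.val_lt i) (ZMod.val_lt j) h)

theorem omPow_sum {ι : Type*} (s : Finset ι) (f : ι → ZMod N) :
    omPow (∑ i ∈ s, f i) = ∏ i ∈ s, omPow (f i) := by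
  classical
  induction s using Finset.induction_on with
  | empty => simp [omPow_zero]
  | insert a s ha ih => rw [Finset.sum_insert ha, Finset.prod_insert ha, omPow_add, ih]

/-- A finite point of the Fermat curve `x ^ N + y ^ N = 1` with `y ≠ 0`. -/
def IsFermat (N : ℕ) (p : ℂ × ℂ) : Prop := p.1 ^ N + p.2 ^ N = 1 ∧ p.2 ≠ 0

variable {p : ℂ × ℂ}

/-- If $\omega^jx=1$ then $x^N=1$, and the curve equation forces $y=0$. Hence no denominator of
$w_p$ vanishes. -/
theorem IsFermat.one_sub_ne (hp : IsFermat N p) (j : ZMod N) : 1 - omPow j * p.1 ≠ 0 := by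
  intro h
  have h1 : (omPow j * p.1) ^ N = 1 := by rw [← sub_eq_zero.mp h, one_pow]
  rw [mul_pow, omPow_pow, one_mul] at h1
  have h2 := hp.1
  rw [h1] at h2
  exact hp.2 ((pow_eq_zero_iff (NeZero.ne N)).mp (by simpa using h2))

theorem IsFermat.cyc_ne (hp : IsFermat N p) (j : ZMod N) : cyc p j ≠ 0 := by
  refine Finset.prod_ne_zero_iff.mpr fun i _ => div_ne_zero hp.2 ?_
  have h := hp.one_sub_ne ((i + 1 : ℕ) : ZMod N)
  have h2 : omega N ^ ((i + 1) % N) = omega N ^ (i + 1) := by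
    conv_rhs => rw [← Nat.mod_add_div (i + 1) N, pow_add, pow_mul,
      omega_isPrimitiveRoot.pow_eq_one, one_pow, mul_one]
  rwa [omPow, ZMod.val_natCast, h2] at h

theorem IsFermat.cyc_sub_one (hp : IsFermat N p) (j : ZMod N) :
    cyc p (j - 1) = cyc p j * ((1 - omPow j * p.1) / p.2) := by
  rw [← mul_div_assoc, cyc_rec p hp.1 hp.2, mul_div_cancel_left₀ _ hp.2]

theorem IsFermat.cyc_add_one (hp : IsFermat N p) (j : ZMod N) :
    cyc p (j + 1) = cyc p j * (p.2 / (1 - omPow (j + 1) * p.1)) := by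
  have h := cyc_rec p hp.1 hp.2 (j + 1)
  rw [add_sub_cancel_right] at h
  rw [← mul_div_assoc, eq_div_iff (hp.one_sub_ne _), h, mul_comm]

theorem lam_sub_one (S : Amplitudes) (n k : ℕ) (j : ZMod N) :
    lam S n k (j - 1) = omega N * lam S n k j := by
  rw [lam, lam, neg_sub, omPow_sub, omPow_neg, omPow_one]
  ring

theorem lam_add_one (S : Amplitudes) (n k : ℕ) (j : ZMod N) :
    lam S n k (j + 1) = lam S n k j / omega N := by
  have h := lam_sub_one S n k (j + 1)
  rw [add_sub_cancel_right] at h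
  rw [h, mul_div_cancel_left₀ _ omega_ne_zero]

/-- This explains the sign $\epsilon$ in $\mathcal B_m$: the nodes are exactly the $N$-th roots of
its nonzero zeros, in the variable $\Lambda=\lambda^N$. -/
theorem lam_pow (S : Amplitudes) (n k : ℕ) (j : ZMod N) :
    lam S n k j ^ N = eps N * S.r n k ^ N := by
  rw [lam, mul_pow, omPow_pow, mul_one, neg_pow, eps]

theorem lam_ne_zero {S : Amplitudes} {n k : ℕ} (h : S.r n k ≠ 0) (j : ZMod N) :
    lam S n k j ≠ 0 :=
  mul_ne_zero (neg_ne_zero.mpr h) (omPow_ne_zero _)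

omit [NeZero N] in
theorem eps_mul_eps : eps N * eps N = 1 := by
  rw [eps, ← mul_pow]; norm_num

theorem lam_ne_of_pow_ne {S : Amplitudes} {n k k' : ℕ} (h : S.r n k ^ N ≠ S.r n k' ^ N)
    (i j : ZMod N) : lam S n k i ≠ lam S n k' j := by
  intro h1
  apply h
  have h2 : lam S n k i ^ N = lam S n k' j ^ N := by rw [h1]
  rw [lam_pow, lam_pow] at h2
  linear_combination eps N * h2 - (S.r n k ^ N - S.r n k' ^ N) * eps_mul_eps (N := N)

end Cyclic

/-! ### Polynomial families and interpolation -/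

section Interpolation

variable {V W : Type*} [AddCommGroup V] [Module ℂ V] [AddCommGroup W] [Module ℂ W]

/-- `X` is a polynomial of degree at most `n` with coefficients in `V`, constant term `x₀` and
coefficient `xₙ` at degree `n`. -/
def PolyEnds (n : ℕ) (X : ℂ → V) (x₀ xₙ : V) : Prop :=
  ∃ c : ℕ → V, c 0 = x₀ ∧ c n = xₙ ∧ ∀ l, X l = ∑ i ∈ Finset.range (n + 1), l ^ i • c i

theorem PolyEnds.const (x : V) : PolyEnds 0 (fun _ => x) x x :=
  ⟨fun _ => x, rfl, rfl, fun l => by simp⟩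

theorem PolyEnds.congr {n : ℕ} {X Y : ℂ → V} {x₀ xₙ y₀ yₙ : V} (h : PolyEnds n X x₀ xₙ)
    (hX : ∀ l, X l = Y l) (h₀ : x₀ = y₀) (hₙ : xₙ = yₙ) : PolyEnds n Y y₀ yₙ := by
  obtain rfl : X = Y := funext hX
  rwa [← h₀, ← hₙ]

theorem PolyEnds.add {n : ℕ} {X Y : ℂ → V} {x₀ xₙ y₀ yₙ : V} (hX : PolyEnds n X x₀ xₙ)
    (hY : PolyEnds n Y y₀ yₙ) : PolyEnds n (fun l => X l + Y l) (x₀ + y₀) (xₙ + yₙ) := by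
  obtain ⟨c, h0, hn, h⟩ := hX
  obtain ⟨d, g0, gn, g⟩ := hY
  refine ⟨fun i => c i + d i, by simp only [h0, g0], by simp only [hn, gn], fun l => ?_⟩
  simp only [h, g]
  rw [ ← Finset.sum_add_distrib]
  simp only [smul_add]

theorem PolyEnds.map {n : ℕ} {X : ℂ → V} {x₀ xₙ : V} (hX : PolyEnds n X x₀ xₙ) (φ : V →ₗ[ℂ] W) :
    PolyEnds n (fun l => φ (X l)) (φ x₀) (φ xₙ) := by
  obtain ⟨c, h0, hn, h⟩ := hX
  refine ⟨fun i => φ (c i), by simp only [h0], by simp only [hn], fun l => ?_⟩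
  simp only [h, map_sum, map_smul]

theorem PolyEnds.sum {ι : Type*} {n : ℕ} (s : Finset ι) {X : ι → ℂ → V} {x₀ xₙ : ι → V}
    (hX : ∀ i ∈ s, PolyEnds n (X i) (x₀ i) (xₙ i)) :
    PolyEnds n (fun l => ∑ i ∈ s, X i l) (∑ i ∈ s, x₀ i) (∑ i ∈ s, xₙ i) := by
  classical
  induction s using Finset.induction_on with
  | empty => exact ⟨fun _ => 0, by simp, by simp, by simp⟩
  | insert a s ha ih =>
    refine ((hX a (Finset.mem_insert_self _ _)).add
      (ih fun i hi => hX i (Finset.mem_insert_of_mem hi))).congr (fun l => ?_) ?_ ?_ <;>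
    rw [Finset.sum_insert ha]

theorem PolyEnds.mul_linear {R : Type*} [Ring R] [Algebra ℂ R] {n : ℕ} {X : ℂ → R} {x₀ xₙ : R}
    (hX : PolyEnds n X x₀ xₙ) (Z Y : R) :
    PolyEnds (n + 1) (fun l => X l * (Z + l • Y)) (x₀ * Z) (xₙ * Y) := by
  obtain ⟨c, h0, hn, h⟩ := hX
  -- The coefficients of a product. The cut-offs are needed because $c_i$ is arbitrary for $i>n$ and
  -- because $i-1$ is truncated at $i=0$.
  refine ⟨fun i => (if i ≤ n then c i * Z else 0) + (if i = 0 then 0 else c (i - 1) * Y),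
    by simp [h0], by simp [hn], fun l => ?_⟩
  simp only [smul_add, Finset.sum_add_distrib]
  rw [Finset.sum_range_succ, Finset.sum_range_succ' (fun i => l ^ i • ite (i = 0) _ _), h, mul_add,
    Finset.sum_mul, Finset.sum_mul]
  congr 1
  · rw [if_neg (by omega), smul_zero, add_zero]
    refine Finset.sum_congr rfl fun i hi => ?_
    rw [if_pos (Nat.lt_succ_iff.mp (Finset.mem_range.mp hi)), smul_mul_assoc]
  · simp only [if_true, smul_zero, add_zero, Nat.succ_ne_zero, if_false, Nat.add_sub_cancel]
    refine Finset.sum_congr rfl fun i _ => ?_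
    rw [smul_mul_smul_comm, pow_succ]

theorem PolyEnds.prod {ι : Type*} (s : Finset ι) (z : ι → ℂ) :
    PolyEnds s.card (fun l => ∏ i ∈ s, (l - z i)) (∏ i ∈ s, (-z i)) 1 := by
  classical
  induction s using Finset.induction_on with
  | empty => simpa using PolyEnds.const (1 : ℂ)
  | insert a s ha ih =>
    rw [Finset.card_insert_of_notMem ha]
    refine (ih.mul_linear (-z a) 1).congr (fun l => ?_) ?_ (by ring)
    · rw [Finset.prod_insert ha, smul_eq_mul]; ring
    · rw [Finset.prod_insert ha]; ring

/-- With both extreme coefficients gone, $X(\lambda)/\lambda$ has degree less than $M$ and $M$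
distinct zeros. -/
theorem PolyEnds.eq_zero {M : ℕ} {X : ℂ → ℂ} (h : PolyEnds (M + 1) X 0 0) {z : Fin M → ℂ}
    (hz : Function.Injective z) (hz0 : ∀ k, z k ≠ 0) (hX : ∀ k, X (z k) = 0) (l : ℂ) :
    X l = 0 := by
  obtain ⟨c, h0, hn, h⟩ := h
  have h' : ∀ l, X l = l * (∑ i ∈ Finset.range M, Polynomial.C (c (i + 1)) *
      Polynomial.X ^ i).eval l := by
    intro l
    rw [h, Finset.sum_range_succ, hn, Finset.sum_range_succ', h0, Polynomial.eval_finsetSum,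
      Finset.mul_sum]
    simp only [Polynomial.eval_mul, Polynomial.eval_C, Polynomial.eval_pow,
      Polynomial.eval_X, smul_eq_mul, mul_zero, add_zero]
    refine Finset.sum_congr rfl fun i _ => by ring
  have hq := Polynomial.eq_zero_of_degree_lt_of_eval_index_eq_zero
    (f := ∑ i ∈ Finset.range M, Polynomial.C (c (i + 1)) * Polynomial.X ^ i)
    (v := z) (s := Finset.univ) hz.injOn ?_ ?_
  · rw [h', hq, Polynomial.eval_zero, mul_zero]
  · rw [Finset.card_univ, Fintype.card_fin]
    refine lt_of_le_of_lt (Polynomial.degree_sum_le _ _)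
      ((Finset.sup_lt_iff (WithBot.bot_lt_coe M)).mpr fun i hi => ?_)
    exact lt_of_le_of_lt (Polynomial.degree_C_mul_X_pow_le _ _)
      (Nat.cast_lt.mpr (Finset.mem_range.mp hi))
  · intro k _
    have := hX k
    rw [h'] at this
    exact (mul_eq_zero.mp this).resolve_left (hz0 k)

/-- The polynomial of degree `M + 1` with values `v k` at `z k`, constant term `x₀` and
leading coefficient `xₙ`. -/
noncomputable def interp {M : ℕ} (z : Fin M → ℂ) (v : Fin M → V) (x₀ xₙ : V) (l : ℂ) : V :=
  ∑ k, ((∏ s ∈ Finset.univ.erase k, (l - z s) / (z k - z s)) * (l / z k)) • v k +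
    (∏ s, (1 - l / z s)) • x₀ + (l * ∏ s, (l - z s)) • xₙ

theorem interp_map {M : ℕ} (z : Fin M → ℂ) (v : Fin M → V) (x₀ xₙ : V) (l : ℂ) (φ : V →ₗ[ℂ] W) :
    φ (interp z v x₀ xₙ l) = interp z (fun k => φ (v k)) (φ x₀) (φ xₙ) l := by
  simp only [interp, map_add, map_sum, map_smul]

theorem polyEnds_interp {M : ℕ} {z : Fin M → ℂ} (hz0 : ∀ k, z k ≠ 0) (v : Fin M → ℂ) (x₀ xₙ : ℂ) :
    PolyEnds (M + 1) (interp z v x₀ xₙ) x₀ xₙ := by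
  have h1 : ∀ k ∈ (Finset.univ : Finset (Fin M)), PolyEnds (M + 1) (fun l =>
      ((∏ s ∈ Finset.univ.erase k, (l - z s) / (z k - z s)) * (l / z k)) • v k) 0 0 := by
    intro k _
    have h := ((PolyEnds.prod (Finset.univ.erase k) z).mul_linear 0 1).mul_linear
      ((∏ s ∈ Finset.univ.erase k, (z k - z s))⁻¹ * (z k)⁻¹ * v k) 0
    rw [Finset.card_erase_of_mem (Finset.mem_univ k), Finset.card_univ, Fintype.card_fin,
      Nat.sub_add_cancel (by have := k.2; omega)] at h
    refine h.congr (fun l => ?_) (by ring) (by ring)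
    rw [Finset.prod_div_distrib]
    simp only [smul_eq_mul]
    ring
  have h2 := (PolyEnds.prod Finset.univ z).mul_linear ((∏ s, (-z s))⁻¹ * x₀) 0
  have h3 := (PolyEnds.prod Finset.univ z).mul_linear 0 xₙ
  rw [Finset.card_univ, Fintype.card_fin] at h2 h3
  have hne : ∏ s, (-z s) ≠ 0 := Finset.prod_ne_zero_iff.mpr fun s _ => neg_ne_zero.mpr (hz0 s)
  refine (((PolyEnds.sum _ h1).add h2).add h3).congr (fun l => ?_) ?_ ?_
  · rw [interp]
    congr 1
    · congr 1
      have : ∏ s, (1 - l / z s) = (∏ s, (l - z s)) * (∏ s, (-z s))⁻¹ := by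
        rw [← Finset.prod_inv_distrib, ← Finset.prod_mul_distrib]
        refine Finset.prod_congr rfl fun s _ => ?_
        have := hz0 s
        field_simp
        ring
      rw [this]
      simp only [smul_eq_mul]
      ring
    · simp only [smul_eq_mul]
      ring
  · rw [Finset.sum_const_zero, mul_inv_cancel_left₀ hne]; ring
  · rw [Finset.sum_const_zero]; ring

theorem interp_node {M : ℕ} {z : Fin M → ℂ} (hz : Function.Injective z) (hz0 : ∀ k, z k ≠ 0)
    (v : Fin M → V) (x₀ xₙ : V) (k : Fin M) : interp z v x₀ xₙ (z k) = v k := by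
  rw [interp, Finset.prod_eq_zero (f := fun s => z k - z s) (Finset.mem_univ k) (sub_self (z k)),
    Finset.prod_eq_zero (f := fun s => 1 - z k / z s) (Finset.mem_univ k)
      (by rw [div_self (hz0 k), sub_self]), mul_zero, zero_smul, zero_smul, add_zero, add_zero,
    Finset.sum_eq_single k, Finset.prod_congr rfl (g := fun _ => (1 : ℂ)), Finset.prod_const_one,
    div_self (hz0 k), mul_one, one_smul]
  · intro s hs
    exact div_self (sub_ne_zero.mpr (hz.ne (Finset.ne_of_mem_erase hs).symm))
  · intro j _ hj
    rw [Finset.prod_eq_zero (i := k) (Finset.mem_erase.mpr ⟨hj.symm, Finset.mem_univ _⟩)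
      (by rw [sub_self, zero_div]), zero_mul, zero_smul]
  · intro h
    exact absurd (Finset.mem_univ k) h

theorem PolyEnds.eq_interp_scalar {M : ℕ} {X : ℂ → ℂ} {x₀ xₙ : ℂ}
    (h : PolyEnds (M + 1) X x₀ xₙ) {z : Fin M → ℂ} (hz : Function.Injective z)
    (hz0 : ∀ k, z k ≠ 0) (l : ℂ) : X l = interp z (fun k => X (z k)) x₀ xₙ l := by
  have h2 := (polyEnds_interp hz0 (fun k => X (z k)) x₀ xₙ).map (-LinearMap.id : ℂ →ₗ[ℂ] ℂ)
  have h3 := ((h.add h2).congr (fun l => rfl) (by simp) (by simp)).eq_zero hz hz0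
    (fun k => by simp [interp_node hz hz0]) l
  simpa [← sub_eq_add_neg, sub_eq_zero] using h3

theorem PolyEnds.eq_interp {ι : Type*} {M : ℕ} {X : ℂ → ι → ℂ} {x₀ xₙ : ι → ℂ}
    (h : PolyEnds (M + 1) X x₀ xₙ) {z : Fin M → ℂ} (hz : Function.Injective z)
    (hz0 : ∀ k, z k ≠ 0) (l : ℂ) : X l = interp z (fun k => X (z k)) x₀ xₙ l := by
  funext i
  let π := LinearMap.proj (R := ℂ) (φ := fun _ : ι => ℂ) i
  exact ((h.map π).eq_interp_scalar hz hz0 l).trans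
    (interp_map z (fun k => X (z k)) x₀ xₙ l π).symm

/-- Changing a node of an interpolation polynomial rescales the value at this node. -/
theorem interp_weight_shift {M : ℕ} {z : Fin M → ℂ} (hz : Function.Injective z)
    (hz0 : ∀ k, z k ≠ 0) (k : Fin M) (w l : ℂ) :
    (∏ s ∈ Finset.univ.erase k, (l - z s) / (w - z s)) * (l / w) =
      ((∏ s ∈ Finset.univ.erase k, (l - z s) / (z k - z s)) * (l / z k)) *
        ((∏ s ∈ Finset.univ.erase k, (z k - z s) / (w - z s)) * (z k / w)) := by
  rw [mul_mul_mul_comm, ← Finset.prod_mul_distrib]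
  congr 1
  · refine Finset.prod_congr rfl fun s hs => ?_
    rw [div_mul_div_cancel₀ (sub_ne_zero.mpr (hz.ne (Finset.ne_of_mem_erase hs).symm))]
  · rw [div_mul_div_cancel₀ (hz0 k)]

/-- The coefficients of the image of a combination of vectors which a polynomial family of
operators shifts along the elements of a group. -/
theorem sum_smul_interp_shift {G : Type*} [AddCommGroup G] [Fintype G] {M : ℕ}
    (z : G → Fin M → ℂ) (hz : ∀ x, Function.Injective (z x)) (hz0 : ∀ x k, z x k ≠ 0)
    (g : Fin M → G) (g₀ gₙ : G)
    (hg : ∀ x k s, s ≠ k → z (x + g k) s = z x s) (hg₀ : ∀ x, z (x + g₀) = z x)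
    (hgₙ : ∀ x, z (x + gₙ) = z x) (e : G → V) (f : G → Fin M → ℂ) (f₀ fₙ : ℂ) (Q : G → ℂ) (l : ℂ) :
    ∑ x, Q x • interp (z x) (fun k => f x k • e (x + g k)) (f₀ • e (x + g₀)) (fₙ • e (x + gₙ)) l =
      ∑ x, interp (z x) (fun k => ((∏ s ∈ Finset.univ.erase k,
          (z x k - z x s) / (z (x - g k) k - z x s)) * (z x k / z (x - g k) k)) *
            (f (x - g k) k * Q (x - g k)))
        (f₀ * Q (x - g₀)) (fₙ * Q (x - gₙ)) l • e x := by
  simp only [interp, smul_add, add_smul, Finset.sum_add_distrib, Finset.smul_sum, Finset.sum_smul]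
  congr 1
  · congr 1
    · rw [Finset.sum_comm, Finset.sum_comm (s := (Finset.univ : Finset G))]
      refine Finset.sum_congr rfl fun k _ => ?_
      -- Collecting the coefficient of a fixed vector moves the $k$-th node and no other. The
      -- Lagrange weight is then rewritten for the moved node, which produces the quotient in the
      -- statement.
      rw [← Equiv.sum_comp (Equiv.addRight (g k)) (fun x => (_ : ℂ) • e x)]
      refine Finset.sum_congr rfl fun x _ => ?_
      simp only [Equiv.coe_addRight, add_sub_cancel_right]
      rw [smul_eq_mul, ← mul_assoc]
      have h1 : ∀ s ∈ Finset.univ.erase k, z x s = z (x + g k) s := fun s hs =>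
        (hg x k s (Finset.ne_of_mem_erase hs)).symm
      have h2 : ∏ s ∈ Finset.univ.erase k, (l - z x s) / (z x k - z x s) =
          ∏ s ∈ Finset.univ.erase k, (l - z (x + g k) s) / (z x k - z (x + g k) s) :=
        Finset.prod_congr rfl fun s hs => by rw [h1 s hs]
      rw [h2, ← interp_weight_shift (hz _) (hz0 _), smul_smul, smul_smul]
      congr 1
      ring
    · rw [← Equiv.sum_comp (Equiv.addRight g₀) (fun x => (_ : ℂ) • e x)]
      refine Finset.sum_congr rfl fun x _ => ?_
      simp only [Equiv.coe_addRight, add_sub_cancel_right, hg₀, smul_smul, smul_eq_mul]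
      congr 1
      ring
  · rw [← Equiv.sum_comp (Equiv.addRight gₙ) (fun x => (_ : ℂ) • e x)]
    refine Finset.sum_congr rfl fun x _ => ?_
    simp only [Equiv.coe_addRight, add_sub_cancel_right, hgₙ, smul_smul, smul_eq_mul]
    congr 1
    ring

end Interpolation

/-! ### Quantum determinants of `2 × 2` matrices of operators -/

section QuantumDeterminant

variable {R : Type*} [Ring R] [Algebra ℂ R]

/-- The relations between the entries of `X' = L(ωλ)` and `X = L(λ)` in one column, with the
quantum determinant `q`. -/
structure ColumnRelations (X' X : Matrix (Fin 2) (Fin 2) R) (q : R) : Prop where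
  left : X' 0 0 * X 1 0 = X' 1 0 * X 0 0
  right : X' 0 1 * X 1 1 = X' 1 1 * X 0 1
  det : X' 0 0 * X 1 1 - X' 1 0 * X 0 1 = q
  det' : X' 1 1 * X 0 0 - X' 0 1 * X 1 0 = q

/-- The relations between the entries of `X = L(λ)` and `X' = L(ωλ)` in one row, with the
quantum determinant `q`. -/
structure RowRelations (w : ℂ) (X X' : Matrix (Fin 2) (Fin 2) R) (q : R) : Prop where
  top : X 0 0 * X' 0 1 = w • (X 0 1 * X' 0 0)
  bottom : X 1 0 * X' 1 1 = w • (X 1 1 * X' 1 0)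
  det : X 0 0 * X' 1 1 - w • (X 0 1 * X' 1 0) = q
  det' : w • (X 1 1 * X' 0 0) - X 1 0 * X' 0 1 = w • q

omit [Algebra ℂ R] in
theorem mul_mul_mul_of_commute {a b c d : R} (h : Commute b c) :
    a * b * (c * d) = a * c * (b * d) := by
  rw [mul_assoc, ← mul_assoc b, h.eq, mul_assoc, mul_assoc]

omit [Algebra ℂ R] in
-- Commuting entries of different sites brings the factors of one matrix together. Each relation of
-- the product then uses all four relations of the left factor and one of the right factor, so only
-- the four together are stable under products.
theorem ColumnRelations.mul {X' X Y' Y : Matrix (Fin 2) (Fin 2) R} {p q : R}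
    (hX : ColumnRelations X' X p) (hY : ColumnRelations Y' Y q)
    (h : ∀ i j i' j', Commute (X i j) (Y' i' j')) :
    ColumnRelations (X' * Y') (X * Y) (p * q) := by
  have hc : ∀ i j k l i' j' k' l', X' i j * Y' k l * (X i' j' * Y k' l') =
      X' i j * X i' j' * (Y' k l * Y k' l') := fun i j k l i' j' k' l' =>
    mul_mul_mul_of_commute (h i' j' k l).symm
  obtain ⟨x1, x2, x3, x4⟩ := hX
  obtain ⟨y1, y2, y3, y4⟩ := hY
  have x3' := sub_eq_iff_eq_add.mp x3
  have x4' := sub_eq_iff_eq_add.mp x4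
  have y3' := sub_eq_iff_eq_add.mp y3
  have y4' := sub_eq_iff_eq_add.mp y4
  constructor <;> simp only [Matrix.mul_apply, Fin.sum_univ_two, mul_add, add_mul, hc] <;>
    simp only [x1, x2, x3', x4', y1, y2, y3', y4', mul_add, add_mul] <;> abel

/-- The mirror image of the column case: each relation of the product uses all four relations of the
right factor and one of the left. -/
theorem RowRelations.mul {w : ℂ} {X' X Y' Y : Matrix (Fin 2) (Fin 2) R} {p q : R}
    (hX : RowRelations w X X' p) (hY : RowRelations w Y Y' q)
    (h : ∀ i j i' j', Commute (Y i j) (X' i' j')) :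
    RowRelations w (X * Y) (X' * Y') (p * q) := by
  have hc : ∀ i j k l i' j' k' l', X i j * Y k l * (X' i' j' * Y' k' l') =
      X i j * X' i' j' * (Y k l * Y' k' l') := fun i j k l i' j' k' l' =>
    mul_mul_mul_of_commute (h k l i' j')
  obtain ⟨x1, x2, x3, x4⟩ := hX
  obtain ⟨y1, y2, y3, y4⟩ := hY
  have x3' := sub_eq_iff_eq_add.mp x3
  have x4' := sub_eq_iff_eq_add.mp x4
  have y3' := sub_eq_iff_eq_add.mp y3
  have y4' : Y 1 0 * Y' 0 1 = w • (Y 1 1 * Y' 0 0) - w • q := by rw [← y4]; abel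
  have x4'' : w • (X 1 1 * X' 0 0) = w • p + X 1 0 * X' 0 1 := sub_eq_iff_eq_add.mp x4
  constructor <;> simp only [Matrix.mul_apply, Fin.sum_univ_two, mul_add, add_mul, hc, smul_add] <;>
    simp only [x1, x2, x3', y1, y2, y3', y4', mul_add, add_mul, mul_sub,
      smul_mul_assoc, mul_smul_comm, smul_add]
  · abel
  · abel
  · abel
  · simp only [← smul_mul_assoc, x4'', add_mul]
    abel

end QuantumDeterminant

/-! ### The one-site operators -/

section Operators

variable {N : ℕ} [NeZero N] {n : ℕ}

omit [NeZero N] in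
theorem uOp_apply (k : Fin n) (f : States N n) (γ : Fin n → ZMod N) :
    uOp k f γ = omPow (γ k) * f γ := rfl

omit [NeZero N] in
theorem uInvOp_apply (k : Fin n) (f : States N n) (γ : Fin n → ZMod N) :
    uInvOp k f γ = omPow (-(γ k)) * f γ := rfl

omit [NeZero N] in
theorem vOp_apply (k : Fin n) (f : States N n) (γ : Fin n → ZMod N) :
    vOp k f γ = f (γ - Pi.single k 1) := rfl

theorem lOp_columnRelations (P : SiteParams) (k : Fin n) (hκ : P.κ (k + 1) ≠ 0) (l : ℂ) :
    ColumnRelations (lOp (N := N) P k (omega N * l)) (lOp P k l) (F N P (k + 1) l • vOp k) := by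
  have hw := omega_ne_zero (N := N)
  constructor <;> refine LinearMap.ext fun f => funext fun γ => ?_ <;>
  · have hγ := omPow_ne_zero (γ k)
    simp [lOp, F, uOp_apply, uInvOp_apply, vOp_apply, omPow_sub, omPow_neg, omPow_one]
    field_simp
    ring

theorem lOp_rowRelations (P : SiteParams) (k : Fin n) (hκ : P.κ (k + 1) ≠ 0) (l : ℂ) :
    RowRelations (omega N) (lOp (N := N) P k l) (lOp P k (omega N * l))
      (F N P (k + 1) l • vOp k) := by
  have hw := omega_ne_zero (N := N)
  constructor <;> refine LinearMap.ext fun f => funext fun γ => ?_ <;>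
  · have hγ := omPow_ne_zero (γ k)
    simp [lOp, F, uOp_apply, uInvOp_apply, vOp_apply, omPow_sub, omPow_neg, omPow_one]
    field_simp
    ring

/-! ### Adding a site -/

/-- An operator on the first `n` sites as an operator on `n + 1` sites. -/
def liftOp : Module.End ℂ (States N n) →ₐ[ℂ] Module.End ℂ (States N (n + 1)) where
  toFun X :=
    { toFun := fun f γ => X (fun γ' => f (Fin.snoc γ' (γ (Fin.last n)))) (Fin.init γ)
      map_add' := fun f g => by
        funext γ
        exact congrFun (X.map_add (fun γ' => f (Fin.snoc γ' (γ (Fin.last n))))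
          (fun γ' => g (Fin.snoc γ' (γ (Fin.last n))))) _
      map_smul' := fun z f => by
        funext γ
        exact congrFun (X.map_smul z (fun γ' => f (Fin.snoc γ' (γ (Fin.last n))))) _ }
  map_one' := by
    refine LinearMap.ext fun f => funext fun γ => ?_
    simp
  map_mul' X Y := by
    refine LinearMap.ext fun f => funext fun γ => ?_
    simp
  map_zero' := by
    refine LinearMap.ext fun f => funext fun γ => ?_
    simp
  map_add' X Y := by
    refine LinearMap.ext fun f => funext fun γ => ?_
    simp
  commutes' z := by
    refine LinearMap.ext fun f => funext fun γ => ?_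
    simp [Module.algebraMap_end_apply]

omit [NeZero N] in
theorem liftOp_apply (X : Module.End ℂ (States N n)) (f : States N (n + 1))
    (γ : Fin (n + 1) → ZMod N) :
    liftOp X f γ = X (fun γ' => f (Fin.snoc γ' (γ (Fin.last n)))) (Fin.init γ) := rfl

omit [NeZero N] in
theorem snoc_sub_single_castSucc (γ : Fin n → ZMod N) (x : ZMod N) (k : Fin n) :
    (Fin.snoc γ x : Fin (n + 1) → ZMod N) - Pi.single k.castSucc 1 =
      Fin.snoc (γ - Pi.single k 1) x := by
  funext i
  refine Fin.lastCases ?_ (fun j => ?_) i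
  · simp [(Fin.castSucc_lt_last k).ne']
  · simp [Pi.single_apply]

omit [NeZero N] in
theorem snoc_sub_single_last (γ : Fin n → ZMod N) (x : ZMod N) :
    (Fin.snoc γ x : Fin (n + 1) → ZMod N) - Pi.single (Fin.last n) 1 = Fin.snoc γ (x - 1) := by
  funext i
  refine Fin.lastCases ?_ (fun j => ?_) i
  · simp
  · simp [(Fin.castSucc_lt_last j).ne]

omit [NeZero N] in
theorem init_sub_single_last (γ : Fin (n + 1) → ZMod N) :
    Fin.init (γ - Pi.single (Fin.last n) 1) = Fin.init γ := by
  funext j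
  simp [Fin.init, (Fin.castSucc_lt_last j).ne]

omit [NeZero N] in
theorem liftOp_vOp (k : Fin n) : liftOp (vOp k : Module.End ℂ (States N n)) = vOp k.castSucc := by
  refine LinearMap.ext fun f => funext fun γ => ?_
  rw [liftOp_apply, vOp_apply, vOp_apply]
  conv_rhs => rw [← Fin.snoc_init_self γ, snoc_sub_single_castSucc]

omit [NeZero N] in
theorem liftOp_uOp (k : Fin n) : liftOp (uOp k : Module.End ℂ (States N n)) = uOp k.castSucc := by
  refine LinearMap.ext fun f => funext fun γ => ?_
  rw [liftOp_apply, uOp_apply, uOp_apply, Fin.snoc_init_self]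
  rfl

omit [NeZero N] in
theorem liftOp_uInvOp (k : Fin n) :
    liftOp (uInvOp k : Module.End ℂ (States N n)) = uInvOp k.castSucc := by
  refine LinearMap.ext fun f => funext fun γ => ?_
  rw [liftOp_apply, uInvOp_apply, uInvOp_apply, Fin.snoc_init_self]
  rfl

omit [NeZero N] in
theorem liftOp_lOp (P : SiteParams) (k : Fin n) (l : ℂ) (i j : Fin 2) :
    liftOp (lOp (N := N) P k l i j) = lOp P k.castSucc l i j := by
  fin_cases i <;> fin_cases j <;>
    simp [lOp, liftOp_vOp, liftOp_uOp, liftOp_uInvOp]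

omit [NeZero N] in
theorem commute_liftOp_vOp (X : Module.End ℂ (States N n)) :
    Commute (liftOp X) (vOp (Fin.last n)) := by
  refine LinearMap.ext fun f => funext fun γ => ?_
  simp only [Module.End.mul_apply, liftOp_apply, vOp_apply, snoc_sub_single_last,
    init_sub_single_last, Pi.sub_apply, Pi.single_eq_same]

omit [NeZero N] in
theorem commute_liftOp_uOp (X : Module.End ℂ (States N n)) :
    Commute (liftOp X) (uOp (Fin.last n)) := by
  refine LinearMap.ext fun f => funext fun γ => ?_
  simp only [Module.End.mul_apply, liftOp_apply, uOp_apply, Fin.snoc_last]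
  exact congrFun (X.map_smul (omPow (γ (Fin.last n)))
    (fun γ' => f (Fin.snoc γ' (γ (Fin.last n))))) _

omit [NeZero N] in
theorem commute_liftOp_uInvOp (X : Module.End ℂ (States N n)) :
    Commute (liftOp X) (uInvOp (Fin.last n)) := by
  refine LinearMap.ext fun f => funext fun γ => ?_
  simp only [Module.End.mul_apply, liftOp_apply, uInvOp_apply, Fin.snoc_last]
  exact congrFun (X.map_smul (omPow (-γ (Fin.last n)))
    (fun γ' => f (Fin.snoc γ' (γ (Fin.last n))))) _

omit [NeZero N] in
theorem commute_liftOp_lOp (P : SiteParams) (X : Module.End ℂ (States N n)) (l : ℂ)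
    (i j : Fin 2) : Commute (liftOp X) (lOp P (Fin.last n) l i j) := by
  have hv := commute_liftOp_vOp X
  have hu := commute_liftOp_uOp X
  have hu' := commute_liftOp_uInvOp X
  have h1 := Commute.one_right (liftOp X)
  fin_cases i <;> fin_cases j <;> simp only [lOp, Fin.zero_eta, Fin.mk_one, Matrix.of_apply,
    Matrix.cons_val', Matrix.cons_val_zero, Matrix.cons_val_one, Matrix.cons_val_fin_one]
  · exact h1.add_right (hv.smul_right _)
  · exact (hu'.mul_right ((h1.smul_right _).sub_right (hv.smul_right _))).smul_right _
  · exact hu.mul_right ((h1.smul_right _).sub_right (hv.smul_right _))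
  · exact (h1.smul_right _).add_right (hv.smul_right _)

omit [NeZero N] in
theorem monodromy_succ (P : SiteParams) (l : ℂ) :
    monodromy N (n + 1) P l =
      (monodromy N n P l).map liftOp * lOp P (Fin.last n) l := by
  rw [monodromy, List.ofFn_succ', List.concat_eq_append, List.prod_append, List.prod_singleton]
  congr 1
  have h := map_list_prod (liftOp (N := N) (n := n)).toRingHom.mapMatrix
    (List.ofFn fun k : Fin n => lOp P k l)
  rw [List.map_ofFn] at h
  rw [monodromy]
  refine Eq.trans ?_ h.symm
  congr 2
  funext k
  refine Matrix.ext fun i j => ?_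
  exact (liftOp_lOp P k l i j).symm

omit [NeZero N] in
theorem chargeOp_succ :
    chargeOp N (n + 1) = liftOp (chargeOp N n) * vOp (Fin.last n) := by
  rw [chargeOp, List.ofFn_succ', List.concat_eq_append, List.prod_append, List.prod_singleton,
    chargeOp, map_list_prod, List.map_ofFn]
  congr 3
  funext k
  exact (liftOp_vOp k).symm

omit [NeZero N] in
theorem ColumnRelations.map_liftOp {X' X : Matrix (Fin 2) (Fin 2) (Module.End ℂ (States N n))}
    {q : Module.End ℂ (States N n)} (h : ColumnRelations X' X q) :
    ColumnRelations (X'.map liftOp) (X.map liftOp) (liftOp q) := by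
  obtain ⟨h1, h2, h3, h4⟩ := h
  constructor <;> simp only [Matrix.map_apply, ← map_mul, ← map_sub, h1, h2, h3, h4]

omit [NeZero N] in
theorem RowRelations.map_liftOp {w : ℂ}
    {X' X : Matrix (Fin 2) (Fin 2) (Module.End ℂ (States N n))}
    {q : Module.End ℂ (States N n)} (h : RowRelations w X X' q) :
    RowRelations w (X.map liftOp) (X'.map liftOp) (liftOp q) := by
  obtain ⟨h1, h2, h3, h4⟩ := h
  constructor <;> simp only [Matrix.map_apply, ← map_mul, ← map_smul, ← map_sub, h1, h2, h3, h4]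

/-- Multiplicativity over the sites. The column form contains the quantum determinant
$A(\omega\lambda)D(\lambda)-C(\omega\lambda)B(\lambda)$; the row form contains
$D(\lambda)A(\omega\lambda)$, in which $A$ and $B$ act first, as is needed to find $D$ from them. -/
theorem monodromy_relations (P : SiteParams) (l : ℂ) (n : ℕ)
    (hκ : ∀ k ∈ Finset.Icc 1 n, P.κ k ≠ 0) :
    ColumnRelations (monodromy N n P (omega N * l)) (monodromy N n P l)
        ((∏ m ∈ Finset.Icc 1 n, F N P m l) • chargeOp N n) ∧
      RowRelations (omega N) (monodromy N n P l) (monodromy N n P (omega N * l))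
        ((∏ m ∈ Finset.Icc 1 n, F N P m l) • chargeOp N n) := by
  induction n with
  | zero => constructor <;> constructor <;> simp [monodromy, chargeOp]
  | succ n ih =>
    obtain ⟨h1, h2⟩ := ih fun k hk => hκ k (by simp only [Finset.mem_Icc] at hk ⊢; omega)
    have hκ' : P.κ ((Fin.last n : ℕ) + 1) ≠ 0 := hκ _ (by simp)
    have hq : (∏ m ∈ Finset.Icc 1 (n + 1), F N P m l) • chargeOp N (n + 1) =
        liftOp ((∏ m ∈ Finset.Icc 1 n, F N P m l) • chargeOp N n) *
          (F N P ((Fin.last n : ℕ) + 1) l • vOp (Fin.last n)) := by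
      rw [Finset.prod_Icc_succ_top (by omega), chargeOp_succ, map_smul, smul_mul_smul_comm,
        Fin.val_last]
    rw [hq, monodromy_succ, monodromy_succ]
    exact ⟨h1.map_liftOp.mul (lOp_columnRelations P _ hκ' l)
        (fun i j i' j' => commute_liftOp_lOp P _ _ _ _),

      h2.map_liftOp.mul (lOp_rowRelations P _ hκ' l)
        (fun i j i' j' => (commute_liftOp_lOp P _ _ _ _).symm)⟩

/-! ### Degrees in the spectral parameter -/

omit [NeZero N] in
theorem lOp_eq_linear (P : SiteParams) (k : Fin n) (l : ℂ) :
    lOp (N := N) P k l 0 0 = 1 + l • (P.κ (k + 1) • vOp k) ∧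
    lOp (N := N) P k l 0 1 =
      0 + l • (uInvOp k * (P.a (k + 1) • 1 - P.b (k + 1) • vOp k)) ∧
    lOp (N := N) P k l 1 0 = uOp k * (P.c (k + 1) • 1 - P.d (k + 1) • vOp k) + l • 0 ∧
    lOp (N := N) P k l 1 1 = (P.b (k + 1) * P.d (k + 1) / P.κ (k + 1)) • vOp k +
      l • ((P.a (k + 1) * P.c (k + 1)) • 1) := by
  refine ⟨?_, ?_, ?_, ?_⟩
  · simp [lOp, mul_smul]
  · simp [lOp]
  · simp [lOp]
  · simp only [lOp, Matrix.of_apply, Matrix.cons_val', Matrix.cons_val_one,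
      Matrix.cons_val_fin_one, smul_smul, ← mul_assoc]
    rw [add_comm]

omit [NeZero N] in
-- The vanishing ends of $B$ and $C$ carry the induction: since $B$ has no constant term and $C$ no
-- top term, the extreme coefficients of $A$ and $D$ are products of those of the single sites.
theorem monodromy_polyEnds (P : SiteParams) (n : ℕ) :
    PolyEnds n (opA N n P) 1 ((∏ m ∈ Finset.Icc 1 n, P.κ m) • chargeOp N n) ∧
    (∃ x, PolyEnds n (opB N n P) 0 x) ∧ (∃ x, PolyEnds n (opC N n P) x 0) ∧
    PolyEnds n (opD N n P) ((∏ m ∈ Finset.Icc 1 n, P.b m * P.d m / P.κ m) • chargeOp N n)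
      ((∏ m ∈ Finset.Icc 1 n, P.a m * P.c m) • 1) := by
  induction n with
  | zero =>
    refine ⟨(PolyEnds.const 1).congr (fun l => ?_) ?_ ?_,
      ⟨0, (PolyEnds.const 0).congr (fun l => ?_) rfl rfl⟩,
      ⟨0, (PolyEnds.const 0).congr (fun l => ?_) rfl rfl⟩,
      (PolyEnds.const 1).congr (fun l => ?_) ?_ ?_⟩ <;>
    simp [opA, opB, opC, opD, monodromy, chargeOp]
  | succ n ih =>
    obtain ⟨hA, ⟨x, hB⟩, ⟨y, hC⟩, hD⟩ := ih
    have hl := lOp_eq_linear (N := N) P (Fin.last n)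
    have key : ∀ (i j : Fin 2) {x₀ xₙ y₀ yₙ : Module.End ℂ (States N n)}
        {Z Y Z' Y' : Module.End ℂ (States N (n + 1))},
        PolyEnds n (fun l => monodromy N n P l i 0) x₀ xₙ →
        PolyEnds n (fun l => monodromy N n P l i 1) y₀ yₙ →
        (∀ l, lOp P (Fin.last n) l 0 j = Z + l • Y) →
        (∀ l, lOp P (Fin.last n) l 1 j = Z' + l • Y') →
        PolyEnds (n + 1) (fun l => monodromy N (n + 1) P l i j)
          (liftOp x₀ * Z + liftOp y₀ * Z') (liftOp xₙ * Y + liftOp yₙ * Y') := by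
      intro i j x₀ xₙ y₀ yₙ Z Y Z' Y' hx hy hZ hZ'
      refine (((hx.map (liftOp (N := N) (n := n)).toLinearMap).mul_linear Z Y).add
        ((hy.map (liftOp (N := N) (n := n)).toLinearMap).mul_linear Z' Y')).congr
        (fun l => ?_) rfl rfl
      rw [monodromy_succ, Matrix.mul_apply, Fin.sum_univ_two, Matrix.map_apply, Matrix.map_apply,
        hZ, hZ']
      rfl
    refine ⟨(key 0 0 hA hB (fun l => (hl l).1) (fun l => (hl l).2.2.1)).congr
        (fun _ => rfl) ?_ ?_,
      ⟨_, (key 0 1 hA hB (fun l => (hl l).2.1) (fun l => (hl l).2.2.2)).congr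
        (fun _ => rfl) ?_ rfl⟩,
      ⟨_, (key 1 0 hC hD (fun l => (hl l).1) (fun l => (hl l).2.2.1)).congr
        (fun _ => rfl) rfl ?_⟩,
      (key 1 1 hC hD (fun l => (hl l).2.1) (fun l => (hl l).2.2.2)).congr
        (fun _ => rfl) ?_ ?_⟩ <;>
    simp [-Finset.prod_div_distrib, Finset.prod_Icc_succ_top, chargeOp_succ, smul_smul, mul_comm]

end Operators

/-! ### The classical chain and the points of the Fermat curve -/

theorem PolyEnds.exists_polynomial {n : ℕ} {X : ℂ → ℂ} {x₀ xₙ : ℂ} (hX : PolyEnds n X x₀ xₙ) :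
    ∃ p : Polynomial ℂ, p.natDegree ≤ n ∧ p.coeff 0 = x₀ ∧ p.coeff n = xₙ ∧
      ∀ l, X l = p.eval l := by
  obtain ⟨c, h0, hn, hc⟩ := hX
  refine ⟨∑ i ∈ Finset.range (n + 1), Polynomial.C (c i) * Polynomial.X ^ i, ?_, ?_, ?_, fun l => ?_⟩
  · exact Polynomial.natDegree_sum_le_of_forall_le _ _ fun i hi =>
      (Polynomial.natDegree_C_mul_X_pow_le _ _).trans (Nat.lt_succ_iff.mp (Finset.mem_range.mp hi))
  · simp only [Polynomial.finsetSum_coeff, Polynomial.coeff_C_mul, Polynomial.coeff_X_pow, mul_ite,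
      mul_one, mul_zero, Finset.sum_ite_eq, Finset.mem_range]
    rw [if_pos (by omega), h0]
  · simp only [Polynomial.finsetSum_coeff, Polynomial.coeff_C_mul, Polynomial.coeff_X_pow, mul_ite,
      mul_one, mul_zero, Finset.sum_ite_eq, Finset.mem_range]
    rw [if_pos (by omega), hn]
  · rw [hc, Polynomial.eval_finsetSum]
    refine Finset.sum_congr rfl fun i _ => ?_
    rw [Polynomial.eval_C_mul, Polynomial.eval_X_pow, smul_eq_mul, mul_comm]

/-- The functions are compared only at $\lambda\ne0$, so that the lemma applies to identities
obtained by cancelling a factor $\Lambda$. -/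
theorem PolyEnds.ends_unique {n : ℕ} {X Y : ℂ → ℂ} {x₀ xₙ y₀ yₙ : ℂ} (hX : PolyEnds n X x₀ xₙ)
    (hY : PolyEnds n Y y₀ yₙ) (h : ∀ l, l ≠ 0 → X l = Y l) : x₀ = y₀ ∧ xₙ = yₙ := by
  obtain ⟨p, -, p0, pn, hp⟩ := hX.exists_polynomial
  obtain ⟨q, -, q0, qn, hq⟩ := hY.exists_polynomial
  have hpq : p = q := Polynomial.eq_of_infinite_eval_eq p q
    ((Set.finite_singleton (0 : ℂ)).infinite_compl.mono fun l hl => by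
      have := h l hl
      rwa [hp, hq] at this)
  rw [← p0, ← pn, ← q0, ← qn, hpq]
  exact ⟨rfl, rfl⟩

section Classical

variable {N n : ℕ} {P : SiteParams} {S : Amplitudes}

theorem classicalT_succ (m : ℕ) (Λ : ℂ) :
    classicalT N P (m + 1) Λ = classicalT N P m Λ * classicalL N P (m + 1) Λ := by
  rw [classicalT, List.ofFn_succ', List.concat_eq_append, List.prod_append, List.prod_singleton]
  rfl

/-- The classical counterpart of $F_k$: its two factors are, up to sign conventions, the two factors
of $F_k(\lambda)$ with every term replaced by its $N$-th power. -/
theorem det_classicalL (k : ℕ) (hκ : P.κ k ≠ 0) (Λ : ℂ) :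
    (classicalL N P k Λ).det = (P.b k ^ N - eps N * P.a k ^ N * P.κ k ^ N * Λ) *
      (P.d k ^ N / P.κ k ^ N - eps N * P.c k ^ N * Λ) := by
  have hκ' : P.κ k ^ N ≠ 0 := pow_ne_zero _ hκ
  have he := eps_mul_eps (N := N)
  rw [Matrix.det_fin_two]
  simp only [classicalL, Matrix.of_apply, Matrix.cons_val', Matrix.cons_val_zero,
    Matrix.cons_val_one, Matrix.cons_val_fin_one]
  field_simp
  ring

theorem det_classicalT (m : ℕ) (Λ : ℂ) :
    (classicalT N P m Λ).det = ∏ k ∈ Finset.Icc 1 m, (classicalL N P k Λ).det := by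
  induction m with
  | zero => simp [classicalT]
  | succ m ih =>
    rw [classicalT_succ, Matrix.det_mul, ih, Finset.prod_Icc_succ_top (by omega)]

theorem classicalT_polyEnds (m : ℕ) :
    PolyEnds m (fun Λ => classicalT N P m Λ 0 0) 1 ((-eps N) ^ m * ∏ k ∈ Finset.Icc 1 m, P.κ k ^ N) ∧
      ∃ x, PolyEnds m (fun Λ => classicalT N P m Λ 0 1) 0 x := by
  induction m with
  | zero =>
    exact ⟨(PolyEnds.const 1).congr (fun l => by simp [classicalT]) rfl (by simp),
      0, (PolyEnds.const 0).congr (fun l => by simp [classicalT]) rfl rfl⟩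
  | succ m ih =>
    obtain ⟨h1, x, h2⟩ := ih
    have hT : ∀ Λ j, classicalT N P (m + 1) Λ 0 j =
        classicalT N P m Λ 0 0 * classicalL N P (m + 1) Λ 0 j +
          classicalT N P m Λ 0 1 * classicalL N P (m + 1) Λ 1 j := fun Λ j => by
      rw [classicalT_succ, Matrix.mul_apply, Fin.sum_univ_two]
    refine ⟨((h1.mul_linear 1 (-eps N * P.κ (m + 1) ^ N)).add (h2.mul_linear
        (P.c (m + 1) ^ N - P.d (m + 1) ^ N) 0)).congr (fun l => ?_) (by ring) ?_, _,
      ((h1.mul_linear 0 (-eps N * (P.a (m + 1) ^ N - P.b (m + 1) ^ N))).add (h2.mul_linear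
        (P.b (m + 1) ^ N * P.d (m + 1) ^ N / P.κ (m + 1) ^ N)
        (-eps N * P.a (m + 1) ^ N * P.c (m + 1) ^ N))).congr (fun l => ?_) (by ring) rfl⟩
    · rw [hT, smul_eq_mul, smul_eq_mul]
      simp only [classicalL, Matrix.of_apply, Matrix.cons_val', Matrix.cons_val_zero,
        Matrix.cons_val_one, Matrix.cons_val_fin_one]
      ring
    · rw [Finset.prod_Icc_succ_top (by omega), pow_succ]; ring
    · rw [hT, smul_eq_mul, smul_eq_mul]
      simp only [classicalL, Matrix.of_apply, Matrix.cons_val', Matrix.cons_val_zero,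
        Matrix.cons_val_one, Matrix.cons_val_fin_one]
      ring

theorem rt_succ (m : ℕ) : S.rt (m + 1) = S.r (m + 1) 0 * ∏ s ∈ Finset.Ico 1 (m + 1), S.r (m + 1) s := by
  rw [Amplitudes.rt, Finset.range_eq_Ico, Finset.prod_eq_prod_Ico_succ_bot (by omega)]

variable (hS : IsSolution N n P S) (hP : IsNondegenerate N n P S)

include hS hP

theorem r_ne_zero {m s : ℕ} (hm : 1 ≤ m) (hmn : m ≤ n) (hs : s < m) : S.r m s ≠ 0 := by
  obtain rfl | h := hm.eq_or_lt
  · obtain rfl : s = 0 := by omega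
    rw [hS.one]
    exact hP.rs_ne 1 (Finset.mem_Icc.mpr ⟨le_rfl, hmn⟩)
  · exact hP.r_ne m (Finset.mem_Icc.mpr ⟨h, hmn⟩) s (Finset.mem_range.mpr hs)

theorem rt_ne_zero {m : ℕ} (hm : 1 ≤ m) (hmn : m ≤ n) : S.rt m ≠ 0 :=
  Finset.prod_ne_zero_iff.mpr fun _ hs => r_ne_zero hS hP hm hmn (Finset.mem_range.mp hs)

variable [NeZero N]

omit hS [NeZero N] in
-- $\det\mathcal T_n$ is the product of the one-site determinants, so its nonvanishing at the zero
-- $\epsilon r_{m,s}^N$ passes to every site, including those beyond $m$.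
theorem det_classicalL_ne {m s k : ℕ} (hm : m ∈ Finset.Icc 2 n) (hs : s ∈ Finset.Ico 1 m)
    (hk : k ∈ Finset.Icc 1 n) :
    (P.b k ^ N - P.a k ^ N * P.κ k ^ N * S.r m s ^ N) *
      (P.d k ^ N / P.κ k ^ N - P.c k ^ N * S.r m s ^ N) ≠ 0 := by
  have h := hP.det_ne m hm s hs
  rw [det_classicalT] at h
  have h2 := Finset.prod_ne_zero_iff.mp h k hk
  rw [det_classicalL k (hP.κ_ne k hk)] at h2
  have he := eps_mul_eps (N := N)
  convert h2 using 2
  · linear_combination P.a k ^ N * P.κ k ^ N * S.r m s ^ N * he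
  · linear_combination P.c k ^ N * S.r m s ^ N * he

omit [NeZero N] in
theorem isFermat_ptSite {k : ℕ} (hk : k ∈ Finset.Icc 1 n) : IsFermat N (ptSite P S k) := by
  have ha := hP.a_ne k hk
  have ha' : P.a k ^ N ≠ 0 := pow_ne_zero _ ha
  refine ⟨?_, div_ne_zero (hP.b_ne k hk) ha⟩
  simp only [ptSite, div_pow]
  rw [hS.site k hk]
  field_simp
  ring

theorem isFermat_ptRatio_same {m s s' : ℕ} (hm : m ∈ Finset.Icc 2 n) (hs : s ∈ Finset.Ico 1 m)
    (hs' : s' ∈ Finset.Ico 1 m) (hne : s ≠ s') : IsFermat N (ptRatio S m s m s') := by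
  have h := hS.y_same m hm s hs s' hs' hne
  refine ⟨h, fun h0 => hP.simple m hm s hs s' hs' hne ?_⟩
  have hr : S.r m s' ^ N ≠ 0 :=
    pow_ne_zero _ (hP.r_ne m hm s' (Finset.mem_range.mpr (Finset.mem_Ico.mp hs').2))
  simp only [ptRatio] at h0
  rwa [h0, zero_pow (NeZero.ne N), add_zero, div_pow, div_eq_one_iff_eq hr] at h

omit hP [NeZero N] in
theorem classicalT_zero {m s : ℕ} (hm : m ∈ Finset.Icc 1 n) (hs : s ∈ Finset.Ico 1 m) :
    classicalT N P m (eps N * S.r m s ^ N) 0 1 = 0 := by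
  rw [hS.classicalB m hm, Finset.prod_eq_zero hs (sub_self _), mul_zero]

omit hP [NeZero N] in
theorem classicalT_succ_zero_one {m : ℕ} (hm : m + 1 ∈ Finset.Icc 1 n) (Λ : ℂ) :
    classicalT N P (m + 1) Λ 0 1 = classicalT N P m Λ 0 0 * (-eps N * Λ * S.rs (m + 1) ^ N) +
      classicalT N P m Λ 0 1 * (P.b (m + 1) ^ N * P.d (m + 1) ^ N / P.κ (m + 1) ^ N -
        eps N * Λ * P.a (m + 1) ^ N * P.c (m + 1) ^ N) := by
  rw [classicalT_succ, Matrix.mul_apply, Fin.sum_univ_two, hS.site _ hm]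
  rfl

omit [NeZero N] in
-- At a common zero of $\mathcal B_{m+2}$ and $\mathcal B_{m+1}$ the recursion would force $\mathcal
-- A_{m+1}=0$. The whole first row of $\mathcal T_{m+1}$ would vanish, hence also $\det\mathcal
-- T_{m+1}$, which divides $\det\mathcal T_n$.
theorem r_pow_ne_prev {m s s' : ℕ} (hm : m + 2 ≤ n) (hs : s ∈ Finset.Ico 1 (m + 2))
    (hs' : s' ∈ Finset.Ico 1 (m + 1)) : S.r (m + 2) s ^ N ≠ S.r (m + 1) s' ^ N := by
  intro h
  have hm2 : m + 2 ∈ Finset.Icc 2 n := by simp; omega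
  have hdet := hP.det_ne (m + 2) hm2 s hs
  have h1 := classicalT_zero hS (m := m + 2) (by simp; omega) hs
  rw [classicalT_succ_zero_one hS (by simp; omega), h,
    classicalT_zero hS (by simp; omega) hs', zero_mul, add_zero] at h1
  have h2 : classicalT N P (m + 1) (eps N * S.r (m + 1) s' ^ N) 0 0 = 0 := by
    refine (mul_eq_zero.mp h1).resolve_right ?_
    have he : eps N ≠ 0 := left_ne_zero_of_mul_eq_one eps_mul_eps
    exact mul_ne_zero (mul_ne_zero (neg_ne_zero.mpr he) (mul_ne_zero he (pow_ne_zero _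
      (r_ne_zero hS hP (by omega) (by omega) (Finset.mem_Ico.mp hs').2))))
      (pow_ne_zero _ (hP.rs_ne _ (by simp; omega)))
  have h3 : (classicalT N P (m + 1) (eps N * S.r (m + 2) s ^ N)).det = 0 := by
    rw [Matrix.det_fin_two, h, h2, classicalT_zero hS (by simp; omega) hs']
    ring
  rw [det_classicalT] at h3 hdet
  obtain ⟨k, hk, hk0⟩ := Finset.prod_eq_zero_iff.mp h3
  exact hdet (Finset.prod_eq_zero (by simp only [Finset.mem_Icc] at hk ⊢; omega) hk0)

theorem isFermat_ptRatio_prev {m s s' : ℕ} (hm : m + 2 ≤ n) (hs : s ∈ Finset.Ico 1 (m + 2))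
    (hs' : s' ∈ Finset.Ico 1 (m + 1)) : IsFermat N (ptRatio S (m + 2) s (m + 1) s') := by
  have h := hS.y_prev (m + 2) (by simp; omega) s hs s' hs'
  refine ⟨h, fun h0 => r_pow_ne_prev hS hP hm hs hs' ?_⟩
  have hr : S.r (m + 1) s' ^ N ≠ 0 :=
    pow_ne_zero _ (r_ne_zero hS hP (by omega) (by omega) (Finset.mem_Ico.mp hs').2)
  simp only [ptRatio] at h0
  simp only [show m + 2 - 1 = m + 1 from rfl] at h
  rwa [h0, zero_pow (NeZero.ne N), add_zero, div_pow, div_eq_one_iff_eq hr] at h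

/-- $\tilde y_{m,s}=0$ would annihilate the second factor of $\det\mathcal L_m$ at $\epsilon
r_{m,s}^N$. -/
theorem isFermat_ptTilde {m s : ℕ} (hm : m ∈ Finset.Icc 2 n) (hs : s ∈ Finset.Ico 1 m) :
    IsFermat N (ptTilde P S m s) := by
  have h := hS.yt_fermat m hm s hs
  have hm1 : m ∈ Finset.Icc 1 n := by simp only [Finset.mem_Icc] at hm ⊢; omega
  refine ⟨h, fun h0 => det_classicalL_ne hP hm hs hm1 ?_⟩
  have hκ : P.κ m ^ N ≠ 0 := pow_ne_zero _ (hP.κ_ne m hm1)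
  have hc : P.c m ^ N ≠ 0 := pow_ne_zero _ (hP.c_ne m hm)
  have hr : S.r m s ^ N ≠ 0 :=
    pow_ne_zero _ (hP.r_ne m hm s (Finset.mem_range.mpr (Finset.mem_Ico.mp hs).2))
  simp only [ptTilde] at h0
  rw [h0, zero_pow (NeZero.ne N), add_zero, div_pow, mul_pow, mul_pow] at h
  have h2 : P.d m ^ N / P.κ m ^ N - P.c m ^ N * S.r m s ^ N = 0 := by
    field_simp at h ⊢
    linear_combination h
  rw [h2, mul_zero]

omit hS in
-- By $\omega^N=1$ and $\lambda^N=\epsilon r^N$, a zero of a factor of $F_k$ becomes, after taking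
-- $N$-th powers, a zero of the matching factor of $\det\mathcal L_k$.
theorem F_lam_ne_zero {m s k : ℕ} (hm : m ∈ Finset.Icc 2 n) (hs : s ∈ Finset.Ico 1 m)
    (hk : k ∈ Finset.Icc 1 n) (j : ZMod N) : F N P k (lam S m s j) ≠ 0 := by
  intro h
  refine det_classicalL_ne hP hm hs hk ?_
  have he := eps_mul_eps (N := N)
  have hl := lam_pow S m s j
  rcases mul_eq_zero.mp h with h | h
  · have h1 : P.b k ^ N = eps N * (P.a k ^ N * P.κ k ^ N * (eps N * S.r m s ^ N)) := by
      rw [← hl, eq_neg_of_add_eq_zero_left h, neg_pow, eps, mul_pow, mul_pow, mul_pow,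
        omega_isPrimitiveRoot.pow_eq_one, one_mul]
    rw [h1]
    linear_combination (P.a k ^ N * P.κ k ^ N * S.r m s ^ N *
      (P.d k ^ N / P.κ k ^ N - P.c k ^ N * S.r m s ^ N)) * he
  · have h1 : P.d k ^ N / P.κ k ^ N = eps N * (eps N * S.r m s ^ N * P.c k ^ N) := by
      rw [← hl, ← div_pow, eq_neg_of_add_eq_zero_right h, neg_pow, eps, mul_pow]
    rw [h1]
    linear_combination ((P.b k ^ N - P.a k ^ N * P.κ k ^ N * S.r m s ^ N) *
      (P.c k ^ N * S.r m s ^ N)) * he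

omit hP [NeZero N] in
/-- The lowest and the highest coefficient of the recursion for `𝓑_m(Λ) / Λ`. -/
theorem classicalB_ends {m : ℕ} (hm : m + 2 ≤ n) :
    S.rt (m + 2) ^ N = S.rs (m + 2) ^ N +
        S.rt (m + 1) ^ N * (P.b (m + 2) ^ N * P.d (m + 2) ^ N / P.κ (m + 2) ^ N) ∧
      S.r (m + 2) 0 ^ N = (∏ k ∈ Finset.Icc 1 (m + 1), P.κ k ^ N) * S.rs (m + 2) ^ N +
        S.r (m + 1) 0 ^ N * P.a (m + 2) ^ N * P.c (m + 2) ^ N := by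
  have he := eps_mul_eps (N := N)
  have hB : ∀ m, PolyEnds m (fun Λ => ∏ s ∈ Finset.Ico 1 (m + 1), (Λ - eps N * S.r (m + 1) s ^ N))
      ((-eps N) ^ m * ∏ s ∈ Finset.Ico 1 (m + 1), S.r (m + 1) s ^ N) 1 := fun m => by
    have h := PolyEnds.prod (Finset.Ico 1 (m + 1)) fun s => eps N * S.r (m + 1) s ^ N
    rw [Nat.card_Ico, Nat.add_sub_cancel] at h
    refine h.congr (fun _ => rfl) ?_ rfl
    simp only [← neg_mul]
    rw [Finset.prod_mul_distrib, Finset.prod_const, Nat.card_Ico, Nat.add_sub_cancel]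
  -- Both sides of the recursion for $\mathcal B_{m+2}$, divided by $\Lambda$, as polynomials of
  -- degree $m+1$.
  have hl := (hB (m + 1)).map (LinearMap.lsmul ℂ ℂ ((-eps N) ^ (m + 2) * S.r (m + 2) 0 ^ N))
  have hr := ((classicalT_polyEnds (N := N) (P := P) (m + 1)).1.map
    (LinearMap.lsmul ℂ ℂ (-eps N * S.rs (m + 2) ^ N))).add
    (((hB m).mul_linear (P.b (m + 2) ^ N * P.d (m + 2) ^ N / P.κ (m + 2) ^ N)
      (-eps N * P.a (m + 2) ^ N * P.c (m + 2) ^ N)).map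
      (LinearMap.lsmul ℂ ℂ ((-eps N) ^ (m + 1) * S.r (m + 1) 0 ^ N)))
  have hs : ∀ i, (-eps N) ^ (i + 1) * (-eps N) ^ i = -eps N := fun i => by
    rw [pow_succ, mul_right_comm, ← mul_pow, neg_mul_neg, he, one_pow, one_mul]
  have hne : (-eps N) ≠ 0 := neg_ne_zero.mpr (left_ne_zero_of_mul_eq_one he)
  have h := hl.ends_unique hr fun Λ hΛ => by
    have h1 := classicalT_succ_zero_one hS (m := m + 1) (by simp; omega) Λ
    rw [hS.classicalB (m + 2) (by simp; omega), hS.classicalB (m + 1) (by simp; omega)] at h1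
    refine mul_left_cancel₀ hΛ ?_
    simp only [LinearMap.lsmul_apply, smul_eq_mul]
    linear_combination h1
  simp only [LinearMap.lsmul_apply, smul_eq_mul] at h
  obtain ⟨h0, hn⟩ := h
  constructor
  · rw [rt_succ, rt_succ, mul_pow, mul_pow, ← Finset.prod_pow, ← Finset.prod_pow]
    refine mul_left_cancel₀ hne ?_
    linear_combination h0 - (S.r (m + 2) 0 ^ N *
        ∏ s ∈ Finset.Ico 1 (m + 2), S.r (m + 2) s ^ N) * hs (m + 1) +
      (S.r (m + 1) 0 ^ N * (∏ s ∈ Finset.Ico 1 (m + 1), S.r (m + 1) s ^ N) *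
        (P.b (m + 2) ^ N * P.d (m + 2) ^ N / P.κ (m + 2) ^ N)) * hs m
  · refine mul_left_cancel₀ (pow_ne_zero (m + 2) hne) ?_
    linear_combination hn

omit [NeZero N] in
-- The curve equation is the lowest coefficient of the recursion for $\mathcal
-- B_m(\Lambda)/\Lambda$, divided by $\tilde r_m^N$.
theorem isFermat_ptTot {m : ℕ} (hm : m + 2 ≤ n) : IsFermat N (ptTot P S (m + 2)) := by
  have h := (classicalB_ends hS hm).1
  have hr : S.rt (m + 2) ^ N ≠ 0 := pow_ne_zero _ (rt_ne_zero hS hP (by omega) hm)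
  have hκ : P.κ (m + 2) ^ N ≠ 0 := pow_ne_zero _ (hP.κ_ne _ (by simp; omega))
  refine ⟨?_, div_ne_zero (mul_ne_zero
    (mul_ne_zero (hP.b_ne _ (by simp; omega)) (hP.d_ne _ (by simp; omega)))
    (rt_ne_zero hS hP (by omega) (by omega)))
    (mul_ne_zero (hP.κ_ne _ (by simp; omega)) (rt_ne_zero hS hP (by omega) hm))⟩
  simp only [ptTot, div_pow, mul_pow, show m + 2 - 1 = m + 1 from rfl]
  field_simp at h ⊢
  linear_combination -h

omit [NeZero N] in
-- The curve equation is the highest coefficient of the same recursion, divided by $r_{m,0}^N$.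
theorem isFermat_ptZero {m : ℕ} (hm : m + 2 ≤ n) : IsFermat N (ptZero P S (m + 2)) := by
  have h := (classicalB_ends hS hm).2
  have hr : S.r (m + 2) 0 ≠ 0 := r_ne_zero hS hP (by omega) hm (by omega)
  have hr' : S.r (m + 2) 0 ^ N ≠ 0 := pow_ne_zero _ hr
  constructor
  · simp only [ptZero, div_pow, mul_pow, show m + 2 - 1 = m + 1 from rfl, ← Finset.prod_pow]
    rw [← add_div, div_eq_one_iff_eq hr', h, add_comm]
    rfl
  · refine div_ne_zero (mul_ne_zero (Finset.prod_ne_zero_iff.mpr fun k hk => hP.κ_ne k ?_)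
      (hP.rs_ne _ (by simp; omega))) hr
    simp only [Finset.mem_Ico, Finset.mem_Icc] at hk ⊢
    omega

/-- The `N`-th power of the coordinate `y_{m,l}`, from the relation of `𝓑_{m+1}`, `𝓑_{m-1}` and
the determinant of the `m`-th classical L-operator at a zero of `𝓑_m`. -/
theorem yPlain_pow {m l : ℕ} (hm : m + 3 ≤ n) (hl : l ∈ Finset.Ico 1 (m + 2)) :
    yPlain P S (m + 2) l ^ N =
      1 - (P.a (m + 2) * P.κ (m + 2) * S.r (m + 2) l / P.b (m + 2)) ^ N := by
  have he := eps_mul_eps (N := N)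
  have hne : eps N ≠ 0 := left_ne_zero_of_mul_eq_one he
  have hm2 : m + 2 ∈ Finset.Icc 2 n := by simp; omega
  have hlt := (Finset.mem_Ico.mp hl).2
  have hR : S.r (m + 2) l ^ N ≠ 0 := pow_ne_zero _ (r_ne_zero hS hP (by omega) (by omega) hlt)
  have hrs : ∀ k ∈ Finset.Icc 1 n, S.rs k ^ N ≠ 0 := fun k hk => pow_ne_zero _ (hP.rs_ne k hk)
  have hs2 := hrs (m + 2) (by simp; omega)
  have hs3 := hrs (m + 3) (by simp; omega)
  -- At a zero of $\mathcal B_{m+2}$ the recursion leaves $\mathcal B_{m+3}=-\epsilon\Lambda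
  -- r_{m+3}^N\mathcal A_{m+2}$. Multiplying $\mathcal A_{m+2}$ by the upper right entry of
  -- $\mathcal L_{m+2}$ and using $\mathcal B_{m+2}=0$ eliminates $\mathcal A_{m+1}$ and leaves
  -- $-\mathcal B_{m+1}\det\mathcal L_{m+2}$.
  have h1 : classicalT N P (m + 3) (eps N * S.r (m + 2) l ^ N) 0 1 * S.rs (m + 2) ^ N =
      -(S.rs (m + 3) ^ N * classicalT N P (m + 1) (eps N * S.r (m + 2) l ^ N) 0 1 *
        (classicalL N P (m + 2) (eps N * S.r (m + 2) l ^ N)).det) := by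
    have h2 := classicalT_succ_zero_one hS (m := m + 2) (by simp; omega)
      (eps N * S.r (m + 2) l ^ N)
    have hz := classicalT_zero hS (m := m + 2) (by simp; omega) hl
    rw [hz, zero_mul, add_zero] at h2
    rw [classicalT_succ, Matrix.mul_apply, Fin.sum_univ_two] at hz
    have h3 : classicalT N P (m + 2) (eps N * S.r (m + 2) l ^ N) 0 0 =
        classicalT N P (m + 1) (eps N * S.r (m + 2) l ^ N) 0 0 *
          classicalL N P (m + 2) (eps N * S.r (m + 2) l ^ N) 0 0 +
        classicalT N P (m + 1) (eps N * S.r (m + 2) l ^ N) 0 1 *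
          classicalL N P (m + 2) (eps N * S.r (m + 2) l ^ N) 1 0 := by
      rw [classicalT_succ, Matrix.mul_apply, Fin.sum_univ_two]
    have h4 : classicalL N P (m + 2) (eps N * S.r (m + 2) l ^ N) 0 1 =
        -eps N * (eps N * S.r (m + 2) l ^ N) * S.rs (m + 2) ^ N := by
      rw [hS.site _ (by simp; omega)]; rfl
    rw [h2, Matrix.det_fin_two, h3]
    linear_combination (-S.rs (m + 3) ^ N *
        classicalT N P (m + 1) (eps N * S.r (m + 2) l ^ N) 0 1 *
          classicalL N P (m + 2) (eps N * S.r (m + 2) l ^ N) 1 0 -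
        S.rs (m + 3) ^ N * classicalT N P (m + 1) (eps N * S.r (m + 2) l ^ N) 0 0 *
          classicalL N P (m + 2) (eps N * S.r (m + 2) l ^ N) 0 0) * h4 +
      S.rs (m + 3) ^ N * classicalL N P (m + 2) (eps N * S.r (m + 2) l ^ N) 0 0 * hz
  rw [hS.classicalB (m + 3) (by simp; omega), hS.classicalB (m + 1) (by simp; omega),
    det_classicalL _ (hP.κ_ne _ (by simp; omega))] at h1
  -- The next three identities replace differences and quotients of the zeros by $N$-th powers of
  -- Fermat coordinates. For two zeros of the same $\mathcal B$, the quotient of $1-r_l^N/r_s^N$ by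
  -- $1-r_s^N/r_l^N$ is $-r_l^N/r_s^N$.
  have hA : ∏ s ∈ Finset.Ico 1 (m + 3), (eps N * S.r (m + 2) l ^ N - eps N * S.r (m + 3) s ^ N) =
      (eps N * S.r (m + 2) l ^ N) ^ (m + 2) *
        ∏ k ∈ Finset.Icc 1 (m + 2), S.y (m + 3) k (m + 2) l ^ N := by
    have hc : (eps N * S.r (m + 2) l ^ N) ^ (m + 2) =
        ∏ _k ∈ Finset.Ico 1 (m + 3), eps N * S.r (m + 2) l ^ N := by
      rw [Finset.prod_const, Nat.card_Ico]; rfl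
    rw [hc, show Finset.Icc 1 (m + 2) = Finset.Ico 1 (m + 3) from rfl,
      ← Finset.prod_mul_distrib]
    refine Finset.prod_congr rfl fun k hk => ?_
    have h := (isFermat_ptRatio_prev hS hP (m := m + 1) hm hk hl).1
    simp only [ptRatio, div_pow] at h
    rw [← sub_eq_iff_eq_add'.mpr h.symm]
    field_simp
  have hB : ∏ s ∈ Finset.Ico 1 (m + 1), (eps N * S.r (m + 2) l ^ N - eps N * S.r (m + 1) s ^ N) =
      (-eps N) ^ m * ((∏ s ∈ Finset.Ico 1 (m + 1), S.r (m + 1) s ^ N) *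
        ∏ s ∈ Finset.Ico 1 (m + 1), S.y (m + 2) l (m + 1) s ^ N) := by
    have hc : (-eps N) ^ m = ∏ _k ∈ Finset.Ico 1 (m + 1), (-eps N) := by
      rw [Finset.prod_const, Nat.card_Ico]; rfl
    rw [hc, ← Finset.prod_mul_distrib, ← Finset.prod_mul_distrib]
    refine Finset.prod_congr rfl fun k hk => ?_
    have h := (isFermat_ptRatio_prev hS hP (m := m) (by omega) hl hk).1
    have hr : S.r (m + 1) k ^ N ≠ 0 :=
      pow_ne_zero _ (r_ne_zero hS hP (by omega) (by omega) (Finset.mem_Ico.mp hk).2)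
    simp only [ptRatio, div_pow] at h
    rw [← sub_eq_iff_eq_add'.mpr h.symm]
    field_simp
    ring
  have hC : ∏ s ∈ (Finset.Ico 1 (m + 2)).erase l, (S.y (m + 2) l (m + 2) s ^ N /
      S.y (m + 2) s (m + 2) l ^ N) = (-1) ^ m * (S.r (m + 2) l ^ N) ^ m /
        ∏ s ∈ (Finset.Ico 1 (m + 2)).erase l, S.r (m + 2) s ^ N := by
    have hc : (-1) ^ m * (S.r (m + 2) l ^ N) ^ m =
        ∏ _k ∈ (Finset.Ico 1 (m + 2)).erase l, (-1 * S.r (m + 2) l ^ N) := by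
      rw [Finset.prod_const, Finset.card_erase_of_mem hl, Nat.card_Ico, mul_pow]; rfl
    rw [hc, ← Finset.prod_div_distrib]
    refine Finset.prod_congr rfl fun s hs => ?_
    obtain ⟨hsl, hs⟩ := Finset.mem_erase.mp hs
    have h := (isFermat_ptRatio_same hS hP hm2 hl hs hsl.symm).1
    have h' := isFermat_ptRatio_same hS hP hm2 hs hl hsl
    have hr : S.r (m + 2) s ^ N ≠ 0 :=
      pow_ne_zero _ (r_ne_zero hS hP (by omega) (by omega) (Finset.mem_Ico.mp hs).2)
    have hy : S.y (m + 2) s (m + 2) l ^ N ≠ 0 := pow_ne_zero _ h'.2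
    have h' := h'.1
    simp only [ptRatio, div_pow] at h h'
    field_simp at h h' ⊢
    linear_combination h + h'
  have hD := (isFermat_ptTilde hS hP hm2 hl).1
  have hY : S.yt (m + 2) l ^ N ≠ 0 := pow_ne_zero _ (isFermat_ptTilde hS hP hm2 hl).2
  have hRs : ∏ s ∈ (Finset.Ico 1 (m + 2)).erase l, S.r (m + 2) s ^ N ≠ 0 :=
    Finset.prod_ne_zero_iff.mpr fun s hs => pow_ne_zero _ (r_ne_zero hS hP (by omega) (by omega)
      (Finset.mem_Ico.mp (Finset.mem_of_mem_erase hs)).2)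
  have hRp : ∏ s ∈ Finset.Ico 1 (m + 1), S.r (m + 1) s ^ N ≠ 0 :=
    Finset.prod_ne_zero_iff.mpr fun s hs => pow_ne_zero _ (r_ne_zero hS hP (by omega) (by omega)
      (Finset.mem_Ico.mp hs).2)
  have hBp : ∏ s ∈ Finset.Ico 1 (m + 1), S.y (m + 2) l (m + 1) s ^ N ≠ 0 :=
    Finset.prod_ne_zero_iff.mpr fun s hs => pow_ne_zero _
      (isFermat_ptRatio_prev hS hP (by omega) hl hs).2
  have hb : P.b (m + 2) ^ N ≠ 0 := pow_ne_zero _ (hP.b_ne _ (by simp; omega))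
  have hc : P.c (m + 2) ^ N ≠ 0 := pow_ne_zero _ (hP.c_ne _ hm2)
  have hκ : P.κ (m + 2) ^ N ≠ 0 := pow_ne_zero _ (hP.κ_ne _ (by simp; omega))
  have hr0 : S.r (m + 2) 0 ^ N ≠ 0 := pow_ne_zero _ (r_ne_zero hS hP (by omega) (by omega) (by omega))
  have hr1 : S.r (m + 1) 0 ^ N ≠ 0 := pow_ne_zero _ (r_ne_zero hS hP (by omega) (by omega) (by omega))
  rw [hA, hB] at h1
  have hE : (P.d (m + 2) ^ N / P.κ (m + 2) ^ N -
      eps N * P.c (m + 2) ^ N * (eps N * S.r (m + 2) l ^ N)) =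
      -(P.c (m + 2) ^ N * S.r (m + 2) l ^ N * S.yt (m + 2) l ^ N) := by
    simp only [ptTilde, div_pow, mul_pow] at hD
    field_simp at hD ⊢
    linear_combination hD - (P.c (m + 2) ^ N * S.r (m + 2) l ^ N * P.κ (m + 2) ^ N) * he
  rw [hE] at h1
  rw [yPlain]
  simp only [show m + 2 - 1 = m + 1 from rfl, mul_pow, div_pow, ← Finset.prod_pow, hC]
  rw [rt_succ, rt_succ, mul_pow, mul_pow, ← Finset.prod_pow, ← Finset.prod_pow,
    ← Finset.mul_prod_erase _ _ hl]
  generalize (∏ s ∈ (Finset.Ico 1 (m + 2)).erase l, S.r (m + 2) s ^ N) = Rs at *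
  generalize (∏ s ∈ Finset.Ico 1 (m + 1), S.r (m + 1) s ^ N) = Rp at *
  generalize (∏ s ∈ Finset.Ico 1 (m + 1), S.y (m + 2) l (m + 1) s ^ N) = Bp at *
  generalize (∏ k ∈ Finset.Icc 1 (m + 2), S.y (m + 3) k (m + 2) l ^ N) = Ap at *
  -- What remains of `h1` after cancelling the powers of $\epsilon$, by $\epsilon^2=1$, and the
  -- common powers of $r_{m+2,l}^N$.
  have h2 : S.r (m + 3) 0 ^ N * (S.r (m + 2) l ^ N) ^ (m + 1) * Ap * S.rs (m + 2) ^ N =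
      S.rs (m + 3) ^ N * S.r (m + 1) 0 ^ N * (-1) ^ m * Rp * Bp *
        (P.b (m + 2) ^ N - P.a (m + 2) ^ N * P.κ (m + 2) ^ N * S.r (m + 2) l ^ N) *
          (P.c (m + 2) ^ N * S.yt (m + 2) l ^ N) := by
    have hem : eps N ^ (m + 3) ≠ 0 := pow_ne_zero _ hne
    have e2 : eps N * P.a (m + 2) ^ N * P.κ (m + 2) ^ N * (eps N * S.r (m + 2) l ^ N) =
        P.a (m + 2) ^ N * P.κ (m + 2) ^ N * S.r (m + 2) l ^ N := by
      linear_combination (P.a (m + 2) ^ N * P.κ (m + 2) ^ N * S.r (m + 2) l ^ N) * he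
    rw [e2] at h1
    have s1 : (-eps N) ^ (m + 3) = (-1) ^ (m + 1) * eps N ^ (m + 1) := by
      rw [← mul_pow, neg_one_mul, pow_add _ (m + 1) 2, neg_sq, sq, he, mul_one]
    have s2 : (eps N * S.r (m + 2) l ^ N) ^ (m + 2) =
        eps N ^ m * (S.r (m + 2) l ^ N) ^ (m + 2) := by
      rw [mul_pow, pow_add _ m 2, sq, he, mul_one]
    have s3 : (-eps N) ^ (m + 1) = (-1) ^ (m + 1) * eps N ^ (m + 1) := by
      rw [← mul_pow, neg_one_mul]
    have s4 : (-eps N) ^ m = (-1) ^ m * eps N ^ m := by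
      rw [← mul_pow, neg_one_mul]
    rw [s1, s2, s3, s4] at h1
    have hk : (-1 : ℂ) ^ (m + 1) * eps N ^ (m + 1) * (eps N * S.r (m + 2) l ^ N) * eps N ^ m *
        S.r (m + 2) l ^ N ≠ 0 := by
      refine mul_ne_zero (mul_ne_zero (mul_ne_zero (mul_ne_zero ?_ ?_) (mul_ne_zero hne hR))
        (pow_ne_zero _ hne)) hR
      · exact pow_ne_zero _ (by norm_num)
      · exact pow_ne_zero _ hne
    refine mul_left_cancel₀ hk ?_
    linear_combination h1
  have h3 : ((-1 : ℂ) ^ m) * (-1) ^ m = 1 := by rw [← mul_pow]; norm_num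
  field_simp
  simp only [show m + 1 + 1 = m + 2 from rfl, show m + 2 + 1 = m + 3 from rfl]
  linear_combination (-1) ^ m * h2 + (S.r (m + 1) 0 ^ N * Rp * S.rs (m + 3) ^ N * P.c (m + 2) ^ N *
    S.yt (m + 2) l ^ N * Bp *
      (P.b (m + 2) ^ N - S.r (m + 2) l ^ N * P.a (m + 2) ^ N * P.κ (m + 2) ^ N)) * h3

/-- A vanishing $y$ would annihilate the first factor of the one-site determinant at this zero. The
bound on the level leaves room for one further site, whose amplitudes enter the definition of $y$.
-/
theorem isFermat_ptPlain {m l : ℕ} (hm : m + 3 ≤ n) (hl : l ∈ Finset.Ico 1 (m + 2)) :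
    IsFermat N (ptPlain P S (m + 2) l) := by
  have h := yPlain_pow hS hP hm hl
  refine ⟨by simp only [ptPlain]; rw [h]; ring, fun h0 => ?_⟩
  simp only [ptPlain] at h0
  rw [h0, zero_pow (NeZero.ne N), div_pow, mul_pow, mul_pow] at h
  have hb : P.b (m + 2) ^ N ≠ 0 := pow_ne_zero _ (hP.b_ne _ (by simp; omega))
  refine det_classicalL_ne hP (m := m + 2) (k := m + 2) (by simp; omega) hl (by simp; omega) ?_
  field_simp at h
  rw [show P.b (m + 2) ^ N - P.a (m + 2) ^ N * P.κ (m + 2) ^ N * S.r (m + 2) l ^ N = 0 by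
    linear_combination -h, zero_mul]

end Classical

/-! ### Shifts of the arguments of products of cyclic functions -/

section Shifts

theorem succ_mem_Ico {m : ℕ} (k : Fin m) : (k : ℕ) + 1 ∈ Finset.Ico 1 (m + 1) := by
  simp only [Finset.mem_Ico]
  omega

theorem prod_eq_prod_mul_of_eq_off {ι : Type*} [DecidableEq ι] (s : Finset ι) {f g : ι → ℂ} {l : ι}
    (hl : l ∈ s) {c : ℂ} (h : ∀ i ∈ s, i ≠ l → g i = f i) (hc : g l = f l * c) :
    ∏ i ∈ s, g i = (∏ i ∈ s, f i) * c := by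
  rw [← Finset.mul_prod_erase s g hl, ← Finset.mul_prod_erase s f hl, hc,
    Finset.prod_congr rfl fun i hi =>
      h i (Finset.mem_of_mem_erase hi) (Finset.ne_of_mem_erase hi)]
  ring

theorem prod_offDiag_eq {ι : Type*} [Fintype ι] [DecidableEq ι] (g : ι → ι → ℂ) (l : ι) :
    ∏ s, ∏ s' ∈ Finset.univ.erase s, g s s' =
      (∏ j ∈ Finset.univ.erase l, g l j * g j l) *
        ∏ s ∈ Finset.univ.erase l, ∏ s' ∈ (Finset.univ.erase s).erase l, g s s' := by
  rw [← Finset.mul_prod_erase Finset.univ (fun s => ∏ s' ∈ Finset.univ.erase s, g s s')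
    (Finset.mem_univ l), Finset.prod_mul_distrib, mul_assoc]
  congr 1
  rw [← Finset.prod_mul_distrib]
  refine Finset.prod_congr rfl fun s hs => ?_
  exact (Finset.mul_prod_erase _ (fun s' => g s s')
    (Finset.mem_erase.mpr ⟨(Finset.ne_of_mem_erase hs).symm, Finset.mem_univ _⟩)).symm

theorem prod_offDiag_swap {ι : Type*} [Fintype ι] [DecidableEq ι] (g : ι → ι → ℂ) :
    ∏ s, ∏ s' ∈ Finset.univ.erase s, g s s' = ∏ s, ∏ s' ∈ Finset.univ.erase s, g s' s :=
  Finset.prod_comm' fun s s' => by simp [eq_comm]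

variable {ι : Type*} [Fintype ι] [DecidableEq ι] {R : Type*} [Ring R]

theorem sum_sub_single (σ : ι → R) (l : ι) :
    ∑ i, (σ - Pi.single l 1 : ι → R) i = ∑ i, σ i - 1 := by
  simp [Finset.sum_sub_distrib]

theorem sum_add_single (σ : ι → R) (l : ι) :
    ∑ i, (σ + Pi.single l 1 : ι → R) i = ∑ i, σ i + 1 := by
  simp [Finset.sum_add_distrib]

end Shifts

/-! ### The nodes and the Sklyanin weight. -/

section Nodes

variable {N n : ℕ} [NeZero N] {P : SiteParams} {S : Amplitudes}

/-- The zeros of the eigenvalue of `B_{M+1}(λ) / λ`. -/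
noncomputable def nodes {N : ℕ} (S : Amplitudes) (M : ℕ) (ρ' : Fin M → ZMod N) (s : Fin M) : ℂ :=
  lam S (M + 1) (s + 1) (ρ' s)

theorem nodes_sub_single (M : ℕ) (ρ' : Fin M → ZMod N) (k : Fin M) :
    nodes S M (ρ' - Pi.single k 1) k = omega N * nodes S M ρ' k := by
  rw [nodes, nodes, Pi.sub_apply, Pi.single_eq_same, lam_sub_one]

theorem nodes_add_single (M : ℕ) (ρ' : Fin M → ZMod N) (k : Fin M) :
    nodes S M (ρ' + Pi.single k 1) k = nodes S M ρ' k / omega N := by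
  rw [nodes, nodes, Pi.add_apply, Pi.single_eq_same, lam_add_one]

omit [NeZero N] in
theorem nodes_sub_single_of_ne (M : ℕ) (ρ' : Fin M → ZMod N) {k s : Fin M} (h : s ≠ k) :
    nodes S M (ρ' - Pi.single k 1) s = nodes S M ρ' s := by
  rw [nodes, nodes, Pi.sub_apply, Pi.single_eq_of_ne h, sub_zero]

omit [NeZero N] in
theorem nodes_add_single_of_ne (M : ℕ) (ρ' : Fin M → ZMod N) {k s : Fin M} (h : s ≠ k) :
    nodes S M (ρ' + Pi.single k 1) s = nodes S M ρ' s := by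
  rw [nodes, nodes, Pi.add_apply, Pi.single_eq_of_ne h, add_zero]

variable (hS : IsSolution N n P S) (hP : IsNondegenerate N n P S)

include hS hP in
theorem nodes_ne_zero {M : ℕ} (hM : M + 1 ≤ n) (ρ' : Fin M → ZMod N) (s : Fin M) :
    nodes S M ρ' s ≠ 0 :=
  lam_ne_zero (r_ne_zero hS hP (by omega) hM (by omega)) _

include hP in
theorem nodes_ne {M : ℕ} (hM : M + 1 ≤ n) (ρ' σ' : Fin M → ZMod N) {s s' : Fin M} (h : s ≠ s') :
    nodes S M ρ' s ≠ nodes S M σ' s' :=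
  lam_ne_of_pow_ne (hP.simple (M + 1) (by simp; omega) _ (succ_mem_Ico s) _ (succ_mem_Ico s')
    (by have := Fin.val_ne_of_ne h; omega)) _ _

include hP in
theorem nodes_injective {M : ℕ} (hM : M + 1 ≤ n) (ρ' : Fin M → ZMod N) :
    Function.Injective (nodes S M ρ') := fun _ _ h => by
  by_contra hne
  exact nodes_ne hP hM ρ' ρ' hne h

include hS hP in
theorem isFermat_ptRatio_same' {M : ℕ} (hM : M + 1 ≤ n) {s s' : Fin M} (h : s ≠ s') :
    IsFermat N (ptRatio S (M + 1) (s + 1) (M + 1) (s' + 1)) :=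
  isFermat_ptRatio_same hS hP (by simp; omega) (succ_mem_Ico s) (succ_mem_Ico s')
    (by have := Fin.val_ne_of_ne h; omega)

include hS hP in
theorem sklyanin_ne_zero {M : ℕ} (hM : M + 1 ≤ n) (ρ' : Fin M → ZMod N) :
    sklyanin S M ρ' ≠ 0 :=
  Finset.prod_ne_zero_iff.mpr fun _ _ => Finset.prod_ne_zero_iff.mpr fun _ hs' =>
    (isFermat_ptRatio_same' hS hP hM (Finset.ne_of_mem_erase hs')).cyc_ne _

theorem lam_div_lam (m k m' k' : ℕ) (i j : ZMod N) (h : S.r m' k' ≠ 0) :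
    omPow (j - i) * (S.r m k / S.r m' k') = lam S m k i / lam S m' k' j := by
  have := omPow_ne_zero i
  have := omPow_ne_zero j
  rw [lam, lam, omPow_sub, omPow_neg, omPow_neg]
  field_simp

include hS hP in
-- Only the pairs containing $k$ change, and each pair contributes two opposite steps of the
-- recursion of $w_p$. The weight thereby trades the Lagrange quotients created by moving a node for
-- a monomial in the nodes times constants. This is used twice: for the kernel, whose denominator is
-- this weight, and for the Baxter equations.
theorem sklyanin_sub_single {M : ℕ} (hM : M + 1 ≤ n) (ρ' : Fin M → ZMod N) (k : Fin M) :
    sklyanin S M ρ' * ∏ s ∈ Finset.univ.erase k,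
        ((nodes S M ρ' k - nodes S M ρ' s) / (omega N * nodes S M ρ' k - nodes S M ρ' s)) =
      sklyanin S M (ρ' - Pi.single k 1) * ∏ s ∈ Finset.univ.erase k,
        (-(nodes S M ρ' k / nodes S M ρ' s) *
          (S.y (M + 1) (s + 1) (M + 1) (k + 1) / S.y (M + 1) (k + 1) (M + 1) (s + 1))) := by
  rw [sklyanin, sklyanin, prod_offDiag_eq _ k, prod_offDiag_eq _ k]
  refine (mul_right_comm _ _ _).trans (Eq.trans (congrArg₂ (· * ·) ?_ ?_) (mul_right_comm _ _ _))
  · rw [← Finset.prod_mul_distrib, ← Finset.prod_mul_distrib]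
    refine Finset.prod_congr rfl fun j hj => ?_
    have hjk := Finset.ne_of_mem_erase hj
    have h1 := isFermat_ptRatio_same' hS hP hM hjk
    have h2 := isFermat_ptRatio_same' hS hP hM hjk.symm
    have e1 : (ρ' - Pi.single k 1 : Fin M → ZMod N) k - (ρ' - Pi.single k 1 : Fin M → ZMod N) j =
        ρ' k - ρ' j - 1 := by
      rw [Pi.sub_apply, Pi.sub_apply, Pi.single_eq_same, Pi.single_eq_of_ne hjk]; ring
    have e2 : (ρ' - Pi.single k 1 : Fin M → ZMod N) j - (ρ' - Pi.single k 1 : Fin M → ZMod N) k =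
        ρ' j - ρ' k + 1 := by
      rw [Pi.sub_apply, Pi.sub_apply, Pi.single_eq_same, Pi.single_eq_of_ne hjk]; ring
    have hz := nodes_ne_zero hS hP hM ρ'
    have hk := hz k
    have hj' := hz j
    have hkj := sub_ne_zero.mpr (nodes_ne hP hM ρ' ρ' hjk.symm)
    have hkj' := nodes_ne hP hM (ρ' - Pi.single k 1) ρ' hjk.symm
    rw [nodes_sub_single, ← sub_ne_zero] at hkj'
    have hr : ∀ s : Fin M, S.r (M + 1) (s + 1) ≠ 0 := fun s =>
      r_ne_zero hS hP (by omega) hM (by omega)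
    have l1 := lam_div_lam (S := S) (M + 1) (j + 1) (M + 1) (k + 1) (ρ' j) (ρ' k) (hr k)
    -- The recursion for the second factor of the pair is taken at the already raised argument,
    -- hence $\rho_k-1$ and the factor $\omega$ in the node.
    have l2 := lam_div_lam (S := S) (M + 1) (k + 1) (M + 1) (j + 1) (ρ' k - 1) (ρ' j) (hr j)
    rw [lam_sub_one, show ρ' j - (ρ' k - 1) = ρ' j - ρ' k + 1 by ring] at l2
    rw [e1, e2, h1.cyc_sub_one, h2.cyc_add_one]
    have y1 := h1.2
    have y2 := h2.2
    simp only [ptRatio] at y1 y2 ⊢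
    rw [l1, l2]
    change _ = _ * ((1 - nodes S M ρ' j / nodes S M ρ' k) / _) *
      (_ * (_ / (1 - omega N * nodes S M ρ' k / nodes S M ρ' j))) * _
    have h3 : 1 - omega N * nodes S M ρ' k / nodes S M ρ' j =
        -(omega N * nodes S M ρ' k - nodes S M ρ' j) / nodes S M ρ' j := by
      field_simp
      ring
    have h4 : 1 - nodes S M ρ' j / nodes S M ρ' k =
        (nodes S M ρ' k - nodes S M ρ' j) / nodes S M ρ' k := by
      field_simp
    rw [h3, h4]
    generalize omega N * nodes S M ρ' k - nodes S M ρ' j = w at *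
    generalize nodes S M ρ' k - nodes S M ρ' j = v at *
    field_simp
  · refine Finset.prod_congr rfl fun s hs => Finset.prod_congr rfl fun s' hs' => ?_
    rw [Pi.sub_apply, Pi.sub_apply, Pi.single_eq_of_ne (Finset.ne_of_mem_erase hs),
      Pi.single_eq_of_ne (Finset.ne_of_mem_erase hs'), sub_zero, sub_zero]

end Nodes

/-! ### The kernel -/

section Kernel

variable {N n : ℕ} [NeZero N] {P : SiteParams} {S : Amplitudes} {m : ℕ}
  (σ : Fin (m + 1) → ZMod N) (τ : ZMod N) (ρ : Fin (m + 2) → ZMod N)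

omit [NeZero N] in
-- The denominator over pairs $j\ne l$ is recognised, with the two indices exchanged, as the
-- Sklyanin weight of the shorter chain.
theorem kernelQ_eq : kernelQ P S m σ τ ρ =
    omPow ((∑ i, ρ i - ∑ i, σ i) * (τ - ρ 0)) /
      (cyc (ptZero P S (m + 2)) (ρ 0 - σ 0 - 1) * cyc (ptTot P S (m + 2)) (∑ i, ρ i - τ - 1)) *
    ((∏ l : Fin m, ∏ k : Fin (m + 1),
        cyc (ptRatio S (m + 2) (k + 1) (m + 1) (l + 1)) (σ l.succ - ρ k.succ)) /
      sklyanin S m (Fin.tail σ)) *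
    ((∏ l : Fin m, cyc (ptPlain P S (m + 1) (l + 1)) (-(σ l.succ))) /
      ∏ l : Fin m, cyc (ptTilde P S (m + 1) (l + 1)) (σ l.succ)) := by
  rw [kernelQ, sklyanin, prod_offDiag_swap, Finset.prod_div_distrib]
  rfl

variable (hS : IsSolution N n P S) (hP : IsNondegenerate N n P S) (hm : m + 2 ≤ n)
include hS hP hm

theorem kernelQ_ne_zero : kernelQ P S m σ τ ρ ≠ 0 := by
  rw [kernelQ_eq]
  refine mul_ne_zero (mul_ne_zero (div_ne_zero (omPow_ne_zero _) (mul_ne_zero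
    ((isFermat_ptZero hS hP hm).cyc_ne _) ((isFermat_ptTot hS hP hm).cyc_ne _)))
    (div_ne_zero ?_ (sklyanin_ne_zero hS hP (by omega) _))) (div_ne_zero ?_ ?_)
  · exact Finset.prod_ne_zero_iff.mpr fun l _ => Finset.prod_ne_zero_iff.mpr fun k _ =>
      (isFermat_ptRatio_prev hS hP hm (succ_mem_Ico k) (succ_mem_Ico l)).cyc_ne _
  · refine Finset.prod_ne_zero_iff.mpr fun l _ => ?_
    -- An index $l$ exists only for $m\ge1$; then the level $m+1$ is at least $2$ and lies below the
    -- last one, as the points $p_{m+1,l}$ require.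
    obtain ⟨m, rfl⟩ : ∃ m', m = m' + 1 := ⟨m - 1, by have := l.2; omega⟩
    exact (isFermat_ptPlain hS hP hm (succ_mem_Ico l)).cyc_ne _
  · refine Finset.prod_ne_zero_iff.mpr fun l _ => ?_
    obtain ⟨m, rfl⟩ : ∃ m', m = m' + 1 := ⟨m - 1, by have := l.2; omega⟩
    exact (isFermat_ptTilde hS hP (by simp; omega) (succ_mem_Ico l)).cyc_ne _

/-- The recursion of $w_{\tilde p_{m+2}}$, whose argument contains $-\tau$. It is the constant term
in $\lambda$ of the eigenvalue equation for $B$ after division by $\lambda$. -/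
theorem kernelQ_sub_tau :
    S.rs (m + 2) * omPow (-τ) * kernelQ P S m σ τ ρ +
      S.rt (m + 1) * omPow (-∑ i, σ i) * (P.b (m + 2) * P.d (m + 2) / P.κ (m + 2)) *
        kernelQ P S m σ (τ - 1) ρ =
      S.rt (m + 2) * omPow (-∑ i, ρ i) * kernelQ P S m σ τ ρ := by
  have hF := isFermat_ptTot hS hP hm
  have hy := hF.2
  have h1 := hF.one_sub_ne (∑ i, ρ i - τ)
  have e1 : ∑ i, ρ i - (τ - 1) - 1 = ∑ i, ρ i - τ - 1 + 1 := by ring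
  have e2 : (∑ i, ρ i - ∑ i, σ i) * (τ - 1 - ρ 0) =
      (∑ i, ρ i - ∑ i, σ i) * (τ - ρ 0) - (∑ i, ρ i - ∑ i, σ i) := by ring
  have key : kernelQ P S m σ (τ - 1) ρ * omPow (∑ i, ρ i - ∑ i, σ i) * (ptTot P S (m + 2)).2 =
      kernelQ P S m σ τ ρ * (1 - omPow (∑ i, ρ i - τ) * (ptTot P S (m + 2)).1) := by
    rw [kernelQ_eq, kernelQ_eq, e1, hF.cyc_add_one, e2, omPow_sub, sub_add_cancel]
    have h2 := hF.cyc_ne (∑ i, ρ i - τ - 1)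
    have h3 := omPow_ne_zero (∑ i, ρ i - ∑ i, σ i)
    generalize 1 - omPow (∑ i, ρ i - τ) * (ptTot P S (m + 2)).1 = w at *
    field_simp
  simp only [ptTot, show m + 2 - 1 = m + 1 from rfl] at key
  have hrt := rt_ne_zero hS hP (m := m + 2) (by omega) hm
  have hκ := hP.κ_ne (m + 2) (by simp; omega)
  have o1 := omPow_ne_zero (∑ i, σ i)
  have o2 := omPow_ne_zero (∑ i, ρ i)
  have o3 := omPow_ne_zero τ
  rw [omPow_sub, omPow_sub] at key
  rw [omPow_neg, omPow_neg, omPow_neg]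
  field_simp at key ⊢
  linear_combination key

/-- The recursion of $w_{p_{m+2,0}}$, whose argument contains $-\sigma_0$. It is the leading
coefficient in $\lambda$ of the same equation. -/
theorem kernelQ_sub_zero :
    S.rs (m + 2) * omPow (-τ) * (∏ k ∈ Finset.Icc 1 (m + 1), P.κ k) *
        kernelQ P S m (σ - Pi.single 0 1) τ ρ +
      S.r (m + 1) 0 * omPow (-σ 0) * (P.a (m + 2) * P.c (m + 2)) * kernelQ P S m σ τ ρ =
      S.r (m + 2) 0 * omPow (-ρ 0) * kernelQ P S m σ τ ρ := by
  have hF := isFermat_ptZero hS hP hm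
  have hy := hF.2
  have h1 := hF.one_sub_ne (ρ 0 - σ 0)
  have e1 : ρ 0 - (σ 0 - 1) - 1 = ρ 0 - σ 0 - 1 + 1 := by ring
  have e2 : (∑ i, ρ i - (∑ i, σ i - 1)) * (τ - ρ 0) =
      (∑ i, ρ i - ∑ i, σ i) * (τ - ρ 0) + (τ - ρ 0) := by ring
  have e3 : Fin.tail (σ - Pi.single 0 1) = Fin.tail σ := by
    funext i; simp [Fin.tail]
  have e4 : ∀ l : Fin m, (σ - Pi.single 0 1 : Fin (m + 1) → ZMod N) l.succ = σ l.succ := by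
    intro i; simp
  have e5 : (σ - Pi.single 0 1 : Fin (m + 1) → ZMod N) 0 = σ 0 - 1 := by simp
  have key : kernelQ P S m (σ - Pi.single 0 1) τ ρ * (ptZero P S (m + 2)).2 =
      kernelQ P S m σ τ ρ * (1 - omPow (ρ 0 - σ 0) * (ptZero P S (m + 2)).1) *
        omPow (τ - ρ 0) := by
    rw [kernelQ_eq, kernelQ_eq, sum_sub_single, e2, e3, e5, e1, hF.cyc_add_one, omPow_add,
      sub_add_cancel]
    simp only [e4]
    have h2 := hF.cyc_ne (ρ 0 - σ 0 - 1)
    generalize 1 - omPow (ρ 0 - σ 0) * (ptZero P S (m + 2)).1 = w at *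
    field_simp
  simp only [ptZero, show m + 2 - 1 = m + 1 from rfl,
    show Finset.Ico 1 (m + 2) = Finset.Icc 1 (m + 1) from rfl] at key
  have hr := r_ne_zero hS hP (m := m + 2) (s := 0) (by omega) hm (by omega)
  have o1 := omPow_ne_zero (σ 0)
  have o2 := omPow_ne_zero (ρ 0)
  have o3 := omPow_ne_zero τ
  rw [omPow_sub, omPow_sub] at key
  rw [omPow_neg, omPow_neg, omPow_neg]
  field_simp at key ⊢
  linear_combination key

omit hS hP hm [NeZero N] in
-- All arguments, and both factors of the exponent of $\omega$, depend only on differences that are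
-- unchanged under this exchange of shifts. It is what makes $\mathbf V$ shift $\rho_0$.
theorem kernelQ_charge :
    kernelQ P S m (σ - Pi.single 0 1) (τ - 1) ρ = kernelQ P S m σ τ (ρ + Pi.single 0 1) := by
  have e3 : Fin.tail (σ - Pi.single 0 1) = Fin.tail σ := by
    funext i; simp [Fin.tail]
  have e4 : ∀ l : Fin m, (σ - Pi.single 0 1 : Fin (m + 1) → ZMod N) l.succ = σ l.succ := by
    intro i; simp
  have e5 : (σ - Pi.single 0 1 : Fin (m + 1) → ZMod N) 0 = σ 0 - 1 := by simp
  have e6 : ∀ l : Fin (m + 1), (ρ + Pi.single 0 1 : Fin (m + 2) → ZMod N) l.succ = ρ l.succ := by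
    intro i; simp
  have e7 : (ρ + Pi.single 0 1 : Fin (m + 2) → ZMod N) 0 = ρ 0 + 1 := by simp
  rw [kernelQ_eq, kernelQ_eq, sum_sub_single, sum_add_single, e3, e5, e7]
  simp only [e4, e6]
  congr 4
  · congr 1 <;> ring
  · congr 1; ring
  · congr 1; ring

/-- The shift of $\sum\rho$ in $w_{\tilde p_{m+2}}$ is absorbed by $\tau-1$, and the functions $w$
of argument $\sigma_l-\rho_k$ supply the factors $1-\lambda_k/\lambda_l$. Their product is
proportional to the eigenvalue of the shorter $B$ at the new node, which is how it enters the action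
of $A$. -/
theorem kernelQ_add_succ (k : Fin (m + 1)) :
    kernelQ P S m σ τ (ρ + Pi.single k.succ 1) * ∏ l : Fin m, S.y (m + 2) (k + 1) (m + 1) (l + 1) =
      kernelQ P S m σ (τ - 1) ρ * omPow (τ - ρ 0 + ∑ i, ρ i - ∑ i, σ i) *
        ∏ l : Fin m, (1 - lam S (m + 2) (k + 1) (ρ k.succ) / lam S (m + 1) (l + 1) (σ l.succ)) := by
  have hF : ∀ l : Fin m, IsFermat N (ptRatio S (m + 2) (k + 1) (m + 1) (l + 1)) := fun l =>
    isFermat_ptRatio_prev hS hP hm (succ_mem_Ico k) (succ_mem_Ico l)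
  have e7 : (ρ + Pi.single k.succ 1 : Fin (m + 2) → ZMod N) 0 = ρ 0 := by
    simp
  have e8 : ∀ l : Fin m, ∏ k' : Fin (m + 1), cyc (ptRatio S (m + 2) (k' + 1) (m + 1) (l + 1))
      (σ l.succ - (ρ + Pi.single k.succ 1 : Fin (m + 2) → ZMod N) k'.succ) =
      (∏ k' : Fin (m + 1), cyc (ptRatio S (m + 2) (k' + 1) (m + 1) (l + 1))
        (σ l.succ - ρ k'.succ)) *
        ((1 - lam S (m + 2) (k + 1) (ρ k.succ) / lam S (m + 1) (l + 1) (σ l.succ)) /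
          S.y (m + 2) (k + 1) (m + 1) (l + 1)) := fun l => by
    refine prod_eq_prod_mul_of_eq_off _ (Finset.mem_univ k) (fun i _ hi => ?_) ?_
    · rw [Pi.add_apply, Pi.single_eq_of_ne (by simpa using hi), add_zero]
    · rw [Pi.add_apply, Pi.single_eq_same, ← sub_sub, (hF l).cyc_sub_one,
        ← lam_div_lam _ _ _ _ _ _ (r_ne_zero hS hP (by omega) (by omega) (by omega))]
      rfl
  have hy : ∏ l : Fin m, S.y (m + 2) (k + 1) (m + 1) (l + 1) ≠ 0 :=
    Finset.prod_ne_zero_iff.mpr fun l _ => (hF l).2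
  have e1 : ∑ i, ρ i + 1 - τ - 1 = ∑ i, ρ i - (τ - 1) - 1 := by ring
  have e2 : (∑ i, ρ i + 1 - ∑ i, σ i) * (τ - ρ 0) = (∑ i, ρ i - ∑ i, σ i) * (τ - 1 - ρ 0) +
      (τ - ρ 0 + ∑ i, ρ i - ∑ i, σ i) := by ring
  rw [kernelQ_eq, kernelQ_eq, sum_add_single, e7, e1, e2, omPow_add]
  simp only [e8, Finset.prod_mul_distrib, Finset.prod_div_distrib]
  field_simp

end Kernel

/-! ### The kernel at the zeros of the eigenvalue of `B` -/

section KernelNode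

theorem prod_Ico_succ_eq_prod_fin (m : ℕ) (f : ℕ → ℂ) :
    ∏ s ∈ Finset.Ico 1 (m + 1), f s = ∏ i : Fin m, f (i + 1) := by
  rw [Finset.prod_Ico_eq_prod_range, Finset.prod_range, Nat.add_sub_cancel]
  simp only [add_comm]

theorem prod_erase_Ico_succ_eq_prod_fin {m : ℕ} (l : Fin m) (f : ℕ → ℂ) :
    ∏ s ∈ (Finset.Ico 1 (m + 1)).erase (l + 1), f s = ∏ i ∈ Finset.univ.erase l, f (i + 1) := by
  symm
  refine Finset.prod_bij (fun i _ => (i : ℕ) + 1) (fun i hi => ?_) (fun i _ j _ h => ?_)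
    (fun s hs => ?_) (fun i _ => rfl)
  · refine Finset.mem_erase.mpr ⟨fun h => Finset.ne_of_mem_erase hi (Fin.ext ?_), succ_mem_Ico i⟩
    omega
  · exact Fin.ext (by omega)
  · obtain ⟨h1, h2⟩ := Finset.mem_erase.mp hs
    rw [Finset.mem_Ico] at h2
    refine ⟨⟨s - 1, by omega⟩, Finset.mem_erase.mpr ⟨fun h => h1 ?_, Finset.mem_univ _⟩, ?_⟩
    · rw [← h]; simp only; omega
    · simp only; omega

variable {N n : ℕ} [NeZero N] {P : SiteParams} {S : Amplitudes} {m : ℕ}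

/-- The factor `φ_k` of the action of `A_{M+1}` at its `k`-th node. -/
noncomputable def phiA {N : ℕ} (P : SiteParams) (S : Amplitudes) (M : ℕ) (k : Fin M)
    (ρ' : Fin M → ZMod N) : ℂ :=
  -(S.rt M / S.rs (M + 1)) * omPow (-∑ i, ρ' i) * F N P (M + 1) (nodes S M ρ' k / omega N) *
    ∏ s ∈ Finset.Ico 1 M, S.y (M + 1) (k + 1) M s

omit [NeZero N] in
theorem tail_sub_single_succ (σ : Fin (m + 1) → ZMod N) (l : Fin m) :
    Fin.tail (σ - Pi.single l.succ 1) = Fin.tail σ - Pi.single l 1 := by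
  funext i
  simp [Fin.tail, Pi.single_apply]

/-- The bookkeeping of one shift of the kernel. Only the Sklyanin weights $W$, $W'$ have to be
cancelled, so only these must be nonzero. -/
theorem kernel_quotient_identity {E o z t A B W W' p y T w v : ℂ} (hW : W ≠ 0) (hW' : W' ≠ 0) :
    E * o / (z * t) * (A * B / W') * (p * y / (T * (w / v))) * W' =
      E / (z * t) * (A / W) * (p / T) * W * o * B * y * (v / w) := by
  have h1 := inv_mul_cancel₀ hW
  have h2 := inv_mul_cancel₀ hW'
  simp only [div_eq_mul_inv, mul_inv, inv_inv]
  linear_combination (E * o * z⁻¹ * t⁻¹ * A * B * p * y * T⁻¹ * w⁻¹ * v) * (h2 - h1)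

/-- The algebraic core of `kernelQ_node`. Here $z$ is the node and $w=\omega$; $W,W'$ are the
Sklyanin weights and $Q,Q'$ the kernels before and after the shift; $U$ is the product of Lagrange
quotients, with $X$ the form given to it by the Sklyanin weight; $w_1,w_2$ come from the recursions
at $\tilde p_{m,l}$ and $p_{m,l}$ and cancel the factors of $F_m(z)$. The hypothesis `hy` is the
definition of $y_{m,l}$, which is the value that balances all remaining constants. -/
theorem kernel_node_identity {Q Q' W W' U X Pk Yk Yp Yr Rs y yt w₁ w₂ z w b c rt₁ rt₂ rs₂ rs₃ r₂ r₃ rl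
    o₁ oτ oρ oσ oS : ℂ} {m : ℕ} (hQ : Q' * W' = Q * W * o₁ * (Pk / Yk) * (y / w₂) * (yt / w₁))
    (hX : X = z ^ m * oS / Rs * Yr) (hsk : W * U = W' * X)
    (hy : y = rt₂ * r₃ * rs₂ / (rt₁ * r₂ * rs₃ * b * c * yt) * Yr⁻¹ * (Yk / Yp))
    (hrt : rt₂ = r₂ * (rl * Rs)) (ho : oτ * o₁ = oρ) (ho' : oσ * oS * rl = -z)
    (hW : W ≠ 0) (hYk : Yk ≠ 0) (hYp : Yp ≠ 0) (hYr : Yr ≠ 0) (hRs : Rs ≠ 0) (hyt : yt ≠ 0)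
    (hw₁ : w₁ ≠ 0) (hw₂ : w₂ ≠ 0) (hz : z ≠ 0) (hw : w ≠ 0) (hb : b ≠ 0) (hc : c ≠ 0)
    (hrt₁ : rt₁ ≠ 0) (hrs₂ : rs₂ ≠ 0) (hrs₃ : rs₃ ≠ 0) (hr₂ : r₂ ≠ 0) :
    rs₃ * oτ * (U * (z / (w * z)) *
      (-(rt₁ / rs₂) * (oσ * w) * (b * w₂ * (z * c * w₁)) * Yp * Q')) =
      r₃ * oρ * (z ^ (m + 2) * Pk) * Q := by
  have h : Q' * U = Q * o₁ * (Pk / Yk) * (y / w₂) * (yt / w₁) * X :=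
    mul_left_cancel₀ hW (by linear_combination X * hQ + Q' * hsk)
  have h' : Q' * U = o₁ * oS * rl * (Q * Pk * z ^ m * r₃ * rs₂ / (rt₁ * rs₃ * b * c * w₁ * w₂ * Yp)) := by
    rw [h, hX, hy, hrt]
    field_simp
  have h3 : rs₃ * oτ * (U * (z / (w * z)) *
      (-(rt₁ / rs₂) * (oσ * w) * (b * w₂ * (z * c * w₁)) * Yp * Q')) =
      -(rs₃ * rt₁ / rs₂ * b * c * w₁ * w₂ * Yp * z * oτ * oσ) * (Q' * U) := by
    field_simp
  have h4 : (rs₃ * rt₁ / rs₂ * b * c * w₁ * w₂ * Yp * z) *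
      (Q * Pk * z ^ m * r₃ * rs₂ / (rt₁ * rs₃ * b * c * w₁ * w₂ * Yp)) =
        Q * Pk * z ^ (m + 1) * r₃ := by
    field_simp
    ring
  rw [h3, h']
  linear_combination (-(oτ * o₁) * (oσ * oS * rl)) * h4 -
    (oσ * oS * rl * Q * Pk * z ^ (m + 1) * r₃) * ho - oρ * Q * Pk * z ^ (m + 1) * r₃ * ho'

theorem prod_erase_neg_nodes_div {M : ℕ} (hS : IsSolution N n P S) (hP : IsNondegenerate N n P S)
    (hM : M + 1 ≤ n) (ρ' : Fin M → ZMod N) (l : Fin M) :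
    ∏ s ∈ Finset.univ.erase l, -(nodes S M ρ' l / nodes S M ρ' s) =
      nodes S M ρ' l ^ (M - 1) * omPow (∑ i, ρ' i - ρ' l) /
        ∏ s ∈ Finset.univ.erase l, S.r (M + 1) (s + 1) := by
  rw [← Finset.sum_erase_eq_sub (Finset.mem_univ l), omPow_sum]
  have hc : nodes S M ρ' l ^ (M - 1) = ∏ _s ∈ Finset.univ.erase l, nodes S M ρ' l := by
    rw [Finset.prod_const, Finset.card_erase_of_mem (Finset.mem_univ l), Finset.card_univ,
      Fintype.card_fin]
  rw [hc, ← Finset.prod_mul_distrib, ← Finset.prod_div_distrib]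
  refine Finset.prod_congr rfl fun s _ => ?_
  have h1 := r_ne_zero hS hP (m := M + 1) (s := s + 1) (by omega) hM (by omega)
  have h2 := omPow_ne_zero (ρ' s)
  rw [show nodes S M ρ' s = -S.r (M + 1) (s + 1) * omPow (-ρ' s) from rfl, omPow_neg]
  field_simp

variable (σ : Fin (m + 1) → ZMod N) (τ : ZMod N) (ρ : Fin (m + 2) → ZMod N)
variable (hS : IsSolution N n P S) (hP : IsNondegenerate N n P S) (hm : m + 2 ≤ n)
include hS hP hm

/-- A shift of $\sigma_l$ moves one step in each $w$ linking $\sigma_l$ with the new variables, in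
$w_{p_{m+1,l}}$ and in $w_{\tilde p_{m+1,l}}$. The change of the Sklyanin weight is kept aside, to
be treated by `sklyanin_sub_single`. -/
theorem kernelQ_sub_succ (l : Fin m) :
    kernelQ P S m (σ - Pi.single l.succ 1) τ ρ * sklyanin S m (Fin.tail σ - Pi.single l 1) =
      kernelQ P S m σ τ ρ * sklyanin S m (Fin.tail σ) * omPow (τ - ρ 0) *
        ((∏ k : Fin (m + 1), (1 - lam S (m + 2) (k + 1) (ρ k.succ) / nodes S m (Fin.tail σ) l)) /
          ∏ k : Fin (m + 1), S.y (m + 2) (k + 1) (m + 1) (l + 1)) *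
        (yPlain P S (m + 1) (l + 1) /
          (1 - omPow (-σ l.succ + 1) * (ptPlain P S (m + 1) (l + 1)).1)) *
        (S.yt (m + 1) (l + 1) / (1 - omPow (σ l.succ) * (ptTilde P S (m + 1) (l + 1)).1)) := by
  obtain ⟨m, rfl⟩ : ∃ m', m = m' + 1 := ⟨m - 1, by have := l.2; omega⟩
  have hpl := isFermat_ptPlain hS hP hm (succ_mem_Ico l)
  have htl := isFermat_ptTilde hS hP (m := m + 2) (by simp; omega) (succ_mem_Ico l)
  have hF : ∀ (l : Fin (m + 1)) (k : Fin (m + 2)),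
      IsFermat N (ptRatio S (m + 3) (k + 1) (m + 2) (l + 1)) := fun l k =>
    isFermat_ptRatio_prev hS hP hm (succ_mem_Ico k) (succ_mem_Ico l)
  have hσ : ∀ i : Fin (m + 1), i ≠ l →
      (σ - Pi.single l.succ 1 : Fin (m + 2) → ZMod N) i.succ = σ i.succ := fun i hi => by
    rw [Pi.sub_apply, Pi.single_eq_of_ne (by simpa using hi), sub_zero]
  have hσl : (σ - Pi.single l.succ 1 : Fin (m + 2) → ZMod N) l.succ = σ l.succ - 1 := by simp
  have hσ0 : (σ - Pi.single l.succ 1 : Fin (m + 2) → ZMod N) 0 = σ 0 := by simp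
  have e1 : (∏ l' : Fin (m + 1), ∏ k : Fin (m + 2),
      cyc (ptRatio S (m + 3) (k + 1) (m + 2) (l' + 1))
        ((σ - Pi.single l.succ 1 : Fin (m + 2) → ZMod N) l'.succ - ρ k.succ)) =
      (∏ l' : Fin (m + 1), ∏ k : Fin (m + 2),
        cyc (ptRatio S (m + 3) (k + 1) (m + 2) (l' + 1)) (σ l'.succ - ρ k.succ)) *
      ((∏ k : Fin (m + 2), (1 - lam S (m + 3) (k + 1) (ρ k.succ) /
        nodes S (m + 1) (Fin.tail σ) l)) /
          ∏ k : Fin (m + 2), S.y (m + 3) (k + 1) (m + 2) (l + 1)) := by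
    refine prod_eq_prod_mul_of_eq_off _ (Finset.mem_univ l) (fun i _ hi => by rw [hσ i hi]) ?_
    rw [hσl, ← Finset.prod_div_distrib, ← Finset.prod_mul_distrib]
    refine Finset.prod_congr rfl fun k _ => ?_
    rw [sub_right_comm, (hF l k).cyc_sub_one, nodes, Fin.tail,
      ← lam_div_lam _ _ _ _ _ _ (r_ne_zero hS hP (by omega) (by omega) (by omega))]
    rfl
  have e2 : ∏ l' : Fin (m + 1), cyc (ptPlain P S (m + 2) (l' + 1))
      (-((σ - Pi.single l.succ 1 : Fin (m + 2) → ZMod N) l'.succ)) =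
      (∏ l' : Fin (m + 1), cyc (ptPlain P S (m + 2) (l' + 1)) (-(σ l'.succ))) *
        (yPlain P S (m + 2) (l + 1) /
          (1 - omPow (-σ l.succ + 1) * (ptPlain P S (m + 2) (l + 1)).1)) := by
    refine prod_eq_prod_mul_of_eq_off _ (Finset.mem_univ l) (fun i _ hi => by rw [hσ i hi]) ?_
    rw [hσl, neg_sub, sub_eq_neg_add, hpl.cyc_add_one]
    rfl
  have e3 : ∏ l' : Fin (m + 1), cyc (ptTilde P S (m + 2) (l' + 1))
      ((σ - Pi.single l.succ 1 : Fin (m + 2) → ZMod N) l'.succ) =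
      (∏ l' : Fin (m + 1), cyc (ptTilde P S (m + 2) (l' + 1)) (σ l'.succ)) *
        ((1 - omPow (σ l.succ) * (ptTilde P S (m + 2) (l + 1)).1) / S.yt (m + 2) (l + 1)) := by
    refine prod_eq_prod_mul_of_eq_off _ (Finset.mem_univ l) (fun i _ hi => by rw [hσ i hi]) ?_
    rw [hσl, htl.cyc_sub_one]
    rfl
  have e4 : (∑ i, ρ i - (∑ i, σ i - 1)) * (τ - ρ 0) =
      (∑ i, ρ i - ∑ i, σ i) * (τ - ρ 0) + (τ - ρ 0) := by ring
  have hW := sklyanin_ne_zero hS hP (by omega) (Fin.tail σ)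
  have hW' := sklyanin_ne_zero hS hP (by omega) (Fin.tail σ - Pi.single l 1)
  have h1 := htl.one_sub_ne (σ l.succ)
  have h2 := htl.2
  simp only [ptTilde] at h2
  rw [kernelQ_eq, kernelQ_eq, e1, e2, e3, tail_sub_single_succ, sum_sub_single, hσ0, e4, omPow_add]
  exact kernel_quotient_identity hW hW'

/-- The eigenvalue equation for $B$ at an old node: there the eigenvalue of the shorter $B$
vanishes, and the contribution of $A$ alone has to produce the new eigenvalue. -/
theorem kernelQ_node (l : Fin m) :
    S.rs (m + 2) * omPow (-τ) *
        ((∏ s ∈ Finset.univ.erase l, ((nodes S m (Fin.tail σ) l - nodes S m (Fin.tail σ) s) /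
            (omega N * nodes S m (Fin.tail σ) l - nodes S m (Fin.tail σ) s))) *
          (nodes S m (Fin.tail σ) l / (omega N * nodes S m (Fin.tail σ) l)) *
          (phiA P S m l (Fin.tail (σ - Pi.single l.succ 1)) *
            kernelQ P S m (σ - Pi.single l.succ 1) τ ρ)) =
      S.r (m + 2) 0 * omPow (-ρ 0) *
        (∏ k : Fin (m + 1), (nodes S m (Fin.tail σ) l - lam S (m + 2) (k + 1) (ρ k.succ))) *
        kernelQ P S m σ τ ρ := by
  have hQ := kernelQ_sub_succ σ τ ρ hS hP hm l
  have hsk := sklyanin_sub_single hS hP (by omega) (Fin.tail σ) l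
  have hW := sklyanin_ne_zero hS hP (by omega) (Fin.tail σ)
  have hW' := sklyanin_ne_zero hS hP (by omega) (Fin.tail σ - Pi.single l 1)
  have hz := nodes_ne_zero hS hP (by omega) (Fin.tail σ) l
  have hphi : phiA P S m l (Fin.tail (σ - Pi.single l.succ 1)) =
      -(S.rt m / S.rs (m + 1)) * (omPow (-∑ i, Fin.tail σ i) * omega N) *
        F N P (m + 1) (nodes S m (Fin.tail σ) l) * ∏ s ∈ Finset.Ico 1 m, S.y (m + 1) (l + 1) m s := by
    rw [phiA, tail_sub_single_succ, sum_sub_single, nodes_sub_single,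
      mul_div_cancel_left₀ _ omega_ne_zero, neg_sub, sub_eq_neg_add, omPow_add, omPow_one]
  have hr : ∀ s : Fin m, S.r (m + 1) (s + 1) ≠ 0 := fun s =>
    r_ne_zero hS hP (by omega) (by omega) (by omega)
  have hprod := prod_erase_neg_nodes_div hS hP (by omega) (Fin.tail σ) l
  have hk : ∏ k : Fin (m + 1), (nodes S m (Fin.tail σ) l - lam S (m + 2) (k + 1) (ρ k.succ)) =
      nodes S m (Fin.tail σ) l ^ (m + 1) * ∏ k : Fin (m + 1),
        (1 - lam S (m + 2) (k + 1) (ρ k.succ) / nodes S m (Fin.tail σ) l) := by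
    have hc : nodes S m (Fin.tail σ) l ^ (m + 1) =
        ∏ _k : Fin (m + 1), nodes S m (Fin.tail σ) l := by simp
    rw [hc, ← Finset.prod_mul_distrib]
    refine Finset.prod_congr rfl fun k _ => ?_
    field_simp
  have hyp : yPlain P S (m + 1) (l + 1) =
      S.rt (m + 1) * S.r (m + 2) 0 * S.rs (m + 1) /
        (S.rt m * S.r (m + 1) 0 * S.rs (m + 2) * P.b (m + 1) * P.c (m + 1) * S.yt (m + 1) (l + 1)) *
      (∏ s ∈ Finset.univ.erase l,
        S.y (m + 1) (s + 1) (m + 1) (l + 1) / S.y (m + 1) (l + 1) (m + 1) (s + 1))⁻¹ *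
      ((∏ k : Fin (m + 1), S.y (m + 2) (k + 1) (m + 1) (l + 1)) /
        ∏ s ∈ Finset.Ico 1 m, S.y (m + 1) (l + 1) m s) := by
    rw [yPlain, prod_erase_Ico_succ_eq_prod_fin l fun s =>
      S.y (m + 1) (l + 1) (m + 1) s / S.y (m + 1) s (m + 1) (l + 1),
      show Finset.Icc 1 (m + 1) = Finset.Ico 1 (m + 2) from rfl, prod_Ico_succ_eq_prod_fin,
      ← Finset.prod_inv_distrib]
    simp only [inv_div]
    rfl
  rw [Finset.prod_mul_distrib, hprod] at hsk
  have hrt : S.rt (m + 1) = S.r (m + 1) 0 * (S.r (m + 1) (l + 1) *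
      ∏ s ∈ Finset.univ.erase l, S.r (m + 1) (s + 1)) := by
    rw [rt_succ, prod_Ico_succ_eq_prod_fin,
      Finset.mul_prod_erase _ (fun s : Fin m => S.r (m + 1) (s + 1)) (Finset.mem_univ l)]
  obtain ⟨m, rfl⟩ : ∃ m', m = m' + 1 := ⟨m - 1, by have := l.2; omega⟩
  have hpl := isFermat_ptPlain hS hP hm (succ_mem_Ico l)
  have htl := isFermat_ptTilde hS hP (m := m + 2) (by simp; omega) (succ_mem_Ico l)
  have h1 := htl.one_sub_ne (σ l.succ)
  have h2 := hpl.one_sub_ne (-σ l.succ + 1)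
  have hyt := htl.2
  have hb := hP.b_ne (m + 2) (by simp; omega)
  have hc := hP.c_ne (m + 2) (by simp; omega)
  have hκ := hP.κ_ne (m + 2) (by simp; omega)
  have hrl := hr l
  have ho := omPow_ne_zero (σ l.succ)
  have hw := omega_ne_zero (N := N)
  have hzl : nodes S (m + 1) (Fin.tail σ) l = -S.r (m + 2) (l + 1) * (omPow (σ l.succ))⁻¹ := by
    rw [← omPow_neg]; rfl
  -- At a node, the two factors of $F$ are those appearing in the recursions of $w$ at $p_{m,l}$ and
  -- $\tilde p_{m,l}$; this is the reason for the abscissas of these points.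
  have hF : F N P (m + 2) (nodes S (m + 1) (Fin.tail σ) l) =
      P.b (m + 2) * (1 - omPow (-σ l.succ + 1) * (ptPlain P S (m + 2) (l + 1)).1) *
        (nodes S (m + 1) (Fin.tail σ) l * P.c (m + 2) *
          (1 - omPow (σ l.succ) * (ptTilde P S (m + 2) (l + 1)).1)) := by
    rw [hzl, F, omPow_add, omPow_neg, omPow_one]
    simp only [ptPlain, ptTilde]
    field_simp
    ring
  have hrs2 := hP.rs_ne (m + 2) (by simp; omega)
  have hrs3 := hP.rs_ne (m + 3) (by simp; omega)
  have hr0 := r_ne_zero hS hP (m := m + 2) (s := 0) (by omega) (by omega) (by omega)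
  have hrt1 := rt_ne_zero hS hP (m := m + 1) (by omega) (by omega)
  have hRs : ∏ s ∈ Finset.univ.erase l, S.r (m + 2) (s + 1) ≠ 0 :=
    Finset.prod_ne_zero_iff.mpr fun s _ => hr s
  have hYr : ∏ s ∈ Finset.univ.erase l,
      S.y (m + 2) (s + 1) (m + 2) (l + 1) / S.y (m + 2) (l + 1) (m + 2) (s + 1) ≠ 0 :=
    Finset.prod_ne_zero_iff.mpr fun s hs => div_ne_zero
      (isFermat_ptRatio_same' hS hP (by omega) (Finset.ne_of_mem_erase hs)).2
      (isFermat_ptRatio_same' hS hP (by omega) (Finset.ne_of_mem_erase hs).symm).2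
  have hYk : ∏ k : Fin (m + 2), S.y (m + 3) (k + 1) (m + 2) (l + 1) ≠ 0 :=
    Finset.prod_ne_zero_iff.mpr fun k _ =>
      (isFermat_ptRatio_prev hS hP hm (succ_mem_Ico k) (succ_mem_Ico l)).2
  have hYp : ∏ s ∈ Finset.Ico 1 (m + 1), S.y (m + 2) (l + 1) (m + 1) s ≠ 0 :=
    Finset.prod_ne_zero_iff.mpr fun s hs =>
      (isFermat_ptRatio_prev hS hP (by omega) (succ_mem_Ico l) hs).2
  have ho1 : omPow (-τ) * omPow (τ - ρ 0) = omPow (-ρ 0) := by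
    rw [← omPow_add]; congr 1; ring
  have ho2 : omPow (-∑ i, Fin.tail σ i) * omPow (∑ i, Fin.tail σ i - Fin.tail σ l) *
      S.r (m + 2) (l + 1) = -nodes S (m + 1) (Fin.tail σ) l := by
    rw [← omPow_add, hzl, ← omPow_neg, show -∑ i, Fin.tail σ i +
      (∑ i, Fin.tail σ i - Fin.tail σ l) = -σ l.succ by rw [Fin.tail]; ring]
    ring
  rw [hphi, hF, hk]
  exact kernel_node_identity hQ rfl hsk hyp hrt ho1 ho2 hW hYk hYp hYr hRs hyt h1 h2 hz hw hb hc
    hrt1 hrs2 hrs3 hr0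

end KernelNode

/-! ### Products of vectors and the recursion for the monodromy -/

section Tensor

variable {N n : ℕ}

/-- The product of a vector of an `n`-site chain and a vector at the site `n + 1`. -/
def tens : States N n →ₗ[ℂ] (ZMod N → ℂ) →ₗ[ℂ] States N (n + 1) :=
  LinearMap.mk₂ ℂ (fun f g γ => f (Fin.init γ) * g (γ (Fin.last n)))
    (fun f f' g => by funext γ; simp [add_mul])
    (fun z f g => by funext γ; simp [mul_assoc])
    (fun f g g' => by funext γ; simp [mul_add])
    (fun z f g => by funext γ; simp [mul_left_comm])

theorem tens_apply (f : States N n) (g : ZMod N → ℂ) (γ : Fin (n + 1) → ZMod N) :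
    tens f g γ = f (Fin.init γ) * g (γ (Fin.last n)) := rfl

theorem liftOp_tens (X : Module.End ℂ (States N n)) (f : States N n) (g : ZMod N → ℂ) :
    liftOp X (tens f g) = tens (X f) g := by
  funext γ
  rw [liftOp_apply, tens_apply]
  simp only [tens_apply, Fin.init_snoc, Fin.snoc_last]
  have h : (fun γ' => f γ' * g (γ (Fin.last n))) = g (γ (Fin.last n)) • f := by
    funext γ'; exact mul_comm _ _
  rw [h, map_smul]
  exact mul_comm _ _

variable [NeZero N] {P : SiteParams} {S : Amplitudes}

omit [NeZero N] in
theorem vOp_tens (f : States N n) (k : ℕ) (τ : ZMod N) :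
    vOp (Fin.last n) (tens f (psiSite P S k τ)) = tens f (psiSite P S k (τ + 1)) := by
  funext γ
  rw [vOp_apply, tens_apply, tens_apply, init_sub_single_last, Pi.sub_apply, Pi.single_eq_same,
    psiSite, psiSite]
  congr 2
  ring

/-- The recursion of $w_{p_k}$ read as an eigenvalue equation:
$u^{-1}(a-bv)\psi_\tau=r\,\omega^{-\tau}\psi_\tau$. -/
theorem psiSite_rec (hp : IsFermat N (ptSite P S (n + 1))) (ha : P.a (n + 1) ≠ 0) (τ γ : ZMod N) :
    P.a (n + 1) * psiSite P S (n + 1) τ γ - P.b (n + 1) * psiSite P S (n + 1) (τ + 1) γ =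
      S.rs (n + 1) * omPow (γ - τ) * psiSite P S (n + 1) τ γ := by
  have h := cyc_rec _ hp.1 hp.2 (γ - τ)
  rw [psiSite, psiSite, show γ - (τ + 1) = γ - τ - 1 by ring]
  simp only [ptSite] at h ⊢
  field_simp at h
  linear_combination h

theorem lOp_zero_one_tens (hp : IsFermat N (ptSite P S (n + 1))) (ha : P.a (n + 1) ≠ 0)
    (f : States N n) (τ : ZMod N) (l : ℂ) :
    lOp P (Fin.last n) l 0 1 (tens f (psiSite P S (n + 1) τ)) =
      (l * (S.rs (n + 1) * omPow (-τ))) • tens f (psiSite P S (n + 1) τ) := by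
  rw [(lOp_eq_linear P (Fin.last n) l).2.1, Fin.val_last, zero_add]
  simp only [LinearMap.smul_apply, LinearMap.sub_apply, Module.End.mul_apply, Module.End.one_apply,
    vOp_tens, mul_smul]
  congr 1
  funext γ
  rw [uInvOp_apply]
  simp only [Pi.sub_apply, Pi.smul_apply, tens_apply, smul_eq_mul]
  have h := psiSite_rec (P := P) (S := S) hp ha τ (γ (Fin.last n))
  have ho := omPow_ne_zero (γ (Fin.last n))
  rw [omPow_sub] at h
  rw [omPow_neg, omPow_neg, inv_mul_eq_iff_eq_mul₀ ho]
  linear_combination f (Fin.init γ) * h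

/-- The operator $u$ is not diagonal on the $\psi_\tau$, but the same recursion gives
$u\psi_\tau=(\omega^\tau/r)(a\psi_\tau-b\psi_{\tau+1})$. It is applied to $\psi_\tau$ and to
$v\psi_\tau=\psi_{\tau+1}$. -/
theorem lOp_one_zero_tens (hp : IsFermat N (ptSite P S (n + 1))) (ha : P.a (n + 1) ≠ 0)
    (hr : S.rs (n + 1) ≠ 0) (f : States N n) (τ : ZMod N) (l : ℂ) :
    lOp P (Fin.last n) l 1 0 (tens f (psiSite P S (n + 1) τ)) =
      (omPow τ / S.rs (n + 1) * P.c (n + 1)) • (P.a (n + 1) • tens f (psiSite P S (n + 1) τ) -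
        P.b (n + 1) • tens f (psiSite P S (n + 1) (τ + 1))) -
      (omPow (τ + 1) / S.rs (n + 1) * P.d (n + 1)) •
        (P.a (n + 1) • tens f (psiSite P S (n + 1) (τ + 1)) -
          P.b (n + 1) • tens f (psiSite P S (n + 1) (τ + 1 + 1))) := by
  rw [(lOp_eq_linear P (Fin.last n) l).2.2.1, Fin.val_last, smul_zero, add_zero]
  simp only [LinearMap.sub_apply, LinearMap.smul_apply, Module.End.mul_apply, Module.End.one_apply,
    vOp_tens]
  funext γ
  rw [uOp_apply]
  simp only [Pi.sub_apply, Pi.smul_apply, tens_apply, smul_eq_mul]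
  have h := psiSite_rec (P := P) (S := S) hp ha τ (γ (Fin.last n))
  have h' := psiSite_rec (P := P) (S := S) hp ha (τ + 1) (γ (Fin.last n))
  have ho := omPow_ne_zero τ
  have ho' := omPow_ne_zero (τ + 1)
  rw [omPow_sub] at h h'
  field_simp at h h' ⊢
  linear_combination (-(f (Fin.init γ) * P.c (n + 1))) * h + (f (Fin.init γ) * P.d (n + 1)) * h'

omit [NeZero N] in
theorem lOp_zero_zero_tens (f : States N n) (τ : ZMod N) (l : ℂ) :
    lOp P (Fin.last n) l 0 0 (tens f (psiSite P S (n + 1) τ)) =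
      tens f (psiSite P S (n + 1) τ) +
        (l * P.κ (n + 1)) • tens f (psiSite P S (n + 1) (τ + 1)) := by
  rw [(lOp_eq_linear P (Fin.last n) l).1, Fin.val_last]
  simp only [LinearMap.add_apply, LinearMap.smul_apply, Module.End.one_apply, vOp_tens, mul_smul]

omit [NeZero N] in
theorem lOp_one_one_tens (f : States N n) (τ : ZMod N) (l : ℂ) :
    lOp P (Fin.last n) l 1 1 (tens f (psiSite P S (n + 1) τ)) =
      (l * (P.a (n + 1) * P.c (n + 1))) • tens f (psiSite P S (n + 1) τ) +
        (P.b (n + 1) * P.d (n + 1) / P.κ (n + 1)) • tens f (psiSite P S (n + 1) (τ + 1)) := by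
  rw [(lOp_eq_linear P (Fin.last n) l).2.2.2, Fin.val_last]
  simp only [LinearMap.add_apply, LinearMap.smul_apply, Module.End.one_apply, vOp_tens, smul_smul]
  exact add_comm _ _

omit [NeZero N] in
theorem monodromy_succ_apply (P : SiteParams) (l : ℂ) (i j : Fin 2) (h : States N (n + 1)) :
    monodromy N (n + 1) P l i j h =
      liftOp (monodromy N n P l i 0) (lOp P (Fin.last n) l 0 j h) +
        liftOp (monodromy N n P l i 1) (lOp P (Fin.last n) l 1 j h) := by
  rw [monodromy_succ, Matrix.mul_apply, Fin.sum_univ_two, Matrix.map_apply, Matrix.map_apply]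
  rfl

theorem opB_tens (hp : IsFermat N (ptSite P S (n + 1))) (ha : P.a (n + 1) ≠ 0)
    (f : States N n) (τ : ZMod N) (l : ℂ) :
    opB N (n + 1) P l (tens f (psiSite P S (n + 1) τ)) =
      (l * (S.rs (n + 1) * omPow (-τ))) • tens (opA N n P l f) (psiSite P S (n + 1) τ) +
      ((l * (P.a (n + 1) * P.c (n + 1))) • tens (opB N n P l f) (psiSite P S (n + 1) τ) +
        (P.b (n + 1) * P.d (n + 1) / P.κ (n + 1)) •
          tens (opB N n P l f) (psiSite P S (n + 1) (τ + 1))) := by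
  rw [opB, monodromy_succ_apply, lOp_zero_one_tens hp ha, lOp_one_one_tens]
  simp only [map_smul, map_add, liftOp_tens]
  rfl

theorem opA_tens (hp : IsFermat N (ptSite P S (n + 1))) (ha : P.a (n + 1) ≠ 0)
    (hr : S.rs (n + 1) ≠ 0) (f : States N n) (τ : ZMod N) (l : ℂ) :
    opA N (n + 1) P l (tens f (psiSite P S (n + 1) τ)) =
      tens (opA N n P l f) (psiSite P S (n + 1) τ) +
        (l * P.κ (n + 1)) • tens (opA N n P l f) (psiSite P S (n + 1) (τ + 1)) +
      ((omPow τ / S.rs (n + 1) * P.c (n + 1)) •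
        (P.a (n + 1) • tens (opB N n P l f) (psiSite P S (n + 1) τ) -
          P.b (n + 1) • tens (opB N n P l f) (psiSite P S (n + 1) (τ + 1))) -
      (omPow (τ + 1) / S.rs (n + 1) * P.d (n + 1)) •
        (P.a (n + 1) • tens (opB N n P l f) (psiSite P S (n + 1) (τ + 1)) -
          P.b (n + 1) • tens (opB N n P l f) (psiSite P S (n + 1) (τ + 1 + 1)))) := by
  rw [opA, monodromy_succ_apply, lOp_zero_zero_tens, lOp_one_zero_tens hp ha hr]
  simp only [map_smul, map_add, map_sub, liftOp_tens]
  rfl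

omit [NeZero N] in
theorem chargeOp_tens (f : States N n) (k : ℕ) (τ : ZMod N) :
    chargeOp N (n + 1) (tens f (psiSite P S k τ)) =
      tens (chargeOp N n f) (psiSite P S k (τ + 1)) := by
  rw [chargeOp_succ, Module.End.mul_apply, vOp_tens, liftOp_tens]

/-- The factor of `ψ_τ` in the vector `Ψ` of an `m + 2`-site chain. -/
noncomputable def psiFactor (P : SiteParams) (S : Amplitudes) (m : ℕ) (ρ : Fin (m + 2) → ZMod N)
    (τ : ZMod N) : States N (m + 1) :=
  ∑ σ, kernelQ P S m σ τ ρ • Psi P S (m + 1) σ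

theorem Psi_succ (m : ℕ) (ρ : Fin (m + 2) → ZMod N) :
    Psi P S (m + 2) ρ = ∑ τ, tens (psiFactor P S m ρ τ) (psiSite P S (m + 2) τ) := by
  funext γ
  simp only [Psi, psiFactor, map_sum, map_smul, LinearMap.sum_apply, LinearMap.smul_apply,
    Finset.sum_apply, Pi.smul_apply, tens_apply, smul_eq_mul]
  rw [Finset.sum_comm]
  simp only [mul_assoc]

/-- The constant function $1$ is the state of the empty chain; the base of the induction can then
use the same product formulas as the step. -/
theorem Psi_one (ρ : Fin 1 → ZMod N) :
    Psi P S 1 ρ = tens (fun _ => 1) (psiSite P S 1 (ρ 0)) := by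
  funext γ
  rw [tens_apply, one_mul]
  rfl

/-- The two arguments keep apart the $\tau$ of the coefficient and the $\tau$ of $\psi_\tau$, so
that terms can be collected by the latter. -/
theorem sum_shift {V : Type*} [AddCommMonoid V] (f : ZMod N → ZMod N → V) :
    ∑ τ, f τ (τ + 1) = ∑ τ, f (τ - 1) τ := by
  rw [← Equiv.sum_comp (Equiv.addRight (1 : ZMod N)) fun τ => f (τ - 1) τ]
  simp

theorem sum_shift_two {V : Type*} [AddCommMonoid V] (f : ZMod N → ZMod N → V) :
    ∑ τ, f τ (τ + 1 + 1) = ∑ τ, f (τ - 1 - 1) τ := by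
  rw [sum_shift (fun τ τ' => f τ (τ' + 1)), sum_shift (fun τ τ' => f (τ - 1) τ')]

end Tensor

/-! ### The action of the operators on the vectors `Ψ` -/

section Action

variable {N n : ℕ} [NeZero N] {P : SiteParams} {S : Amplitudes}

/-- The action of `𝐕`, of `B(λ)` and of `A` at the zeros of the eigenvalue of `B`
on the vectors `Ψ` of an `m + 1`-site chain. -/
structure ActsOnPsi (N : ℕ) [NeZero N] (P : SiteParams) (S : Amplitudes) (m : ℕ) : Prop where
  charge : ∀ ρ, chargeOp N (m + 1) (Psi P S (m + 1) ρ) = Psi P S (m + 1) (ρ + Pi.single 0 1)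
  B : ∀ l ρ, opB N (m + 1) P l (Psi P S (m + 1) ρ) =
    (l * (S.r (m + 1) 0 * omPow (-ρ 0) * ∏ s, (l - nodes S m (Fin.tail ρ) s))) •
      Psi P S (m + 1) ρ
  A : ∀ ρ k, opA N (m + 1) P (nodes S m (Fin.tail ρ) k) (Psi P S (m + 1) ρ) =
    phiA P S m k (Fin.tail ρ) • Psi P S (m + 1) (ρ + Pi.single k.succ 1)

omit [NeZero N] in
theorem tail_add_single_succ {m : ℕ} (σ : Fin (m + 1) → ZMod N) (l : Fin m) :
    Fin.tail (σ + Pi.single l.succ 1) = Fin.tail σ + Pi.single l 1 := by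
  funext i
  simp [Fin.tail, Pi.single_apply]

omit [NeZero N] in
theorem tail_add_single_zero {m : ℕ} (σ : Fin (m + 1) → ZMod N) :
    Fin.tail (σ + Pi.single 0 1) = Fin.tail σ := by
  funext i
  simp [Fin.tail]

/-- The constant term of the eigenvalue of $B(\lambda)/\lambda$, in the form in which it meets
$w_{\tilde p_m}$. -/
theorem r_zero_mul_prod_nodes (m : ℕ) (ρ : Fin (m + 1) → ZMod N) :
    S.r (m + 1) 0 * omPow (-ρ 0) * ∏ s, -nodes S m (Fin.tail ρ) s =
      S.rt (m + 1) * omPow (-∑ i, ρ i) := by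
  rw [rt_succ, prod_Ico_succ_eq_prod_fin, ← Finset.sum_neg_distrib, omPow_sum, Fin.prod_univ_succ]
  have h : ∏ s, -nodes S m (Fin.tail ρ) s =
      (∏ s : Fin m, S.r (m + 1) (s + 1)) * ∏ s : Fin m, omPow (-ρ s.succ) := by
    rw [← Finset.prod_mul_distrib]
    refine Finset.prod_congr rfl fun s _ => ?_
    rw [nodes, lam, neg_mul, neg_neg]
    rfl
  rw [h]
  ring

theorem actsOnPsi_zero (hS : IsSolution N n P S) (hP : IsNondegenerate N n P S) (hn : 1 ≤ n) :
    ActsOnPsi N P S 0 where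
  charge ρ := by
    rw [Psi_one, Psi_one, chargeOp_tens]
    simp [chargeOp]
  B l ρ := by
    rw [Psi_one, opB_tens (isFermat_ptSite hS hP (by simp; omega)) (hP.a_ne _ (by simp; omega))]
    simp [opA, opB, monodromy, hS.one]
  A ρ k := k.elim0

variable (hS : IsSolution N n P S) (hP : IsNondegenerate N n P S)
include hS hP

theorem ActsOnPsi.opA_eq_interp {m : ℕ} (hm : m + 1 ≤ n) (h : ActsOnPsi N P S m) (l : ℂ)
    (σ : Fin (m + 1) → ZMod N) :
    opA N (m + 1) P l (Psi P S (m + 1) σ) = interp (nodes S m (Fin.tail σ))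
      (fun k => phiA P S m k (Fin.tail σ) • Psi P S (m + 1) (σ + Pi.single k.succ 1))
      -- The trivial scalar and the trivial shift bring the expression into the form required by
      -- `sum_smul_interp_shift`.
      ((1 : ℂ) • Psi P S (m + 1) (σ + 0))
      ((∏ k ∈ Finset.Icc 1 (m + 1), P.κ k) • Psi P S (m + 1) (σ + Pi.single 0 1)) l := by
  have h1 := (monodromy_polyEnds (N := N) P (m + 1)).1.map
    (LinearMap.applyₗ (R := ℂ) (M := States N (m + 1)) (M₂ := States N (m + 1))
      (Psi P S (m + 1) σ))
  have h2 := h1.eq_interp (nodes_injective hP hm (Fin.tail σ))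
    (nodes_ne_zero hS hP hm (Fin.tail σ)) l
  simp only [LinearMap.applyₗ_apply_apply, h.A, LinearMap.smul_apply, Module.End.one_apply,
    h.charge] at h2
  rw [h2, one_smul, add_zero]

theorem sum_smul_opA_Psi {m : ℕ} (hm : m + 1 ≤ n) (h : ActsOnPsi N P S m) (l : ℂ)
    (Q : (Fin (m + 1) → ZMod N) → ℂ) :
    opA N (m + 1) P l (∑ σ, Q σ • Psi P S (m + 1) σ) =
      ∑ σ, interp (nodes S m (Fin.tail σ)) (fun k => ((∏ s ∈ Finset.univ.erase k,
          (nodes S m (Fin.tail σ) k - nodes S m (Fin.tail σ) s) /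
            (omega N * nodes S m (Fin.tail σ) k - nodes S m (Fin.tail σ) s)) *
          (nodes S m (Fin.tail σ) k / (omega N * nodes S m (Fin.tail σ) k))) *
            (phiA P S m k (Fin.tail (σ - Pi.single k.succ 1)) * Q (σ - Pi.single k.succ 1)))
        (Q σ) ((∏ k ∈ Finset.Icc 1 (m + 1), P.κ k) * Q (σ - Pi.single 0 1)) l •
          Psi P S (m + 1) σ := by
  simp only [map_sum, map_smul, h.opA_eq_interp hS hP hm]
  rw [sum_smul_interp_shift (fun σ => nodes S m (Fin.tail σ))
    (fun σ => nodes_injective hP hm _) (fun σ => nodes_ne_zero hS hP hm _)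
    (fun k => Pi.single k.succ 1) 0 (Pi.single 0 1) (fun σ k s hs => by
      rw [tail_add_single_succ, nodes_add_single_of_ne _ _ hs]) (fun σ => by rw [add_zero])
    (fun σ => by rw [tail_add_single_zero]) (Psi P S (m + 1)) (fun σ k => phiA P S m k (Fin.tail σ))]
  simp only [tail_sub_single_succ, nodes_sub_single, one_mul, sub_zero]

/-- The component along $\psi_\tau$ of the eigenvalue equation for $B$ of the longer chain. Once $A$
is expanded by interpolation, the coefficients of each $\Psi_\sigma$ can be compared. -/
theorem opB_recursion {m : ℕ} (hm : m + 2 ≤ n) (h : ActsOnPsi N P S m) (l : ℂ)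
    (ρ : Fin (m + 2) → ZMod N) (τ : ZMod N) :
    (l * (S.rs (m + 2) * omPow (-τ))) • opA N (m + 1) P l (psiFactor P S m ρ τ) +
      ((l * (P.a (m + 2) * P.c (m + 2))) • opB N (m + 1) P l (psiFactor P S m ρ τ) +
        (P.b (m + 2) * P.d (m + 2) / P.κ (m + 2)) •
          opB N (m + 1) P l (psiFactor P S m ρ (τ - 1))) =
      (l * (S.r (m + 2) 0 * omPow (-ρ 0) * ∏ s, (l - nodes S (m + 1) (Fin.tail ρ) s))) •
        psiFactor P S m ρ τ := by
  simp only [psiFactor]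
  rw [sum_smul_opA_Psi hS hP (by omega) h]
  simp only [map_sum, map_smul, h.B, Finset.smul_sum, ← Finset.sum_add_distrib, smul_smul,
    ← add_smul]
  refine Finset.sum_congr rfl fun σ _ => congrArg (· • Psi P S (m + 1) σ) ?_
  have hz := nodes_injective hP (M := m) (by omega) (Fin.tail σ)
  have hz0 := nodes_ne_zero hS hP (M := m) (by omega) (Fin.tail σ)
  have hnode := fun k => kernelQ_node σ τ ρ hS hP hm k
  generalize hv : (fun k => ((∏ s ∈ Finset.univ.erase k,
    (nodes S m (Fin.tail σ) k - nodes S m (Fin.tail σ) s) /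
      (omega N * nodes S m (Fin.tail σ) k - nodes S m (Fin.tail σ) s)) *
    (nodes S m (Fin.tail σ) k / (omega N * nodes S m (Fin.tail σ) k))) *
      (phiA P S m k (Fin.tail (σ - Pi.single k.succ 1)) *
        kernelQ P S m (σ - Pi.single k.succ 1) τ ρ)) = v
  have hv' : ∀ k, _ = v k := congrFun hv
  simp only at hv'
  simp only [hv'] at hnode
  have h1 := (polyEnds_interp hz0 v (kernelQ P S m σ τ ρ)
    ((∏ k ∈ Finset.Icc 1 (m + 1), P.κ k) * kernelQ P S m (σ - Pi.single 0 1) τ ρ)).map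
      (LinearMap.lsmul ℂ ℂ (S.rs (m + 2) * omPow (-τ)))
  have h2 := ((PolyEnds.prod Finset.univ (nodes S m (Fin.tail σ))).mul_linear
    (P.b (m + 2) * P.d (m + 2) / P.κ (m + 2) * kernelQ P S m σ (τ - 1) ρ)
    (P.a (m + 2) * P.c (m + 2) * kernelQ P S m σ τ ρ)).map
      (LinearMap.lsmul ℂ ℂ (S.r (m + 1) 0 * omPow (-σ 0)))
  have h3 := (PolyEnds.prod Finset.univ (nodes S (m + 1) (Fin.tail ρ))).map
      (LinearMap.lsmul ℂ ℂ (-(S.r (m + 2) 0 * omPow (-ρ 0) * kernelQ P S m σ τ ρ)))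
  rw [Finset.card_univ, Fintype.card_fin] at h2 h3
  simp only [LinearMap.lsmul_apply, smul_eq_mul] at h1 h2 h3
  have e1 := r_zero_mul_prod_nodes (S := S) m σ
  have e2 := r_zero_mul_prod_nodes (S := S) (m + 1) ρ
  -- Divided by $\lambda$, the difference of the two sides has degree $m+1$. Its constant term, its
  -- leading coefficient and its values at the $m$ old nodes vanish by the three relations for the
  -- kernel.
  have h4 := (((h1.add h2).add h3).congr (fun _ => rfl) (y₀ := 0) (yₙ := 0) ?_ ?_).eq_zero
    hz hz0 ?_ l
  · linear_combination l * h4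
  · linear_combination kernelQ_sub_tau σ τ ρ hS hP hm - kernelQ P S m σ τ ρ * e2 +
      P.b (m + 2) * P.d (m + 2) / P.κ (m + 2) * kernelQ P S m σ (τ - 1) ρ * e1
  · linear_combination kernelQ_sub_zero σ τ ρ hS hP hm
  · intro k
    rw [interp_node hz hz0, Finset.prod_eq_zero (f := fun s => nodes S m (Fin.tail σ) k -
      nodes S m (Fin.tail σ) s) (Finset.mem_univ k) (sub_self _)]
    have h5 := hnode k
    change _ = _ * (∏ s, (_ - nodes S (m + 1) (Fin.tail ρ) s)) * _ at h5
    linear_combination h5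

omit hS hP in
theorem ActsOnPsi.charge_succ {m : ℕ} (h : ActsOnPsi N P S m) (ρ : Fin (m + 2) → ZMod N) :
    chargeOp N (m + 2) (Psi P S (m + 2) ρ) = Psi P S (m + 2) (ρ + Pi.single 0 1) := by
  rw [Psi_succ, Psi_succ, map_sum]
  simp only [chargeOp_tens]
  rw [sum_shift fun τ τ' => tens (chargeOp N (m + 1) (psiFactor P S m ρ τ)) (psiSite P S (m + 2) τ')]
  refine Finset.sum_congr rfl fun τ _ => ?_
  congr 2
  simp only [psiFactor, map_sum, map_smul, h.charge, ← kernelQ_charge]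
  refine Eq.trans ?_ (Equiv.sum_comp (Equiv.addRight (Pi.single (0 : Fin (m + 1)) (1 : ZMod N)))
    (fun σ => kernelQ P S m (σ - Pi.single 0 1) (τ - 1) ρ • Psi P S (m + 1) σ))
  simp

theorem ActsOnPsi.B_succ {m : ℕ} (hm : m + 2 ≤ n) (h : ActsOnPsi N P S m) (l : ℂ)
    (ρ : Fin (m + 2) → ZMod N) : opB N (m + 2) P l (Psi P S (m + 2) ρ) =
      (l * (S.r (m + 2) 0 * omPow (-ρ 0) * ∏ s, (l - nodes S (m + 1) (Fin.tail ρ) s))) •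
        Psi P S (m + 2) ρ := by
  rw [Psi_succ, map_sum]
  simp only [opB_tens (isFermat_ptSite hS hP (k := m + 2) (by simp; omega))
    (hP.a_ne _ (by simp; omega)), Finset.sum_add_distrib]
  rw [sum_shift fun τ τ' => (P.b (m + 2) * P.d (m + 2) / P.κ (m + 2)) •
    tens (opB N (m + 1) P l (psiFactor P S m ρ τ)) (psiSite P S (m + 2) τ')]
  rw [← Finset.sum_add_distrib, ← Finset.sum_add_distrib, Finset.smul_sum]
  refine Finset.sum_congr rfl fun τ _ => ?_
  have h1 := congrArg (fun f => tens f (psiSite P S (m + 2) τ)) (opB_recursion hS hP hm h l ρ τ)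
  simpa only [map_add, map_smul, LinearMap.add_apply, LinearMap.smul_apply] using h1

/-- At a node of the longer chain the right side of `opB_recursion` is zero, so $A$ of the shorter
chain can be eliminated in favour of $B$, which is diagonal. -/
theorem ActsOnPsi.A_succ {m : ℕ} (hm : m + 2 ≤ n) (h : ActsOnPsi N P S m)
    (ρ : Fin (m + 2) → ZMod N) (k : Fin (m + 1)) :
    opA N (m + 2) P (nodes S (m + 1) (Fin.tail ρ) k) (Psi P S (m + 2) ρ) =
      phiA P S (m + 1) k (Fin.tail ρ) • Psi P S (m + 2) (ρ + Pi.single k.succ 1) := by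
  have hl := nodes_ne_zero hS hP (M := m + 1) (by omega) (Fin.tail ρ) k
  have hrec := opB_recursion hS hP hm h (nodes S (m + 1) (Fin.tail ρ) k) ρ
  have hrs := hP.rs_ne (m + 2) (by simp; omega)
  have hκ := hP.κ_ne (m + 2) (by simp; omega)
  have hw := omega_ne_zero (N := N)
  simp only [Finset.prod_eq_zero (f := fun s => nodes S (m + 1) (Fin.tail ρ) k -
    nodes S (m + 1) (Fin.tail ρ) s) (Finset.mem_univ k) (sub_self _), mul_zero, zero_smul] at hrec
  rw [Psi_succ, map_sum, Psi_succ, Finset.smul_sum]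
  simp only [opA_tens (isFermat_ptSite hS hP (k := m + 2) (by simp; omega))
    (hP.a_ne _ (by simp; omega)) hrs]
  generalize hL : nodes S (m + 1) (Fin.tail ρ) k = l at *
  set a := fun τ => opA N (m + 1) P l (psiFactor P S m ρ τ) with ha
  set Ξ := fun τ => opB N (m + 1) P l (psiFactor P S m ρ τ) with hΞ
  have ha' : ∀ τ, a τ = -(omPow τ / (l * S.rs (m + 2))) • ((l * (P.a (m + 2) * P.c (m + 2))) • Ξ τ +
      (P.b (m + 2) * P.d (m + 2) / P.κ (m + 2)) • Ξ (τ - 1)) := fun τ => by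
    have h1 := eq_neg_of_add_eq_zero_left (hrec τ)
    have ho := omPow_ne_zero τ
    rw [neg_smul, ← smul_neg, ← h1, smul_smul, omPow_neg, show
      omPow τ / (l * S.rs (m + 2)) * (l * (S.rs (m + 2) * (omPow τ)⁻¹)) = 1 by field_simp, one_smul]
  -- The action of $A$ on the product is split by the shift $0$, $1$ or $2$ of the index of $\psi$.
  set X : ZMod N → ZMod N → States N (m + 2) := fun τ τ' =>
    tens (a τ + (omPow τ / S.rs (m + 2) * P.c (m + 2) * P.a (m + 2)) • Ξ τ)
      (psiSite P S (m + 2) τ') with hX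
  set Y : ZMod N → ZMod N → States N (m + 2) := fun τ τ' =>
    tens ((l * P.κ (m + 2)) • a τ - (omPow τ / S.rs (m + 2) * P.c (m + 2) * P.b (m + 2) +
      omPow (τ + 1) / S.rs (m + 2) * P.d (m + 2) * P.a (m + 2)) • Ξ τ)
      (psiSite P S (m + 2) τ') with hY
  set Z : ZMod N → ZMod N → States N (m + 2) := fun τ τ' =>
    tens ((omPow (τ + 1) / S.rs (m + 2) * P.d (m + 2) * P.b (m + 2)) • Ξ τ)
      (psiSite P S (m + 2) τ') with hZ
  have hsum : ∀ τ, tens (a τ) (psiSite P S (m + 2) τ) +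
        (l * P.κ (m + 2)) • tens (a τ) (psiSite P S (m + 2) (τ + 1)) +
      ((omPow τ / S.rs (m + 2) * P.c (m + 2)) •
        (P.a (m + 2) • tens (Ξ τ) (psiSite P S (m + 2) τ) -
          P.b (m + 2) • tens (Ξ τ) (psiSite P S (m + 2) (τ + 1))) -
      (omPow (τ + 1) / S.rs (m + 2) * P.d (m + 2)) •
        (P.a (m + 2) • tens (Ξ τ) (psiSite P S (m + 2) (τ + 1)) -
          P.b (m + 2) • tens (Ξ τ) (psiSite P S (m + 2) (τ + 1 + 1)))) =
      X τ τ + Y τ (τ + 1) + Z τ (τ + 1 + 1) := fun τ => by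
    simp only [hX, hY, hZ, map_add, map_sub, map_smul, LinearMap.add_apply, LinearMap.sub_apply,
      LinearMap.smul_apply]
    module
  refine (Finset.sum_congr rfl fun τ _ => hsum τ).trans ?_
  rw [Finset.sum_add_distrib, Finset.sum_add_distrib, sum_shift Y, sum_shift_two Z,
    ← Finset.sum_add_distrib, ← Finset.sum_add_distrib]
  refine Finset.sum_congr rfl fun τ _ => ?_
  suffices hv : a τ + (omPow τ / S.rs (m + 2) * P.c (m + 2) * P.a (m + 2)) • Ξ τ +
      ((l * P.κ (m + 2)) • a (τ - 1) -
        (omPow (τ - 1) / S.rs (m + 2) * P.c (m + 2) * P.b (m + 2) +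
          omPow (τ - 1 + 1) / S.rs (m + 2) * P.d (m + 2) * P.a (m + 2)) • Ξ (τ - 1)) +
      (omPow (τ - 1 - 1 + 1) / S.rs (m + 2) * P.d (m + 2) * P.b (m + 2)) • Ξ (τ - 1 - 1) =
      phiA P S (m + 1) k (Fin.tail ρ) • psiFactor P S m (ρ + Pi.single k.succ 1) τ by
    simpa only [hX, hY, hZ, map_add, map_sub, map_smul, LinearMap.add_apply, LinearMap.sub_apply,
      LinearMap.smul_apply] using congrArg (fun f => tens f (psiSite P S (m + 2) τ)) hv
  have hF : F N P (m + 2) (l / omega N) = (P.b (m + 2) + P.a (m + 2) * P.κ (m + 2) * l) *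
      (l / omega N * P.c (m + 2) + P.d (m + 2) / P.κ (m + 2)) := by
    rw [F]; field_simp
  -- After the elimination, the coefficients of $\Xi_\tau$ and $\Xi_{\tau-2}$ cancel, and that of
  -- $\Xi_{\tau-1}$ factors into $F(\lambda/\omega)$.
  trans (-(F N P (m + 2) (l / omega N) * (omPow τ / (l * S.rs (m + 2))))) • Ξ (τ - 1)
  · rw [ha', ha', hF, sub_add_cancel, sub_add_cancel, omPow_sub, omPow_one]
    match_scalars
    · field_simp
      ring
    · field_simp
      ring
    · field_simp
      ring
  · simp only [hΞ, psiFactor, map_sum, map_smul, h.B, Finset.smul_sum, smul_smul]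
    refine Finset.sum_congr rfl fun σ _ => congrArg (· • Psi P S (m + 1) σ) ?_
    have hQ := kernelQ_add_succ σ τ ρ hS hP hm k
    have e1 := r_zero_mul_prod_nodes (S := S) m σ
    have e2 : ∏ s, (l - nodes S m (Fin.tail σ) s) = (∏ s, -nodes S m (Fin.tail σ) s) *
        ∏ s, (1 - l / nodes S m (Fin.tail σ) s) := by
      rw [← Finset.prod_mul_distrib]
      refine Finset.prod_congr rfl fun s _ => ?_
      have := nodes_ne_zero hS hP (M := m) (by omega) (Fin.tail σ) s
      field_simp
      ring
    -- The phase of `kernelQ_add_succ` and that of $\varphi_k$ combine into the phases of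
    -- $\psi_\tau$ and of the eigenvalue of $B$.
    have e3 : omPow (-∑ i, Fin.tail ρ i) * omPow (τ - ρ 0 + ∑ i, ρ i - ∑ i, σ i) =
        omPow τ * omPow (-∑ i, σ i) := by
      rw [← omPow_add, ← omPow_add, Fin.sum_univ_succ ρ]
      simp only [Fin.tail]
      congr 1
      ring
    change _ = _ * ∏ s, (1 - nodes S (m + 1) (Fin.tail ρ) k / nodes S m (Fin.tail σ) s) at hQ
    rw [hL] at hQ
    rw [phiA, hL, prod_Ico_succ_eq_prod_fin, e2]
    have e4 : F N P (m + 2) (l / omega N) * (omPow τ / (l * S.rs (m + 2))) * l =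
        F N P (m + 2) (l / omega N) * omPow τ / S.rs (m + 2) := by
      field_simp
    generalize ∏ s, (1 - l / nodes S m (Fin.tail σ) s) = p at *
    generalize ∏ s, -nodes S m (Fin.tail σ) s = p' at *
    linear_combination (-(kernelQ P S m σ (τ - 1) ρ * (S.r (m + 1) 0 * omPow (-σ 0) * (p' * p)))) * e4 -
      F N P (m + 2) (l / omega N) * omPow τ / S.rs (m + 2) * kernelQ P S m σ (τ - 1) ρ * p * e1 +
      (S.rt (m + 1) / S.rs (m + 2)) * omPow (-∑ i, Fin.tail ρ i) * F N P (m + 2) (l / omega N) * hQ +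
      (S.rt (m + 1) / S.rs (m + 2)) * F N P (m + 2) (l / omega N) * kernelQ P S m σ (τ - 1) ρ * p * e3

theorem actsOnPsi (m : ℕ) (hm : m + 1 ≤ n) : ActsOnPsi N P S m := by
  induction m with
  | zero => exact actsOnPsi_zero hS hP hm
  | succ m ih =>
    have h := ih (by omega)
    exact ⟨h.charge_succ, h.B_succ hS hP hm, h.A_succ hS hP hm⟩

end Action

/-! ### The action of `D` -/

section ActionD

variable {N n : ℕ} [NeZero N] {P : SiteParams} {S : Amplitudes} {m : ℕ}
  (hS : IsSolution N n P S) (hP : IsNondegenerate N n P S) (hm : m + 1 ≤ n)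
include hS hP hm

omit hm in
theorem prod_y_prev_ne_zero (hm : m + 1 ≤ n) (k : Fin m) :
    ∏ s ∈ Finset.Ico 1 m, S.y (m + 1) (k + 1) m s ≠ 0 := by
  obtain ⟨m, rfl⟩ : ∃ m', m = m' + 1 := ⟨m - 1, by have := k.2; omega⟩
  exact Finset.prod_ne_zero_iff.mpr fun s hs =>
    (isFermat_ptRatio_prev hS hP hm (succ_mem_Ico k) hs).2

omit hS in
theorem F_nodes_ne_zero (k : Fin m) (ρ' : Fin m → ZMod N) {j : ℕ} (hj : j ∈ Finset.Icc 1 n) :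
    F N P j (nodes S m ρ' k) ≠ 0 :=
  F_lam_ne_zero hP (by have := k.2; simp; omega) (succ_mem_Ico k) hj _

theorem phiA_ne_zero (k : Fin m) (ρ' : Fin m → ZMod N) : phiA P S m k ρ' ≠ 0 := by
  have hk := k.2
  rw [phiA, ← nodes_add_single]
  exact mul_ne_zero (mul_ne_zero (mul_ne_zero (neg_ne_zero.mpr (div_ne_zero
    (rt_ne_zero hS hP (by omega) (by omega)) (hP.rs_ne _ (by simp; omega)))) (omPow_ne_zero _))
    (F_nodes_ne_zero hP hm k _ (by simp; omega))) (prod_y_prev_ne_zero hS hP hm k)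

/-- The consistency of the shifts by $A$ and $D$ with the quantum determinant: the phases,
amplitudes and $y$ coordinates are inverse to each other, and the products $F$ complete one another.
-/
theorem phiA_sub_single_mul_phiTilde (k : Fin m) (ρ' : Fin m → ZMod N) :
    phiA P S m k (ρ' - Pi.single k 1) * phiTilde P S m k ρ' =
      ∏ j ∈ Finset.Icc 1 (m + 1), F N P j (nodes S m ρ' k) := by
  have hk := k.2
  have h1 := rt_ne_zero hS hP (m := m) (by omega) (by omega)
  have h2 := hP.rs_ne (m + 1) (by simp; omega)
  have h3 := omPow_ne_zero (∑ i, ρ' i - 1)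
  have h4 := prod_y_prev_ne_zero hS hP hm k
  rw [phiA, phiTilde, nodes_sub_single, mul_div_cancel_left₀ _ omega_ne_zero, sum_sub_single,
    omPow_neg, Finset.prod_Icc_succ_top (by omega), ← nodes]
  field_simp

/-- The row form of the quantum determinant is applied to $\Psi$ with $\rho_k$ lowered. Its $k$-th
node is $\omega\lambda_k$, so $B(\omega\lambda_k)$ annihilates this vector and $A(\omega\lambda_k)$
maps it to a nonzero multiple of $\Psi_{\boldsymbol\rho}$; dividing by this multiple leaves
$D(\lambda_k)\Psi_{\boldsymbol\rho}$. -/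
theorem opD_nodes (ρ : Fin (m + 1) → ZMod N) (k : Fin m) :
    opD N (m + 1) P (nodes S m (Fin.tail ρ) k) (Psi P S (m + 1) ρ) =
      phiTilde P S m k (Fin.tail ρ) • Psi P S (m + 1) (ρ + Pi.single 0 1 - Pi.single k.succ 1) := by
  have hact := actsOnPsi hS hP m hm
  have hrow := (monodromy_relations (N := N) P (nodes S m (Fin.tail ρ) k) (m + 1)
    fun j hj => hP.κ_ne j (by simp at hj ⊢; omega)).2.det'
  have hA := hact.A (ρ - Pi.single k.succ 1) k
  have hB := hact.B (nodes S m (Fin.tail ρ - Pi.single k 1) k) (ρ - Pi.single k.succ 1)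
  have hz : ∏ s, (nodes S m (Fin.tail ρ - Pi.single k 1) k -
      nodes S m (Fin.tail ρ - Pi.single k 1) s) = 0 :=
    Finset.prod_eq_zero (Finset.mem_univ k) (sub_self _)
  rw [tail_sub_single_succ, hz, mul_zero, mul_zero, zero_smul, nodes_sub_single] at hB
  rw [tail_sub_single_succ, nodes_sub_single, sub_add_cancel] at hA
  have h := LinearMap.congr_fun hrow (Psi P S (m + 1) (ρ - Pi.single k.succ 1))
  simp only [LinearMap.sub_apply, LinearMap.smul_apply, Module.End.mul_apply] at h
  rw [opA] at hA
  rw [opB] at hB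
  rw [opD]
  rw [hA, hB, map_zero, sub_zero, map_smul, hact.charge] at h
  have h' := (smul_right_inj (omega_ne_zero (N := N))).mp h
  rw [← phiA_sub_single_mul_phiTilde hS hP hm, mul_smul] at h'
  rw [(smul_right_inj (phiA_ne_zero hS hP hm k _)).mp h', sub_add_eq_add_sub]

theorem opD_eq_interp (l : ℂ) (ρ : Fin (m + 1) → ZMod N) :
    opD N (m + 1) P l (Psi P S (m + 1) ρ) = interp (nodes S m (Fin.tail ρ))
      (fun k => phiTilde P S m k (Fin.tail ρ) •
        Psi P S (m + 1) (ρ + Pi.single 0 1 - Pi.single k.succ 1))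
      ((∏ j ∈ Finset.Icc 1 (m + 1), P.b j * P.d j / P.κ j) • Psi P S (m + 1) (ρ + Pi.single 0 1))
      ((∏ j ∈ Finset.Icc 1 (m + 1), P.a j * P.c j) • Psi P S (m + 1) ρ) l := by
  have h1 := (monodromy_polyEnds (N := N) P (m + 1)).2.2.2.map
    (LinearMap.applyₗ (R := ℂ) (M := States N (m + 1)) (M₂ := States N (m + 1))
      (Psi P S (m + 1) ρ))
  have h2 := h1.eq_interp (nodes_injective hP hm (Fin.tail ρ))
    (nodes_ne_zero hS hP hm (Fin.tail ρ)) l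
  simp only [LinearMap.applyₗ_apply_apply, opD_nodes hS hP hm, LinearMap.smul_apply,
    Module.End.one_apply, (actsOnPsi hS hP m hm).charge] at h2
  exact h2

end ActionD

/-! ### Linear independence -/

section Independence

variable {N n : ℕ} [NeZero N] {P : SiteParams} {S : Amplitudes}

/-- The product of all differences is a nonzero polynomial, so it has a nonzero value at some point.
Thus a single operator $B(\lambda)$ separates the eigenvectors. -/
theorem exists_forall_ne_of_injective {ι : Type*} [Fintype ι] [DecidableEq ι]
    {p : ι → Polynomial ℂ} (hp : Function.Injective p) :
    ∃ l : ℂ, Function.Injective fun i => (p i).eval l := by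
  have h : ∏ x ∈ Finset.univ.offDiag, (p x.1 - p x.2) ≠ (0 : Polynomial ℂ) :=
    Finset.prod_ne_zero_iff.mpr fun x hx =>
      sub_ne_zero.mpr (hp.ne (Finset.mem_offDiag.mp hx).2.2)
  obtain ⟨l, hl⟩ : ∃ l : ℂ, (∏ x ∈ Finset.univ.offDiag, (p x.1 - p x.2)).eval l ≠ 0 := by
    by_contra! hc
    exact h (Polynomial.funext fun l => by rw [hc l, Polynomial.eval_zero])
  refine ⟨l, fun i j hij => ?_⟩
  by_contra hne
  rw [Polynomial.eval_prod] at hl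
  refine Finset.prod_ne_zero_iff.mp hl (i, j) (Finset.mem_offDiag.mpr ⟨?_, ?_, hne⟩) ?_
  · exact Finset.mem_univ _
  · exact Finset.mem_univ _
  · rw [Polynomial.eval_sub, sub_eq_zero]
    exact hij

/-- Eigenvectors of $u^{-1}(a-bv)$ with distinct eigenvalues $r\,\omega^{-\tau}$. -/
theorem psiSite_linearIndependent (hS : IsSolution N n P S) (hP : IsNondegenerate N n P S) {k : ℕ}
    (hk : k + 1 ≤ n) : LinearIndependent ℂ fun τ : ZMod N => psiSite P S (k + 1) τ := by
  have hp := isFermat_ptSite hS hP (k := k + 1) (by simp; omega)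
  have ha := hP.a_ne (k + 1) (by simp; omega)
  have hr := hP.rs_ne (k + 1) (by simp; omega)
  let f : Module.End ℂ (ZMod N → ℂ) :=
    { toFun := fun g γ => omPow (-γ) * (P.a (k + 1) * g γ - P.b (k + 1) * g (γ - 1))
      map_add' := fun g h => by funext γ; simp only [Pi.add_apply]; ring
      map_smul' := fun z g => by
        funext γ; simp only [Pi.smul_apply, smul_eq_mul, RingHom.id_apply]; ring }
  refine Module.End.eigenvectors_linearIndependent' f (fun τ => S.rs (k + 1) * omPow (-τ))
    (fun τ τ' h => neg_injective (omPow_injective (mul_left_cancel₀ hr h))) _ fun τ => ?_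
  refine ⟨Module.End.mem_eigenspace_iff.mpr ?_, fun h => ?_⟩
  · funext γ
    have h1 := psiSite_rec (S := S) hp ha τ γ
    have h2 : psiSite P S (k + 1) τ (γ - 1) = psiSite P S (k + 1) (τ + 1) γ := by
      rw [psiSite, psiSite]; congr 1; ring
    change omPow (-γ) * (P.a (k + 1) * psiSite P S (k + 1) τ γ -
      P.b (k + 1) * psiSite P S (k + 1) τ (γ - 1)) = _ * psiSite P S (k + 1) τ γ
    have h3 := omPow_ne_zero γ
    rw [h2, h1, omPow_sub, omPow_neg, omPow_neg]
    field_simp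
  · exact hp.cyc_ne (τ - τ) (congrFun h τ)

theorem eq_zero_of_sum_tens_psiSite (hS : IsSolution N n P S) (hP : IsNondegenerate N n P S)
    {m : ℕ} (hm : m + 1 ≤ n) {f : ZMod N → States N m}
    (h : ∑ τ, tens (f τ) (psiSite P S (m + 1) τ) = 0) (τ : ZMod N) : f τ = 0 := by
  funext γ'
  refine Fintype.linearIndependent_iff.mp (psiSite_linearIndependent hS hP hm) (fun τ => f τ γ') ?_ τ
  funext γ
  have h1 := congrFun h (Fin.snoc γ' γ)
  simpa [Finset.sum_apply, tens_apply] using h1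

variable (hS : IsSolution N n P S) (hP : IsNondegenerate N n P S)
include hS hP

/-- The leading coefficient determines $\rho_0$. A zero with label $s$ cannot coincide with one of
another label because the $r_s^N$ differ, so the zeros determine every other $\rho_s$. -/
theorem eigenvalueB_injective {m : ℕ} (hm : m + 1 ≤ n) :
    Function.Injective fun ρ : Fin (m + 1) → ZMod N =>
      Polynomial.C (S.r (m + 1) 0 * omPow (-ρ 0)) *
        ∏ s, (Polynomial.X - Polynomial.C (nodes S m (Fin.tail ρ) s)) := by
  intro ρ σ h
  have hr := r_ne_zero hS hP (m := m + 1) (s := 0) (by omega) hm (by omega)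
  have h0 : ρ 0 = σ 0 := by
    have h1 := congrArg Polynomial.leadingCoeff h
    simp only [Polynomial.leadingCoeff_mul, Polynomial.leadingCoeff_C,
      (Polynomial.monic_prod_X_sub_C _ _).leadingCoeff, mul_one] at h1
    exact neg_injective (omPow_injective (mul_left_cancel₀ hr h1))
  refine funext (Fin.cases h0 fun s => ?_)
  have h1 := congrArg (Polynomial.eval (nodes S m (Fin.tail ρ) s)) h
  simp only [Polynomial.eval_mul, Polynomial.eval_C, Polynomial.eval_prod, Polynomial.eval_sub,
    Polynomial.eval_X] at h1
  rw [Finset.prod_eq_zero (f := fun s' => nodes S m (Fin.tail ρ) s - nodes S m (Fin.tail ρ) s')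
    (Finset.mem_univ s) (sub_self _), mul_zero] at h1
  have h2 := (mul_eq_zero.mp h1.symm).resolve_left (mul_ne_zero hr (omPow_ne_zero _))
  obtain ⟨s', -, hs'⟩ := Finset.prod_eq_zero_iff.mp h2
  have h3 : s = s' := by
    by_contra hne
    exact nodes_ne hP hm _ _ hne (sub_eq_zero.mp hs')
  subst h3
  have h4 := sub_eq_zero.mp hs'
  have hrs := r_ne_zero hS hP (m := m + 1) (s := s + 1) (by omega) hm (by omega)
  exact neg_injective (omPow_injective (mul_left_cancel₀ (neg_ne_zero.mpr hrs) h4))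

/-- Nonvanishing is a hypothesis here because its own proof needs independence for the shorter
chain. -/
theorem Psi_linearIndependent_of_ne_zero {m : ℕ} (hm : m + 1 ≤ n)
    (h : ∀ ρ : Fin (m + 1) → ZMod N, Psi P S (m + 1) ρ ≠ 0) :
    LinearIndependent ℂ fun ρ : Fin (m + 1) → ZMod N => Psi P S (m + 1) ρ := by
  -- The additional factor $X$ is the explicit $\lambda$ in the eigenvalue of $B(\lambda)$.
  have hinj : Function.Injective fun ρ : Fin (m + 1) → ZMod N =>
      Polynomial.X * (Polynomial.C (S.r (m + 1) 0 * omPow (-ρ 0)) *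
        ∏ s, (Polynomial.X - Polynomial.C (nodes S m (Fin.tail ρ) s))) := fun ρ σ hρσ =>
    eigenvalueB_injective hS hP hm (mul_left_cancel₀ Polynomial.X_ne_zero hρσ)
  obtain ⟨l, hl⟩ := exists_forall_ne_of_injective hinj
  refine Module.End.eigenvectors_linearIndependent' (opB N (m + 1) P l) _ hl _ fun ρ =>
    ⟨Module.End.mem_eigenspace_iff.mpr ?_, h ρ⟩
  rw [(actsOnPsi hS hP m hm).B]
  simp [Polynomial.eval_prod]

/-- If $\Psi$ vanished, so would its factor at each $\psi_\tau$, by independence of the $\psi_\tau$.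
That factor is a combination of the independent vectors of the shorter chain, with coefficients $Q$
that are never zero. -/
theorem Psi_ne_zero (m : ℕ) (hm : m + 1 ≤ n) (ρ : Fin (m + 1) → ZMod N) : Psi P S (m + 1) ρ ≠ 0 := by
  induction m with
  | zero =>
    intro h
    exact (isFermat_ptSite hS hP (by simp; omega)).cyc_ne _ (congrFun h 0)
  | succ m ih =>
    intro h
    rw [Psi_succ] at h
    have h1 := eq_zero_of_sum_tens_psiSite hS hP hm h 0
    have h2 := Fintype.linearIndependent_iff.mp
      (Psi_linearIndependent_of_ne_zero hS hP (by omega) (ih (by omega))) _ h1 0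
    exact kernelQ_ne_zero _ _ _ hS hP hm h2

theorem Psi_linearIndependent {m : ℕ} (hm : m + 1 ≤ n) :
    LinearIndependent ℂ fun ρ : Fin (m + 1) → ZMod N => Psi P S (m + 1) ρ :=
  Psi_linearIndependent_of_ne_zero hS hP hm (Psi_ne_zero hS hP m hm)

theorem span_Psi {m : ℕ} (hm : m + 1 ≤ n) :
    Submodule.span ℂ (Set.range fun ρ : Fin (m + 1) → ZMod N => Psi P S (m + 1) ρ) = ⊤ :=
  (Psi_linearIndependent hS hP hm).span_eq_top_of_card_eq_finrank'
    (Module.finrank_fintype_fun_eq_card ℂ).symm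

omit hS hP in
-- Fourier inversion, from the orthogonality of the characters of $\mathbb Z_N$; it shows that the
-- $\tilde\Psi$ span all $\Psi$.
theorem sum_omPow_smul_PsiTilde (m : ℕ) (x : ZMod N) (ρ' : Fin m → ZMod N) :
    ∑ ρ : ZMod N, omPow (ρ * x) • PsiTilde P S m ρ ρ' = (N : ℂ) • Psi P S (m + 1) (Fin.cons x ρ') := by
  simp only [PsiTilde, Finset.smul_sum, smul_smul, ← omPow_add]
  rw [Finset.sum_comm]
  have h : ∀ y : ZMod N, ∑ ρ : ZMod N, omPow (ρ * x + -(ρ * y)) = if x = y then (N : ℂ) else 0 := by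
    intro y
    have h1 := AddChar.sum_mulShift (x - y) (ZMod.isPrimitive_stdAddChar N)
    simp only [sub_eq_zero, ZMod.card] at h1
    simp only [omPow_eq_stdAddChar, ← sub_eq_add_neg, ← mul_sub, h1]
    push_cast
    rfl
  simp only [← Finset.sum_smul, h, ite_smul, zero_smul, Finset.sum_ite_eq, Finset.mem_univ, if_true]

theorem span_PsiTilde {m : ℕ} (hm : m + 1 ≤ n) :
    Submodule.span ℂ (Set.range fun x : ZMod N × (Fin m → ZMod N) => PsiTilde P S m x.1 x.2) = ⊤ := by
  rw [eq_top_iff, ← span_Psi hS hP hm, Submodule.span_le]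
  rintro _ ⟨ρ, rfl⟩
  have h := sum_omPow_smul_PsiTilde (P := P) (S := S) m (ρ 0) (Fin.tail ρ)
  rw [Fin.cons_self_tail] at h
  have hN : (N : ℂ) ≠ 0 := Nat.cast_ne_zero.mpr (NeZero.ne N)
  rw [SetLike.mem_coe, ← Submodule.smul_mem_iff _ hN, ← h]
  exact Submodule.sum_mem _ fun x _ => Submodule.smul_mem _ _ (Submodule.subset_span ⟨(x, _), rfl⟩)

theorem PsiTilde_linearIndependent {m : ℕ} (hm : m + 1 ≤ n) :
    LinearIndependent ℂ fun x : ZMod N × (Fin m → ZMod N) => PsiTilde P S m x.1 x.2 := by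
  refine linearIndependent_of_top_le_span_of_card_eq_finrank (span_PsiTilde hS hP hm).ge ?_
  rw [Module.finrank_fintype_fun_eq_card]
  simp [ZMod.card, pow_succ']

theorem chargeOp_PsiTilde {m : ℕ} (hm : m + 1 ≤ n) (ρ : ZMod N) (ρ' : Fin m → ZMod N) :
    chargeOp N (m + 1) (PsiTilde P S m ρ ρ') = omPow ρ • PsiTilde P S m ρ ρ' := by
  simp only [PsiTilde, map_sum, map_smul, (actsOnPsi hS hP m hm).charge, Finset.smul_sum, smul_smul,
    ← omPow_add]
  rw [← Equiv.sum_comp (Equiv.addRight (1 : ZMod N)) fun x =>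
    omPow (ρ + -(ρ * x)) • Psi P S (m + 1) (Fin.cons x ρ')]
  refine Finset.sum_congr rfl fun x _ => ?_
  rw [Equiv.coe_addRight]
  congr 2
  · ring
  · funext i
    refine Fin.cases ?_ (fun i => ?_) i <;> simp

end Independence

/-! ### The transfer matrix on the vectors `Ψ̃` -/

section Transfer

variable {N n : ℕ} [NeZero N] {P : SiteParams} {S : Amplitudes} {m : ℕ}

theorem combine_add (ρ : ZMod N) (Q Q' : (Fin m → ZMod N) → ℂ) :
    combine P S m ρ (Q + Q') = combine P S m ρ Q + combine P S m ρ Q' := by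
  simp [combine, add_smul, Finset.sum_add_distrib]

theorem combine_smul (ρ : ZMod N) (z : ℂ) (Q : (Fin m → ZMod N) → ℂ) :
    combine P S m ρ (z • Q) = z • combine P S m ρ Q := by
  simp [combine, mul_smul, Finset.smul_sum]

section Coefficient

/-- The value at the `k`-th node of the coefficient of `Ψ̃` in the image under the transfer matrix
of the vector with coefficients `Q`. -/
noncomputable def transferCoeff (P : SiteParams) (S : Amplitudes) (m : ℕ) (ρ : ZMod N)
    (Q : (Fin m → ZMod N) → ℂ) (ρ' : Fin m → ZMod N) (k : Fin m) : ℂ :=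
  ((∏ s ∈ Finset.univ.erase k, (nodes S m ρ' k - nodes S m ρ' s) /
      (omega N * nodes S m ρ' k - nodes S m ρ' s)) *
      (nodes S m ρ' k / (omega N * nodes S m ρ' k))) *
        (phiA P S m k (ρ' - Pi.single k 1) * Q (ρ' - Pi.single k 1)) +
    ((∏ s ∈ Finset.univ.erase k, (nodes S m ρ' k - nodes S m ρ' s) /
      (nodes S m ρ' k / omega N - nodes S m ρ' s)) *
      (nodes S m ρ' k / (nodes S m ρ' k / omega N))) *
        (omPow ρ * phiTilde P S m k (ρ' + Pi.single k 1) * Q (ρ' + Pi.single k 1))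

end Coefficient

variable (hS : IsSolution N n P S) (hP : IsNondegenerate N n P S) (hm : m + 1 ≤ n)
include hS hP hm

theorem opA_PsiTilde (l : ℂ) (ρ : ZMod N) (ρ' : Fin m → ZMod N) :
    opA N (m + 1) P l (PsiTilde P S m ρ ρ') = interp (nodes S m ρ')
      (fun k => phiA P S m k ρ' • PsiTilde P S m ρ (ρ' + Pi.single k 1))
      ((1 : ℂ) • PsiTilde P S m ρ (ρ' + 0))
      (((∏ k ∈ Finset.Icc 1 (m + 1), P.κ k) * omPow ρ) • PsiTilde P S m ρ (ρ' + 0)) l := by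
  have h1 := (monodromy_polyEnds (N := N) P (m + 1)).1.map
    (LinearMap.applyₗ (R := ℂ) (M := States N (m + 1)) (M₂ := States N (m + 1))
      (PsiTilde P S m ρ ρ'))
  have h2 := h1.eq_interp (nodes_injective hP hm ρ') (nodes_ne_zero hS hP hm ρ') l
  have h3 : ∀ k, opA N (m + 1) P (nodes S m ρ' k) (PsiTilde P S m ρ ρ') =
      phiA P S m k ρ' • PsiTilde P S m ρ (ρ' + Pi.single k 1) := fun k => by
    simp only [PsiTilde, map_sum, map_smul, Finset.smul_sum]
    refine Finset.sum_congr rfl fun x _ => ?_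
    have h4 := (actsOnPsi hS hP m hm).A (Fin.cons x ρ') k
    rw [Fin.tail_cons] at h4
    rw [h4, smul_comm]
    congr 3
    funext i
    refine Fin.cases ?_ (fun i => ?_) i <;> simp [Pi.single_apply]
  simp only [LinearMap.applyₗ_apply_apply, h3, LinearMap.smul_apply, Module.End.one_apply,
    chargeOp_PsiTilde hS hP hm, smul_smul] at h2
  rw [h2, one_smul, add_zero]

theorem opD_PsiTilde (l : ℂ) (ρ : ZMod N) (ρ' : Fin m → ZMod N) :
    opD N (m + 1) P l (PsiTilde P S m ρ ρ') = interp (nodes S m ρ')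
      (fun k => (omPow ρ * phiTilde P S m k ρ') • PsiTilde P S m ρ (ρ' + -Pi.single k 1))
      (((∏ j ∈ Finset.Icc 1 (m + 1), P.b j * P.d j / P.κ j) * omPow ρ) • PsiTilde P S m ρ (ρ' + 0))
      ((∏ j ∈ Finset.Icc 1 (m + 1), P.a j * P.c j) • PsiTilde P S m ρ (ρ' + 0)) l := by
  have h1 := (monodromy_polyEnds (N := N) P (m + 1)).2.2.2.map
    (LinearMap.applyₗ (R := ℂ) (M := States N (m + 1)) (M₂ := States N (m + 1))
      (PsiTilde P S m ρ ρ'))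
  have h2 := h1.eq_interp (nodes_injective hP hm ρ') (nodes_ne_zero hS hP hm ρ') l
  have h3 : ∀ k, opD N (m + 1) P (nodes S m ρ' k) (PsiTilde P S m ρ ρ') =
      (omPow ρ * phiTilde P S m k ρ') • PsiTilde P S m ρ (ρ' + -Pi.single k 1) := fun k => by
    simp only [PsiTilde, map_sum, map_smul, Finset.smul_sum]
    -- $D$ at a node also raises $\rho_0$; reindexing the Fourier sum turns this shift into the
    -- factor $\omega^\rho$.
    refine Eq.trans ?_ (Equiv.sum_comp (Equiv.addRight (1 : ZMod N)) fun x =>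
      (omPow ρ * phiTilde P S m k ρ') •
        omPow (-(ρ * x)) • Psi P S (m + 1) (Fin.cons x (ρ' + -Pi.single k 1)))
    refine Finset.sum_congr rfl fun x _ => ?_
    have h4 := opD_nodes hS hP hm (Fin.cons x ρ') k
    rw [Fin.tail_cons] at h4
    rw [h4, smul_smul, smul_smul, Equiv.coe_addRight, show -(ρ * (x + 1)) = -(ρ * x) - ρ by ring,
      omPow_sub]
    have h5 := omPow_ne_zero ρ
    congr 1
    · field_simp
    · congr 1
      funext i
      refine Fin.cases ?_ (fun i => ?_) i <;> simp [Pi.single_apply, sub_eq_add_neg]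
  simp only [LinearMap.applyₗ_apply_apply, h3, LinearMap.smul_apply, Module.End.one_apply,
    chargeOp_PsiTilde hS hP hm, smul_smul] at h2
  rw [h2, add_zero]

/-- On a fixed charge sector the extreme coefficients of $A$ and $D$ act as scalars, so they
multiply $Q$ at the same point; only the node values couple neighbouring points. -/
theorem transfer_combine (l : ℂ) (ρ : ZMod N) (Q : (Fin m → ZMod N) → ℂ) :
    transfer N (m + 1) P l (combine P S m ρ Q) =
      combine P S m ρ fun ρ' => interp (nodes S m ρ') (transferCoeff P S m ρ Q ρ')
        ((1 + omPow ρ * ∏ j ∈ Finset.Icc 1 (m + 1), P.b j * P.d j / P.κ j) * Q ρ')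
        (((∏ j ∈ Finset.Icc 1 (m + 1), P.a j * P.c j) +
          omPow ρ * ∏ j ∈ Finset.Icc 1 (m + 1), P.κ j) * Q ρ') l := by
  rw [transfer, LinearMap.add_apply]
  simp only [combine, map_sum, map_smul, opA_PsiTilde hS hP hm, opD_PsiTilde hS hP hm]
  rw [sum_smul_interp_shift (nodes S m) (fun ρ' => nodes_injective hP hm ρ')
    (fun ρ' => nodes_ne_zero hS hP hm ρ') (fun k => Pi.single k 1) 0 0
    (fun ρ' k s hs => nodes_add_single_of_ne _ _ hs) (fun ρ' => by rw [add_zero])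
    (fun ρ' => by rw [add_zero]) (PsiTilde P S m ρ) (fun ρ' k => phiA P S m k ρ'),
    sum_smul_interp_shift (nodes S m) (fun ρ' => nodes_injective hP hm ρ')
    (fun ρ' => nodes_ne_zero hS hP hm ρ') (fun k => -Pi.single k 1) 0 0
    (fun ρ' k s hs => by rw [← sub_eq_add_neg, nodes_sub_single_of_ne _ _ hs])
    (fun ρ' => by rw [add_zero]) (fun ρ' => by rw [add_zero]) (PsiTilde P S m ρ)
    (fun ρ' k => omPow ρ * phiTilde P S m k ρ'), ← Finset.sum_add_distrib]
  refine Finset.sum_congr rfl fun ρ' _ => ?_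
  rw [← add_smul]
  congr 1
  simp only [sub_neg_eq_add, sub_zero, nodes_sub_single, nodes_add_single, interp, transferCoeff,
    smul_eq_mul, mul_add, Finset.sum_add_distrib]
  ring

/-- The shift factor of $A$, corrected by the change of the Sklyanin weight and of the Lagrange
weight, depends on $\boldsymbol\rho'$ only through the node $\lambda_k$. The constants left over
form $\chi_k$. -/
theorem prod_mul_phiA (ρ' : Fin m → ZMod N) (k : Fin m) :
    (∏ s ∈ Finset.univ.erase k, (-(nodes S m ρ' k / nodes S m ρ' s) *
        (S.y (m + 1) (s + 1) (m + 1) (k + 1) / S.y (m + 1) (k + 1) (m + 1) (s + 1)))) *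
      (nodes S m ρ' k / (omega N * nodes S m ρ' k)) * phiA P S m k (ρ' - Pi.single k 1) =
    deltaMinus N P S (m + 1) (k + 1) (omega N * nodes S m ρ' k) := by
  have hk := k.2
  have hw := omega_ne_zero (N := N)
  have hz := nodes_ne_zero hS hP hm ρ' k
  have hr : ∀ s : Fin m, S.r (m + 1) (s + 1) ≠ 0 := fun s =>
    r_ne_zero hS hP (by omega) hm (by omega)
  have h0 := r_ne_zero hS hP (m := m + 1) (s := 0) (by omega) hm (by omega)
  have hR : ∏ s ∈ Finset.univ.erase k, S.r (m + 1) (s + 1) ≠ 0 :=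
    Finset.prod_ne_zero_iff.mpr fun s _ => hr s
  have hrs := hP.rs_ne (m + 1) (by simp; omega)
  have hrt : S.rt (m + 1) = S.r (m + 1) 0 * (S.r (m + 1) (k + 1) *
      ∏ s ∈ Finset.univ.erase k, S.r (m + 1) (s + 1)) := by
    rw [rt_succ, prod_Ico_succ_eq_prod_fin,
      Finset.mul_prod_erase _ (fun s : Fin m => S.r (m + 1) (s + 1)) (Finset.mem_univ k)]
  have ho : omPow (-(∑ i, ρ' i - 1)) * omPow (∑ i, ρ' i - ρ' k) * S.r (m + 1) (k + 1) =
      -(nodes S m ρ' k * omega N) := by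
    rw [← omPow_add, show -(∑ i, ρ' i - 1) + (∑ i, ρ' i - ρ' k) = -ρ' k + 1 by ring, omPow_add,
      omPow_one, nodes, lam]
    ring
  have hpow : nodes S m ρ' k ^ m = nodes S m ρ' k ^ (m - 1) * nodes S m ρ' k := by
    rw [← pow_succ, Nat.sub_add_cancel (by omega)]
  rw [Finset.prod_mul_distrib, prod_erase_neg_nodes_div hS hP hm, phiA, deltaMinus, chi,
    sum_sub_single, nodes_sub_single, mul_div_cancel_left₀ _ hw, Nat.add_sub_cancel, hpow, hrt,
    prod_erase_Ico_succ_eq_prod_fin k fun s =>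
      S.y (m + 1) s (m + 1) (k + 1) / S.y (m + 1) (k + 1) (m + 1) s]
  have hrk := hr k
  generalize ∏ s ∈ Finset.univ.erase k, S.r (m + 1) (s + 1) = R at *
  generalize ∏ s ∈ Finset.univ.erase k, S.y (m + 1) (s + 1) (m + 1) (k + 1) /
    S.y (m + 1) (k + 1) (m + 1) (s + 1) = Y at *
  generalize ∏ s ∈ Finset.Ico 1 m, S.y (m + 1) (k + 1) m s = Y' at *
  generalize omPow (∑ i, ρ' i - ρ' k) = o at *
  generalize omPow (-(∑ i, ρ' i - 1)) = o' at *
  generalize F N P (m + 1) (nodes S m ρ' k) = f at *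
  generalize nodes S m ρ' k = z at *
  field_simp
  linear_combination (-(Y * f * Y' * S.rt m)) * ho

/-- The term of $A$ is `prod_mul_phiA`. The term of $D$ is reduced to it by the quantum determinant,
used at the raised point, which is why $\Delta_+$ contains $\chi_k^{-1}$ and the complementary
product of the $F_m$. -/
theorem sklyanin_mul_transferCoeff (ρ : ZMod N) (Q : (Fin m → ZMod N) → ℂ) (ρ' : Fin m → ZMod N)
    (k : Fin m) : sklyanin S m ρ' * transferCoeff P S m ρ Q ρ' k =
      deltaPlus P S (m + 1) (k + 1) ρ (nodes S m ρ' k) *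
        (sklyanin S m (ρ' + Pi.single k 1) * Q (ρ' + Pi.single k 1)) +
      deltaMinus N P S (m + 1) (k + 1) (omega N * nodes S m ρ' k) *
        (sklyanin S m (ρ' - Pi.single k 1) * Q (ρ' - Pi.single k 1)) := by
  have hk := k.2
  have hw := omega_ne_zero (N := N)
  have hz := nodes_ne_zero hS hP hm
  have h1 := sklyanin_sub_single hS hP hm ρ' k
  have h2 := sklyanin_sub_single hS hP hm (ρ' + Pi.single k 1) k
  have h3 := prod_mul_phiA hS hP hm ρ' k
  have h4 := prod_mul_phiA hS hP hm (ρ' + Pi.single k 1) k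
  have h5 := phiA_sub_single_mul_phiTilde hS hP hm k (ρ' + Pi.single k 1)
  have h6 := phiA_ne_zero hS hP hm k ρ'
  -- Raising the node and lowering it are inverse operations, so the Lagrange quotients at the
  -- raised point are the inverses of those in the term of $D$.
  have e1 : ∏ s ∈ Finset.univ.erase k, ((nodes S m (ρ' + Pi.single k 1) k -
      nodes S m (ρ' + Pi.single k 1) s) / (omega N * nodes S m (ρ' + Pi.single k 1) k -
        nodes S m (ρ' + Pi.single k 1) s)) =
      (∏ s ∈ Finset.univ.erase k, (nodes S m ρ' k - nodes S m ρ' s) /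
        (nodes S m ρ' k / omega N - nodes S m ρ' s))⁻¹ := by
    rw [← Finset.prod_inv_distrib]
    refine Finset.prod_congr rfl fun s hs => ?_
    rw [nodes_add_single_of_ne _ _ (Finset.ne_of_mem_erase hs), nodes_add_single,
      mul_div_cancel₀ _ hw, inv_div]
  have h7 : ∏ s ∈ Finset.univ.erase k, (nodes S m ρ' k - nodes S m ρ' s) /
      (nodes S m ρ' k / omega N - nodes S m ρ' s) ≠ 0 := by
    refine Finset.prod_ne_zero_iff.mpr fun s hs => div_ne_zero ?_ ?_
    · exact sub_ne_zero.mpr (nodes_ne hP hm _ _ (Finset.ne_of_mem_erase hs).symm)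
    · rw [← nodes_add_single]
      exact sub_ne_zero.mpr (nodes_ne hP hm _ _ (Finset.ne_of_mem_erase hs).symm)
  rw [e1, add_sub_cancel_right] at h2
  rw [add_sub_cancel_right] at h4 h5
  have h8 : ∏ s ∈ Finset.univ.erase k,
      (-(nodes S m (ρ' + Pi.single k 1) k / nodes S m (ρ' + Pi.single k 1) s) *
        (S.y (m + 1) (s + 1) (m + 1) (k + 1) / S.y (m + 1) (k + 1) (m + 1) (s + 1))) ≠ 0 := by
    refine Finset.prod_ne_zero_iff.mpr fun s hs => mul_ne_zero (neg_ne_zero.mpr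
      (div_ne_zero (hz _ k) (hz _ s))) (div_ne_zero ?_ ?_)
    · exact (isFermat_ptRatio_same' hS hP hm (Finset.ne_of_mem_erase hs)).2
    · exact (isFermat_ptRatio_same' hS hP hm (Finset.ne_of_mem_erase hs).symm).2
  generalize ∏ s ∈ Finset.univ.erase k,
      (-(nodes S m (ρ' + Pi.single k 1) k / nodes S m (ρ' + Pi.single k 1) s) *
        (S.y (m + 1) (s + 1) (m + 1) (k + 1) / S.y (m + 1) (k + 1) (m + 1) (s + 1))) = X at *
  have hF := F_nodes_ne_zero hP hm k (ρ' + Pi.single k 1) (j := m + 1) (by simp; omega)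
  have h9 : deltaPlus P S (m + 1) (k + 1) ρ (nodes S m ρ' k) * X =
      omega N * omPow ρ * phiTilde P S m k (ρ' + Pi.single k 1) := by
    have hz' := hz (ρ' + Pi.single k 1) k
    rw [Finset.prod_Icc_succ_top (by omega)] at h5
    rw [deltaMinus, mul_div_cancel_left₀ _ hw, Nat.add_sub_cancel] at h4
    -- $\chi_k$ is a factor of the right side of `h4`, whose left side is a product of nonzero
    -- factors.
    have hc : chi S (m + 1) (k + 1) ≠ 0 := by
      intro hc
      rw [hc, zero_mul, zero_mul] at h4
      exact mul_ne_zero (mul_ne_zero h8 (div_ne_zero hz' (mul_ne_zero hw hz'))) h6 h4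
    rw [deltaPlus, show (1 : ℤ) - ((m + 1 : ℕ) : ℤ) = -(m : ℤ) by push_cast; ring, zpow_neg,
      zpow_natCast, ← nodes_add_single, show Finset.Ico 1 (m + 1) = Finset.Icc 1 m from rfl]
    generalize nodes S m (ρ' + Pi.single k 1) k = z at *
    generalize ∏ j ∈ Finset.Icc 1 m, F N P j z = p at *
    have h10 : X * p = omega N * chi S (m + 1) (k + 1) * z ^ m *
        phiTilde P S m k (ρ' + Pi.single k 1) := by
      refine mul_right_cancel₀ (mul_ne_zero h6 hF) ?_
      field_simp at h4
      linear_combination (p * F N P (m + 1) z) * h4 -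
        (chi S (m + 1) (k + 1) * z ^ m * omega N * F N P (m + 1) z) * h5
    field_simp
    linear_combination omPow ρ * h10
  rw [transferCoeff]
  have h11 : nodes S m ρ' k / (nodes S m ρ' k / omega N) = omega N := by
    have := hz ρ' k
    field_simp
  rw [h11]
  rw [← div_eq_mul_inv, div_eq_iff h7] at h2
  linear_combination (nodes S m ρ' k / (omega N * nodes S m ρ' k) *
      (phiA P S m k (ρ' - Pi.single k 1) * Q (ρ' - Pi.single k 1))) * h1 +
    (sklyanin S m (ρ' - Pi.single k 1) * Q (ρ' - Pi.single k 1)) * h3 -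
    (deltaPlus P S (m + 1) (k + 1) ρ (nodes S m ρ' k) * Q (ρ' + Pi.single k 1)) * h2 -
    (sklyanin S m ρ' * (∏ s ∈ Finset.univ.erase k, (nodes S m ρ' k - nodes S m ρ' s) /
        (nodes S m ρ' k / omega N - nodes S m ρ' s)) * Q (ρ' + Pi.single k 1)) * h9

end Transfer

/-! ### Separated functions -/

section Separation

variable {ι Z : Type*} [Fintype ι] [DecidableEq ι]

/-- The product `x ↦ ∏ q_k(x_k)` of functions of one variable. -/
noncomputable def sepProd : MultilinearMap ℂ (fun _ : ι => Z → ℂ) ((ι → Z) → ℂ) :=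
  (MultilinearMap.mkPiAlgebra ℂ ι ((ι → Z) → ℂ)).compLinearMap fun k =>
    LinearMap.funLeft ℂ ℂ fun x : ι → Z => x k

omit [DecidableEq ι] in
theorem sepProd_apply (q : ι → Z → ℂ) (x : ι → Z) : sepProd q x = ∏ k, q k (x k) := by
  simp [sepProd, Finset.prod_apply, LinearMap.funLeft_apply]

theorem sepProd_apply_update (q : ι → Z → ℂ) (x : ι → Z) (k : ι) (j : Z) :
    sepProd q (Function.update x k j) = (∏ s ∈ Finset.univ.erase k, q s (x s)) * q k j := by
  rw [sepProd_apply, ← Finset.mul_prod_erase _ _ (Finset.mem_univ k), Function.update_self, mul_comm]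
  congr 1
  exact Finset.prod_congr rfl fun s hs => by
    rw [Function.update_of_ne (Finset.ne_of_mem_erase hs)]

omit [DecidableEq ι] in
theorem sepProd_ne_zero {q : ι → Z → ℂ} (hq : ∀ k, q k ≠ 0) : sepProd q ≠ 0 := by
  choose x hx using fun k => Function.ne_iff.mp (hq k)
  exact fun h => Finset.prod_ne_zero_iff.mpr (fun k _ => hx k)
    ((sepProd_apply q x).symm.trans (congrFun h x))

/-- A linear map applied to a function of several variables in one of them. -/
noncomputable def applyAt (k : ι) (f : (Z → ℂ) →ₗ[ℂ] (Z → ℂ)) : ((ι → Z) → ℂ) →ₗ[ℂ] ((ι → Z) → ℂ) where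
  toFun Q x := f (fun j => Q (Function.update x k j)) (x k)
  map_add' Q Q' := by
    funext x
    exact congrFun (f.map_add (fun j => Q (Function.update x k j)) _) (x k)
  map_smul' z Q := by
    funext x
    exact congrFun (f.map_smul z (fun j => Q (Function.update x k j))) (x k)

theorem applyAt_sepProd (k : ι) (f : (Z → ℂ) →ₗ[ℂ] (Z → ℂ)) (q : ι → Z → ℂ) :
    applyAt k f (sepProd q) = sepProd (Function.update q k (f (q k))) := by
  funext x
  have h : (fun j => sepProd q (Function.update x k j)) =
      (∏ s ∈ Finset.univ.erase k, q s (x s)) • q k :=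
    funext fun j => sepProd_apply_update q x k j
  change f (fun j => sepProd q (Function.update x k j)) (x k) = _
  rw [h, map_smul, sepProd_apply, ← Finset.mul_prod_erase _ _ (Finset.mem_univ k),
    Function.update_self, Pi.smul_apply, smul_eq_mul, mul_comm]
  congr 1
  exact Finset.prod_congr rfl fun s hs => by
    rw [Function.update_of_ne (Finset.ne_of_mem_erase hs)]

/-- A function of several variables which lies in a subspace `W k` as a function of its `k`-th
variable is a combination of products of elements of these subspaces. -/
theorem mem_span_sepProd [Fintype Z] {W : ι → Submodule ℂ (Z → ℂ)} {Q : (ι → Z) → ℂ}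
    (hQ : ∀ x k, (fun j => Q (Function.update x k j)) ∈ W k) :
    Q ∈ Submodule.span ℂ {f | ∃ q : ι → Z → ℂ, (∀ k, q k ∈ W k) ∧ f = sepProd q} := by
  classical
  -- Induction on the set of variables in which the factors are already known to lie in $W_k$; the
  -- empty set is the expansion into delta functions.
  have key : ∀ K : Finset ι,
      Q ∈ Submodule.span ℂ {f | ∃ q : ι → Z → ℂ, (∀ k ∈ K, q k ∈ W k) ∧ f = sepProd q} := by
    intro K
    induction K using Finset.induction_on with
    | empty =>
      have h : Q = ∑ y : ι → Z, Q y • sepProd fun k => Pi.single (y k) (1 : ℂ) := by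
        funext x
        rw [Finset.sum_apply, Finset.sum_eq_single x]
        · simp [sepProd_apply]
        · intro y _ hy
          obtain ⟨k, hk⟩ := Function.ne_iff.mp hy
          rw [Pi.smul_apply, sepProd_apply, Finset.prod_eq_zero (Finset.mem_univ k), smul_zero]
          rw [Pi.single_eq_of_ne hk.symm]
        · exact fun h => absurd (Finset.mem_univ x) h
      rw [h]
      exact Submodule.sum_mem _ fun y _ => Submodule.smul_mem _ _
        (Submodule.subset_span ⟨_, by simp, rfl⟩)
    | insert k K hk ih =>
      -- A projection onto $W_k$, acting in the $k$-th variable, fixes $Q$ and maps products to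
      -- products, so it improves the $k$-th factor without touching the others.
      obtain ⟨g, hg⟩ := LinearMap.exists_leftInverse_of_injective (W k).subtype (W k).ker_subtype
      have hfix : applyAt k ((W k).subtype ∘ₗ g) Q = Q := by
        funext x
        change ((g fun j => Q (Function.update x k j) : W k) : Z → ℂ) (x k) = _
        have h1 : g (fun j => Q (Function.update x k j)) = ⟨_, hQ x k⟩ :=
          LinearMap.congr_fun hg ⟨_, hQ x k⟩
        rw [h1]
        exact congrArg Q (Function.update_eq_self k x)
      rw [← hfix]
      refine Submodule.span_mono ?_ (Submodule.apply_mem_span_image_of_mem_span _ ih)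
      rintro _ ⟨_, ⟨q, hq, rfl⟩, rfl⟩
      refine ⟨_, fun s hs => ?_, applyAt_sepProd k _ q⟩
      by_cases h : s = k
      · subst h
        rw [Function.update_self]
        exact (g (q s)).2
      · rw [Function.update_of_ne h]
        exact hq s ((Finset.mem_insert.mp hs).resolve_left h)
  simpa using key Finset.univ

/-- If all but one of the subspaces `W k` are at most one-dimensional, then the products of their
elements form a subspace. -/
theorem exists_eq_sepProd_of_finrank_le_one [Finite Z] {W : ι → Submodule ℂ (Z → ℂ)} {k₀ : ι}
    (hW : ∀ k, k ≠ k₀ → Module.finrank ℂ (W k) ≤ 1) {Q : (ι → Z) → ℂ}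
    (hQ : Q ∈ Submodule.span ℂ {f | ∃ q : ι → Z → ℂ, (∀ k, q k ∈ W k) ∧ f = sepProd q}) :
    ∃ q : ι → Z → ℂ, (∀ k, q k ∈ W k) ∧ Q = sepProd q := by
  have h : ∀ k, ∃ e ∈ W k, k ≠ k₀ → ∀ f ∈ W k, ∃ c : ℂ, c • e = f := by
    intro k
    by_cases hk : k = k₀
    · exact ⟨0, (W k).zero_mem, fun h => absurd hk h⟩
    · obtain ⟨e, he⟩ := finrank_le_one_iff.mp (hW k hk)
      exact ⟨e, e.2, fun _ f hf => (he ⟨f, hf⟩).imp fun c hc => congrArg Subtype.val hc⟩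
  choose e he he' using h
  let L := (sepProd.toLinearMap e k₀) ∘ₗ (W k₀).subtype
  -- All scalars can be moved into the factor $k_0$, so every product, and hence every combination
  -- of products, is in the image of the linear map `L` defined on $W_{k_0}$.
  have hle : Submodule.span ℂ {f | ∃ q : ι → Z → ℂ, (∀ k, q k ∈ W k) ∧ f = sepProd q} ≤ L.range := by
    rw [Submodule.span_le]
    rintro _ ⟨q, hq, rfl⟩
    have h : ∀ k, ∃ c : ℂ, k ≠ k₀ → c • e k = q k := fun k => by
      by_cases hk : k = k₀
      · exact ⟨0, fun h => absurd hk h⟩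
      · exact (he' k hk _ (hq k)).imp fun c hc _ => hc
    choose c hc using h
    refine ⟨(∏ k ∈ Finset.univ.erase k₀, c k) • ⟨q k₀, hq k₀⟩, ?_⟩
    rw [map_smul]
    funext x
    change (∏ k ∈ Finset.univ.erase k₀, c k) • sepProd (Function.update e k₀ (q k₀)) x = _
    rw [sepProd_apply, sepProd_apply, ← Finset.mul_prod_erase _ _ (Finset.mem_univ k₀),
      ← Finset.mul_prod_erase _ (fun k => q k (x k)) (Finset.mem_univ k₀), Function.update_self,
      smul_eq_mul, mul_left_comm, ← Finset.prod_mul_distrib]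
    congr 1
    refine Finset.prod_congr rfl fun s hs => ?_
    have hs' := Finset.ne_of_mem_erase hs
    rw [Function.update_of_ne hs', ← hc s hs']
    rfl
  obtain ⟨f, hf⟩ := hle hQ
  refine ⟨Function.update e k₀ f, fun k => ?_, hf.symm⟩
  by_cases hk : k = k₀
  · subst hk
    rw [Function.update_self]
    exact f.2
  · rw [Function.update_of_ne hk]
    exact he k

end Separation

/-! ### Eigenvectors of the transfer matrix -/

section Eigenvectors

variable {N n : ℕ} [NeZero N] {P : SiteParams} {S : Amplitudes} {m : ℕ}

theorem IsEigenPoly.polyEnds {N : ℕ} {ρ : ZMod N} {E : Polynomial ℂ} (h : IsEigenPoly P n ρ E) :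
    PolyEnds n (fun l => E.eval l)
      (1 + omPow ρ * ∏ j ∈ Finset.Icc 1 n, P.b j * P.d j / P.κ j)
      ((∏ j ∈ Finset.Icc 1 n, P.a j * P.c j) + omPow ρ * ∏ j ∈ Finset.Icc 1 n, P.κ j) :=
  ⟨E.coeff, h.2.1, h.2.2, fun l => by
    refine (Polynomial.eval_eq_sum_range' (Nat.lt_succ_of_le h.1) l).trans ?_
    exact Finset.sum_congr rfl fun i _ => mul_comm _ _⟩

theorem PolyEnds.exists_isEigenPoly {N : ℕ} {ρ : ZMod N} {t : ℂ → ℂ} (h : PolyEnds n t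
      (1 + omPow ρ * ∏ j ∈ Finset.Icc 1 n, P.b j * P.d j / P.κ j)
      ((∏ j ∈ Finset.Icc 1 n, P.a j * P.c j) + omPow ρ * ∏ j ∈ Finset.Icc 1 n, P.κ j)) :
    ∃ E : Polynomial ℂ, IsEigenPoly P n ρ E ∧ ∀ l, t l = E.eval l := by
  obtain ⟨E, hd, h0, hn, hE⟩ := h.exists_polynomial
  exact ⟨E, ⟨hd, h0, hn⟩, hE⟩

variable (hS : IsSolution N n P S) (hP : IsNondegenerate N n P S) (hm : m + 1 ≤ n)
include hS hP hm

theorem chargeOp_combine (ρ : ZMod N) (Q : (Fin m → ZMod N) → ℂ) :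
    chargeOp N (m + 1) (combine P S m ρ Q) = omPow ρ • combine P S m ρ Q := by
  simp only [combine, map_sum, map_smul, chargeOp_PsiTilde hS hP hm, Finset.smul_sum]
  exact Finset.sum_congr rfl fun ρ' _ => smul_comm _ _ _

theorem exists_eq_sum_combine (Φ : States N (m + 1)) :
    ∃ c : ZMod N → (Fin m → ZMod N) → ℂ, Φ = ∑ ρ, combine P S m ρ (c ρ) := by
  have h : Φ ∈ Submodule.span ℂ
      (Set.range fun x : ZMod N × (Fin m → ZMod N) => PsiTilde P S m x.1 x.2) := by
    rw [span_PsiTilde hS hP hm]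
    trivial
  obtain ⟨c, hc⟩ := (Submodule.mem_span_range_iff_exists_fun ℂ).mp h
  refine ⟨fun ρ ρ' => c (ρ, ρ'), ?_⟩
  rw [← hc, Fintype.sum_prod_type]
  rfl

theorem sum_combine_eq_zero {c : ZMod N → (Fin m → ZMod N) → ℂ}
    (h : ∑ ρ, combine P S m ρ (c ρ) = 0) (ρ : ZMod N) : c ρ = 0 := by
  funext ρ'
  refine Fintype.linearIndependent_iff.mp (PsiTilde_linearIndependent hS hP hm)
    (fun x => c x.1 x.2) ?_ (ρ, ρ')
  rw [Fintype.sum_prod_type]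
  exact h

theorem combine_eq_zero {ρ : ZMod N} {Q : (Fin m → ZMod N) → ℂ} (h : combine P S m ρ Q = 0) :
    Q = 0 := by
  funext ρ'
  have h1 := (PsiTilde_linearIndependent hS hP hm).comp (fun ρ' => (ρ, ρ')) fun x y hxy =>
    (Prod.mk.inj hxy).2
  exact Fintype.linearIndependent_iff.mp h1 Q h ρ'

theorem combine_injective (ρ : ZMod N) :
    Function.Injective (combine P S m ρ : ((Fin m → ZMod N) → ℂ) → States N (m + 1)) := fun Q Q' h => by
  have h1 : combine P S m ρ (Q + (-1 : ℂ) • Q') = 0 := by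
    rw [combine_add, combine_smul, h]
    simp
  have h2 := combine_eq_zero hS hP hm h1
  simpa [← sub_eq_add_neg, sub_eq_zero] using h2

/-- $\mathbf V$ multiplies the component of charge $\rho$ by $\omega^\rho$. A component that is not
zero therefore forces $\mu=\omega^\rho$, and the other components vanish since the powers
$\omega^\rho$ are distinct. -/
theorem exists_eq_combine_of_charge {Φ : States N (m + 1)} (hΦ : Φ ≠ 0) {μ : ℂ}
    (h : chargeOp N (m + 1) Φ = μ • Φ) :
    ∃ ρ : ZMod N, omPow ρ = μ ∧ ∃ Q, Φ = combine P S m ρ Q := by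
  obtain ⟨c, rfl⟩ := exists_eq_sum_combine hS hP hm Φ
  have h1 : ∀ ρ, (omPow ρ - μ) • c ρ = 0 := by
    refine sum_combine_eq_zero hS hP hm (c := fun ρ => (omPow ρ - μ) • c ρ) ?_
    simp only [combine_smul, sub_smul (omPow _) μ (combine P S m _ _), Finset.sum_sub_distrib,
      ← Finset.smul_sum]
    rw [← h, map_sum, sub_eq_zero]
    exact Finset.sum_congr rfl fun ρ _ => (chargeOp_combine hS hP hm ρ _).symm
  obtain ⟨ρ, hρ⟩ : ∃ ρ, c ρ ≠ 0 := by
    by_contra! hc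
    refine hΦ (Finset.sum_eq_zero fun ρ _ => ?_)
    simp [hc, combine]
  have h2 : omPow ρ = μ := sub_eq_zero.mp ((smul_eq_zero.mp (h1 ρ)).resolve_right hρ)
  refine ⟨ρ, h2, c ρ, Finset.sum_eq_single ρ (fun σ _ hσ => ?_) fun h => absurd (Finset.mem_univ ρ) h⟩
  have h3 : c σ = 0 := (smul_eq_zero.mp (h1 σ)).resolve_left fun h =>
    hσ (omPow_injective ((sub_eq_zero.mp h).trans h2.symm))
  simp [h3, combine]

theorem exists_eq_combine {Φ : States N (m + 1)} {ρ : ZMod N}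
    (h : chargeOp N (m + 1) Φ = omPow ρ • Φ) : ∃ Q, Φ = combine P S m ρ Q := by
  by_cases hΦ : Φ = 0
  · exact ⟨0, by simp [hΦ, combine]⟩
  · obtain ⟨σ, hσ, hQ⟩ := exists_eq_combine_of_charge hS hP hm hΦ h
    rwa [omPow_injective hσ] at hQ

/-- The vector with coefficients `Q` is an eigenvector of the transfer matrix if and only if
these coefficients, multiplied by the Sklyanin weight, solve the separated difference equations. -/
theorem transfer_combine_iff {t : ℂ → ℂ} {ρ : ZMod N} (ht : PolyEnds (m + 1) t
      (1 + omPow ρ * ∏ j ∈ Finset.Icc 1 (m + 1), P.b j * P.d j / P.κ j)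
      ((∏ j ∈ Finset.Icc 1 (m + 1), P.a j * P.c j) + omPow ρ * ∏ j ∈ Finset.Icc 1 (m + 1), P.κ j))
    (Q : (Fin m → ZMod N) → ℂ) :
    (∀ l, transfer N (m + 1) P l (combine P S m ρ Q) = t l • combine P S m ρ Q) ↔
      ∀ (ρ' : Fin m → ZMod N) (k : Fin m),
        t (lam S (m + 1) (k + 1) (ρ' k)) * (sklyanin S m ρ' * Q ρ') =
          deltaPlus P S (m + 1) (k + 1) ρ (lam S (m + 1) (k + 1) (ρ' k)) *
            (sklyanin S m (ρ' + Pi.single k 1) * Q (ρ' + Pi.single k 1)) +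
          deltaMinus N P S (m + 1) (k + 1) (omega N * lam S (m + 1) (k + 1) (ρ' k)) *
            (sklyanin S m (ρ' - Pi.single k 1) * Q (ρ' - Pi.single k 1)) := by
  have h1 : (∀ (ρ' : Fin m → ZMod N) (k : Fin m),
        t (lam S (m + 1) (k + 1) (ρ' k)) * (sklyanin S m ρ' * Q ρ') =
          deltaPlus P S (m + 1) (k + 1) ρ (lam S (m + 1) (k + 1) (ρ' k)) *
            (sklyanin S m (ρ' + Pi.single k 1) * Q (ρ' + Pi.single k 1)) +
          deltaMinus N P S (m + 1) (k + 1) (omega N * lam S (m + 1) (k + 1) (ρ' k)) *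
            (sklyanin S m (ρ' - Pi.single k 1) * Q (ρ' - Pi.single k 1))) ↔
      ∀ ρ' k, t (nodes S m ρ' k) * Q ρ' = transferCoeff P S m ρ Q ρ' k := by
    refine forall_congr' fun ρ' => forall_congr' fun k => ?_
    change t (nodes S m ρ' k) * _ = deltaPlus P S (m + 1) (k + 1) ρ (nodes S m ρ' k) * _ +
      deltaMinus N P S (m + 1) (k + 1) (omega N * nodes S m ρ' k) * _ ↔ _
    rw [← sklyanin_mul_transferCoeff hS hP hm, mul_left_comm]
    exact mul_right_inj' (sklyanin_ne_zero hS hP hm ρ')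
  have h2 : ∀ l, transfer N (m + 1) P l (combine P S m ρ Q) = t l • combine P S m ρ Q ↔
      ∀ ρ', interp (nodes S m ρ') (transferCoeff P S m ρ Q ρ')
        ((1 + omPow ρ * ∏ j ∈ Finset.Icc 1 (m + 1), P.b j * P.d j / P.κ j) * Q ρ')
        (((∏ j ∈ Finset.Icc 1 (m + 1), P.a j * P.c j) +
          omPow ρ * ∏ j ∈ Finset.Icc 1 (m + 1), P.κ j) * Q ρ') l = t l * Q ρ' := fun l => by
    rw [transfer_combine hS hP hm, ← combine_smul, (combine_injective hS hP hm ρ).eq_iff]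
    exact funext_iff
  simp only [h1, h2]
  constructor
  · intro h ρ' k
    rw [← h, interp_node (nodes_injective hP hm ρ') (nodes_ne_zero hS hP hm ρ')]
  · intro h l ρ'
    -- By $(*)$, $t(\lambda)Q$ has the same extreme coefficients as the coefficient of $\mathbf
    -- t(\lambda)\Phi$, so agreement at the nodes is agreement everywhere.
    have h3 := (ht.map (LinearMap.lsmul ℂ ℂ (Q ρ'))).eq_interp_scalar (nodes_injective hP hm ρ')
      (nodes_ne_zero hS hP hm ρ') l
    simp only [LinearMap.lsmul_apply, smul_eq_mul] at h3
    rw [mul_comm (t l), h3, mul_comm (1 + _), mul_comm (_ + _)]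
    congr 1
    exact funext fun k => (h ρ' k).symm.trans (mul_comm _ _)

/-- Every eigenvector of the transfer matrix has a charge, and its eigenvalue is a polynomial with
known extreme coefficients. -/
theorem exists_charge_of_transfer {t : ℂ → ℂ} {Φ : States N (m + 1)} (hΦ : Φ ≠ 0)
    (h : ∀ l, transfer N (m + 1) P l Φ = t l • Φ) :
    ∃ ρ : ZMod N, chargeOp N (m + 1) Φ = omPow ρ • Φ ∧ PolyEnds (m + 1) t
      (1 + omPow ρ * ∏ j ∈ Finset.Icc 1 (m + 1), P.b j * P.d j / P.κ j)
      ((∏ j ∈ Finset.Icc 1 (m + 1), P.a j * P.c j) +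
        omPow ρ * ∏ j ∈ Finset.Icc 1 (m + 1), P.κ j) := by
  -- A nonzero coordinate of $\Phi$ recovers the arbitrary function $t$ as a polynomial with ends
  -- expressed by $\Phi$ and $\mathbf V\Phi$.
  obtain ⟨γ, hγ⟩ := Function.ne_iff.mp hΦ
  have hend := monodromy_polyEnds (N := N) P (m + 1)
  have h1 := (hend.1.add hend.2.2.2).map (LinearMap.applyₗ (R := ℂ) (M := States N (m + 1))
    (M₂ := States N (m + 1)) Φ)
  have h2 := fun γ => h1.map (LinearMap.proj (R := ℂ) (φ := fun _ : Fin (m + 1) → ZMod N => ℂ) γ)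
  have h3 : ∀ γ, PolyEnds (m + 1) (fun l => Φ γ * t l)
      (Φ γ + (∏ j ∈ Finset.Icc 1 (m + 1), P.b j * P.d j / P.κ j) * chargeOp N (m + 1) Φ γ)
      ((∏ j ∈ Finset.Icc 1 (m + 1), P.κ j) * chargeOp N (m + 1) Φ γ +
        (∏ j ∈ Finset.Icc 1 (m + 1), P.a j * P.c j) * Φ γ) := fun γ =>
    (h2 γ).congr (fun l => (congrFun (h l) γ).trans (mul_comm _ _)) rfl rfl
  have h4 := ((h3 γ).map (LinearMap.lsmul ℂ ℂ (Φ γ)⁻¹)).congr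
    (fun l => show (Φ γ)⁻¹ * (Φ γ * t l) = t l from inv_mul_cancel_left₀ hγ _) rfl rfl
  have hκ : ∏ j ∈ Finset.Icc 1 (m + 1), P.κ j ≠ 0 :=
    Finset.prod_ne_zero_iff.mpr fun j hj => hP.κ_ne j (by simp at hj ⊢; omega)
  -- The leading coefficients of the other coordinates say that $\prod\kappa\cdot\mathbf V\Phi+\prod
  -- ac\cdot\Phi$ is proportional to $\Phi$. Since $\prod\kappa\ne0$, $\Phi$ is an eigenvector of
  -- $\mathbf V$.
  have h5 : ∃ μ : ℂ, chargeOp N (m + 1) Φ = μ • Φ := by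
    refine ⟨(Φ γ)⁻¹ * chargeOp N (m + 1) Φ γ, funext fun γ' => ?_⟩
    have h6 := ((h4.map (LinearMap.lsmul ℂ ℂ (Φ γ'))).ends_unique (h3 γ') fun l _ => rfl).2
    simp only [LinearMap.lsmul_apply, smul_eq_mul] at h6
    have hγ' : Φ γ ≠ 0 := hγ
    refine mul_left_cancel₀ (mul_ne_zero hγ' hκ) ?_
    rw [Pi.smul_apply, smul_eq_mul]
    field_simp at h6
    linear_combination -h6 - (∏ j ∈ Finset.Icc 1 (m + 1), P.κ j) * chargeOp N (m + 1) Φ γ * Φ γ' *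
      mul_inv_cancel₀ hγ'
  obtain ⟨μ, hμ⟩ := h5
  obtain ⟨ρ, hρ, -⟩ := exists_eq_combine_of_charge hS hP hm hΦ hμ
  subst hρ
  have hγ' : Φ γ ≠ 0 := hγ
  refine ⟨ρ, hμ, h4.congr (fun l => rfl) ?_ ?_⟩
  · rw [hμ, LinearMap.lsmul_apply, Pi.smul_apply, smul_eq_mul, smul_eq_mul]
    field_simp
  · rw [hμ, LinearMap.lsmul_apply, Pi.smul_apply, smul_eq_mul, smul_eq_mul]
    field_simp
    ring

theorem combine_mem_jointEigenspace_iff {ρ : ZMod N} {E : Polynomial ℂ}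
    (hE : IsEigenPoly P (m + 1) ρ E) (Qt : (Fin m → ZMod N) → ℂ) :
    combine P S m ρ (fun ρ' => Qt ρ' / sklyanin S m ρ') ∈
        jointEigenspace P (m + 1) ρ (fun l => E.eval l) ↔
      ∀ (ρ' : Fin m → ZMod N) (k : Fin m),
        E.eval (lam S (m + 1) (k + 1) (ρ' k)) * Qt ρ' =
          deltaPlus P S (m + 1) (k + 1) ρ (lam S (m + 1) (k + 1) (ρ' k)) *
            Qt (ρ' + Pi.single k 1) +
          deltaMinus N P S (m + 1) (k + 1) (omega N * lam S (m + 1) (k + 1) (ρ' k)) *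
            Qt (ρ' - Pi.single k 1) := by
  have h := transfer_combine_iff hS hP hm hE.polyEnds fun ρ' => Qt ρ' / sklyanin S m ρ'
  simp only [mul_div_cancel₀ _ (sklyanin_ne_zero hS hP hm _)] at h
  rw [← h, jointEigenspace, Submodule.mem_inf, Submodule.mem_iInf, Module.End.mem_eigenspace_iff]
  simp only [Module.End.mem_eigenspace_iff, chargeOp_combine hS hP hm, true_and]

theorem combine_sepProd_mem_jointEigenspace {ρ : ZMod N} {E : Polynomial ℂ}
    (hE : IsEigenPoly P (m + 1) ρ E) {q : Fin m → ZMod N → ℂ}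
    (hq : ∀ k : Fin m, q k ∈ baxterSpace P S (m + 1) (k + 1) ρ fun l => E.eval l) :
    combine P S m ρ (fun ρ' => sepProd q ρ' / sklyanin S m ρ') ∈
      jointEigenspace P (m + 1) ρ (fun l => E.eval l) := by
  rw [combine_mem_jointEigenspace_iff hS hP hm hE]
  intro ρ' k
  have e0 := sepProd_apply_update q ρ' k (ρ' k)
  have e1 := sepProd_apply_update q ρ' k (ρ' k + 1)
  have e2 := sepProd_apply_update q ρ' k (ρ' k - 1)
  have u1 : Function.update ρ' k (ρ' k + 1) = ρ' + Pi.single k 1 := by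
    funext i
    by_cases h : i = k
    · subst h; simp
    · simp [h]
  have u2 : Function.update ρ' k (ρ' k - 1) = ρ' - Pi.single k 1 := by
    funext i
    by_cases h : i = k
    · subst h; simp
    · simp [h]
  rw [Function.update_eq_self] at e0
  rw [u1] at e1
  rw [u2] at e2
  rw [e0, e1, e2]
  linear_combination (∏ s ∈ Finset.univ.erase k, q s (ρ' s)) * hq k (ρ' k)

theorem combine_sepProd_ne_zero (ρ : ZMod N) {q : Fin m → ZMod N → ℂ} (hq : ∀ k, q k ≠ 0) :
    combine P S m ρ (fun ρ' => sepProd q ρ' / sklyanin S m ρ') ≠ 0 := fun h => by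
  refine sepProd_ne_zero hq (funext fun ρ' => ?_)
  have h1 := congrFun (combine_eq_zero hS hP hm h) ρ'
  exact (div_eq_zero_iff.mp h1).resolve_right (sklyanin_ne_zero hS hP hm ρ')

theorem exists_mem_span_sepProd {ρ : ZMod N} {E : Polynomial ℂ}
    (hE : IsEigenPoly P (m + 1) ρ E) {Φ : States N (m + 1)}
    (hΦ : Φ ∈ jointEigenspace P (m + 1) ρ (fun l => E.eval l)) :
    ∃ Qt ∈ Submodule.span ℂ {f | ∃ q : Fin m → ZMod N → ℂ,
        (∀ k : Fin m, q k ∈ baxterSpace P S (m + 1) (k + 1) ρ fun l => E.eval l) ∧ f = sepProd q},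
      Φ = combine P S m ρ fun ρ' => Qt ρ' / sklyanin S m ρ' := by
  obtain ⟨Q, rfl⟩ := exists_eq_combine hS hP hm (Module.End.mem_eigenspace_iff.mp hΦ.1)
  have hQ : combine P S m ρ Q =
      combine P S m ρ fun ρ' => (sklyanin S m ρ' * Q ρ') / sklyanin S m ρ' := by
    congr 1
    exact funext fun ρ' => (mul_div_cancel_left₀ _ (sklyanin_ne_zero hS hP hm ρ')).symm
  refine ⟨fun ρ' => sklyanin S m ρ' * Q ρ', mem_span_sepProd fun x k j => ?_, hQ⟩
  rw [hQ, combine_mem_jointEigenspace_iff hS hP hm hE] at hΦ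
  -- With all variables but the $k$-th frozen, the $k$-th equation of the system is the $k$-th
  -- Baxter equation.
  have h := hΦ (Function.update x k j) k
  have u1 : Function.update x k j + Pi.single k 1 = Function.update x k (j + 1) := by
    funext i
    by_cases h : i = k
    · subst h; simp
    · simp [h]
  have u2 : Function.update x k j - Pi.single k 1 = Function.update x k (j - 1) := by
    funext i
    by_cases h : i = k
    · subst h; simp
    · simp [h]
  rw [u1, u2, Function.update_self] at h
  exact h

/-- The vector with the given coefficients, which are multiplied by the Sklyanin weight. -/
noncomputable def weightedCombine {N : ℕ} [NeZero N] (P : SiteParams) (S : Amplitudes) (m : ℕ)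
    (ρ : ZMod N) : ((Fin m → ZMod N) → ℂ) →ₗ[ℂ] States N (m + 1) where
  toFun Qt := combine P S m ρ fun ρ' => Qt ρ' / sklyanin S m ρ'
  map_add' Q Q' := by
    rw [← combine_add]
    congr 1
    exact funext fun ρ' => add_div _ _ _
  map_smul' z Q := by
    rw [RingHom.id_apply, ← combine_smul]
    congr 1
    exact funext fun ρ' => mul_div_assoc _ _ _

theorem jointEigenspace_eq_span {ρ : ZMod N} {E : Polynomial ℂ} (hE : IsEigenPoly P (m + 1) ρ E) :
    jointEigenspace P (m + 1) ρ (fun l => E.eval l) =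
      Submodule.span ℂ {Φ | ∃ q : Fin m → ZMod N → ℂ,
        (∀ k : Fin m, q k ∈ baxterSpace P S (m + 1) (k + 1) ρ fun l => E.eval l) ∧
        Φ = combine P S m ρ fun ρ' => sepProd q ρ' / sklyanin S m ρ'} := by
  refine le_antisymm (fun Φ hΦ => ?_) (Submodule.span_le.mpr ?_)
  · obtain ⟨Qt, hQt, rfl⟩ := exists_mem_span_sepProd hS hP hm hE hΦ
    refine Submodule.span_mono ?_
      (Submodule.apply_mem_span_image_of_mem_span (weightedCombine P S m ρ) hQt)
    rintro _ ⟨_, ⟨q, hq, rfl⟩, rfl⟩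
    exact ⟨q, hq, rfl⟩
  · rintro _ ⟨q, hq, rfl⟩
    exact combine_sepProd_mem_jointEigenspace hS hP hm hE hq

/-- If some $\mathcal S_k$ is zero, every spanning separated vector has a zero factor; if none is, a
product of nonzero solutions is a nonzero eigenvector. -/
theorem jointEigenspace_ne_bot_iff {ρ : ZMod N} {E : Polynomial ℂ}
    (hE : IsEigenPoly P (m + 1) ρ E) :
    jointEigenspace P (m + 1) ρ (fun l => E.eval l) ≠ (⊥ : Submodule ℂ (States N (m + 1))) ↔
      ∀ k : Fin m, baxterSpace P S (m + 1) (k + 1) ρ (fun l => E.eval l) ≠ ⊥ := by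
  constructor
  · intro h k hk
    rw [jointEigenspace_eq_span hS hP hm hE] at h
    refine h (Submodule.span_eq_bot.mpr ?_)
    rintro _ ⟨q, hq, rfl⟩
    have h0 : q k = 0 := (Submodule.mem_bot ℂ).mp (hk ▸ hq k)
    rw [sepProd.map_coord_zero k h0]
    simp [combine]
  · intro h hbot
    choose q hq hq0 using fun k => (Submodule.ne_bot_iff _).mp (h k)
    have h1 := combine_sepProd_mem_jointEigenspace hS hP hm hE hq
    rw [hbot, Submodule.mem_bot] at h1
    exact combine_sepProd_ne_zero hS hP hm ρ hq0 h1

theorem exists_eq_combine_sepProd {ρ : ZMod N} {E : Polynomial ℂ} (hE : IsEigenPoly P (m + 1) ρ E)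
    (hm1 : 1 ≤ m)
    (h : Module.finrank ℂ (jointEigenspace (N := N) P (m + 1) ρ (fun l => E.eval l)) = 1 ∨
      (∃ k₀ : Fin m, ∀ k : Fin m, k ≠ k₀ →
        Module.finrank ℂ (baxterSpace P S (m + 1) (k + 1) ρ (fun l => E.eval l)) ≤ 1))
    {Φ : States N (m + 1)} (hΦ : Φ ∈ jointEigenspace P (m + 1) ρ (fun l => E.eval l)) :
    ∃ q : Fin m → ZMod N → ℂ,
      (∀ k : Fin m, q k ∈ baxterSpace P S (m + 1) (k + 1) ρ (fun l => E.eval l)) ∧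
      Φ = combine P S m ρ fun ρ' => sepProd q ρ' / sklyanin S m ρ' := by
  rcases h with h | ⟨k₀, h⟩
  · have hne : jointEigenspace P (m + 1) ρ (fun l => E.eval l) ≠
        (⊥ : Submodule ℂ (States N (m + 1))) := by
      intro hbot
      rw [hbot, finrank_bot] at h
      exact zero_ne_one h
    choose q hq hq0 using fun k => (Submodule.ne_bot_iff _).mp
      ((jointEigenspace_ne_bot_iff hS hP hm hE).mp hne k)
    have h1 := combine_sepProd_mem_jointEigenspace hS hP hm hE hq
    have h2 := combine_sepProd_ne_zero hS hP hm ρ hq0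
    obtain ⟨c, hc⟩ := (finrank_eq_one_iff_of_nonzero' ⟨_, h1⟩
      (fun h0 => h2 (congrArg Subtype.val h0))).mp h ⟨Φ, hΦ⟩
    -- A factor is needed to absorb the scalar $c$; it exists because $m\ge1$.
    let k₀ : Fin m := ⟨0, hm1⟩
    refine ⟨Function.update q k₀ (c • q k₀), fun k => ?_, ?_⟩
    · by_cases hk : k = k₀
      · subst hk
        rw [Function.update_self]
        exact Submodule.smul_mem _ _ (hq _)
      · rw [Function.update_of_ne hk]
        exact hq k
    · rw [sepProd.map_update_smul, Function.update_eq_self]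
      exact (congrArg Subtype.val hc).symm.trans
        ((weightedCombine P S m ρ).map_smul c (sepProd q)).symm
  · obtain ⟨Qt, hQt, rfl⟩ := exists_mem_span_sepProd hS hP hm hE hΦ
    obtain ⟨q, hq, rfl⟩ := exists_eq_sepProd_of_finrank_le_one
      (W := fun k : Fin m => baxterSpace P S (m + 1) (k + 1) ρ fun l => E.eval l) h hQt
    exact ⟨q, hq, rfl⟩

end Eigenvectors

end BBS

/-! ### The theorem. -/

theorem mainTheorem3 (N : ℕ) [NeZero N] (M : ℕ) (hM : 1 ≤ M)
    (P : SiteParams) (S : Amplitudes)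
    (hS : IsSolution N (M + 1) P S) (hP : IsNondegenerate N (M + 1) P S) :
    -- the quantum determinant of the chain with `n = M + 1` sites
    (∀ l : ℂ,
      opA N (M + 1) P (omega N * l) * opD N (M + 1) P l
          - opC N (M + 1) P (omega N * l) * opB N (M + 1) P l
        = (∏ m ∈ Finset.Icc 1 (M + 1), F N P m l) • chargeOp N (M + 1)) ∧
    -- the operators `D` at the zeros of the eigenvalue of `B` are shifts
    (∀ (ρ : Fin (M + 1) → ZMod N) (k : Fin M),
      opD N (M + 1) P (lam S (M + 1) (k + 1) (ρ k.succ)) (Psi P S (M + 1) ρ)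
        = phiTilde P S M k (Fin.tail ρ) •
            Psi P S (M + 1) (ρ + Pi.single 0 1 - Pi.single k.succ 1)) ∧
    -- the action of `D` for arbitrary `λ`
    (∀ (l : ℂ) (ρ : Fin (M + 1) → ZMod N),
      opD N (M + 1) P l (Psi P S (M + 1) ρ)
        = (∑ k : Fin M,
            ((∏ s ∈ Finset.univ.erase k,
                (l - lam S (M + 1) (s + 1) (ρ s.succ)) /
                  (lam S (M + 1) (k + 1) (ρ k.succ) - lam S (M + 1) (s + 1) (ρ s.succ))) *
              (l / lam S (M + 1) (k + 1) (ρ k.succ)) * phiTilde P S M k (Fin.tail ρ)) •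
              Psi P S (M + 1) (ρ + Pi.single 0 1 - Pi.single k.succ 1))
          + ((∏ s : Fin M, (1 - l / lam S (M + 1) (s + 1) (ρ s.succ))) *
              ∏ m ∈ Finset.Icc 1 (M + 1), P.b m * P.d m / P.κ m) •
              Psi P S (M + 1) (ρ + Pi.single 0 1)
          + (l * (∏ m ∈ Finset.Icc 1 (M + 1), P.a m * P.c m) *
              ∏ s : Fin M, (l - lam S (M + 1) (s + 1) (ρ s.succ))) •
              Psi P S (M + 1) ρ) ∧
    -- the Fourier transformed vectors are a basis of eigenvectors of the charge operator
    (∀ (ρ : ZMod N) (ρ' : Fin M → ZMod N),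
      chargeOp N (M + 1) (PsiTilde P S M ρ ρ') = omPow ρ • PsiTilde P S M ρ ρ') ∧
    LinearIndependent ℂ
      (fun x : ZMod N × (Fin M → ZMod N) => PsiTilde P S M x.1 x.2) ∧
    Submodule.span ℂ
      (Set.range fun x : ZMod N × (Fin M → ZMod N) => PsiTilde P S M x.1 x.2) = ⊤ ∧
    -- every eigenvector of the transfer matrix has a charge, its eigenvalue is a polynomial with
    -- the known extreme coefficients, and it has a unique expansion; the coefficients, multiplied
    -- by the Sklyanin weight, satisfy the separated difference equations
    (∀ (t : ℂ → ℂ) (Φ : States N (M + 1)), Φ ≠ 0 →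
      (∀ l : ℂ, transfer N (M + 1) P l Φ = t l • Φ) →
      ∃! ρ : ZMod N, chargeOp N (M + 1) Φ = omPow ρ • Φ ∧
        (∃ E : Polynomial ℂ, IsEigenPoly P (M + 1) ρ E ∧ ∀ l : ℂ, t l = E.eval l) ∧
        ∃! Q : (Fin M → ZMod N) → ℂ, Φ = combine P S M ρ Q ∧
          ∀ (ρ' : Fin M → ZMod N) (k : Fin M),
            t (lam S (M + 1) (k + 1) (ρ' k)) * (sklyanin S M ρ' * Q ρ') =
              deltaPlus P S (M + 1) (k + 1) ρ (lam S (M + 1) (k + 1) (ρ' k)) *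
                (sklyanin S M (ρ' + Pi.single k 1) * Q (ρ' + Pi.single k 1)) +
              deltaMinus N P S (M + 1) (k + 1) (omega N * lam S (M + 1) (k + 1) (ρ' k)) *
                (sklyanin S M (ρ' - Pi.single k 1) * Q (ρ' - Pi.single k 1))) ∧
    -- conversely, for every admissible polynomial, solutions give eigenvectors; separation of
    -- variables
    (∀ (ρ : ZMod N) (E : Polynomial ℂ), IsEigenPoly P (M + 1) ρ E →
      (∀ Qt : (Fin M → ZMod N) → ℂ,
        combine P S M ρ (fun ρ' => Qt ρ' / sklyanin S M ρ') ∈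
            jointEigenspace P (M + 1) ρ (fun l => E.eval l) ↔
          ∀ (ρ' : Fin M → ZMod N) (k : Fin M),
            E.eval (lam S (M + 1) (k + 1) (ρ' k)) * Qt ρ' =
              deltaPlus P S (M + 1) (k + 1) ρ (lam S (M + 1) (k + 1) (ρ' k)) *
                Qt (ρ' + Pi.single k 1) +
              deltaMinus N P S (M + 1) (k + 1) (omega N * lam S (M + 1) (k + 1) (ρ' k)) *
                Qt (ρ' - Pi.single k 1)) ∧
      -- nontrivial solutions of the Baxter equations give an eigenvector
      (∀ q : Fin M → ZMod N → ℂ,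
        (∀ k : Fin M, q k ≠ 0 ∧
          q k ∈ baxterSpace P S (M + 1) (k + 1) ρ (fun l => E.eval l)) →
        combine P S M ρ (fun ρ' => (∏ k, q k (ρ' k)) / sklyanin S M ρ') ≠ 0 ∧
        combine P S M ρ (fun ρ' => (∏ k, q k (ρ' k)) / sklyanin S M ρ') ∈
          jointEigenspace P (M + 1) ρ (fun l => E.eval l)) ∧
      -- such separated eigenvectors span each eigenspace
      jointEigenspace P (M + 1) ρ (fun l => E.eval l) =
        Submodule.span ℂ {Φ | ∃ q : Fin M → ZMod N → ℂ,
          (∀ k : Fin M, q k ∈ baxterSpace P S (M + 1) (k + 1) ρ (fun l => E.eval l)) ∧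
          Φ = combine P S M ρ (fun ρ' => (∏ k, q k (ρ' k)) / sklyanin S M ρ')} ∧
      -- `E` is an eigenvalue if and only if all the Baxter equations are nontrivially solvable
      (jointEigenspace P (M + 1) ρ (fun l => E.eval l) ≠ ⊥ ↔
        ∀ k : Fin M, baxterSpace P S (M + 1) (k + 1) ρ (fun l => E.eval l) ≠ ⊥) ∧
      -- in the absence of degeneration every eigenvector is separated
      (Module.finrank ℂ (jointEigenspace P (M + 1) ρ (fun l => E.eval l)) = 1 ∨
          (∃ k₀ : Fin M, ∀ k : Fin M, k ≠ k₀ →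
            Module.finrank ℂ (baxterSpace P S (M + 1) (k + 1) ρ (fun l => E.eval l)) ≤ 1) →
        ∀ Φ ∈ jointEigenspace P (M + 1) ρ (fun l => E.eval l),
          ∃ q : Fin M → ZMod N → ℂ,
            (∀ k : Fin M, q k ∈ baxterSpace P S (M + 1) (k + 1) ρ (fun l => E.eval l)) ∧
            Φ = combine P S M ρ (fun ρ' => (∏ k, q k (ρ' k)) / sklyanin S M ρ'))) := by
  refine ⟨fun l => ?_, fun ρ k => opD_nodes hS hP le_rfl ρ k, fun l ρ => ?_,
    fun ρ ρ' => chargeOp_PsiTilde hS hP le_rfl ρ ρ', PsiTilde_linearIndependent hS hP le_rfl,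
    span_PsiTilde hS hP le_rfl, fun t Φ hΦ h => ?_, fun ρ E hE =>
      ⟨combine_mem_jointEigenspace_iff hS hP le_rfl hE, fun q hq => ?_, ?_,
        jointEigenspace_ne_bot_iff hS hP le_rfl hE, fun h Φ hΦ => ?_⟩⟩
  · exact (monodromy_relations (N := N) P l (M + 1) fun j hj => hP.κ_ne j hj).1.det
  · rw [opD_eq_interp hS hP le_rfl, interp]
    simp only [smul_smul]
    rw [mul_right_comm l]
    rfl
  · obtain ⟨ρ, hρ, ht⟩ := exists_charge_of_transfer hS hP le_rfl hΦ h
    refine ⟨ρ, ⟨hρ, ht.exists_isEigenPoly, ?_⟩, fun σ hσ => ?_⟩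
    · obtain ⟨Q, rfl⟩ := exists_eq_combine hS hP le_rfl hρ
      -- The expansion alone determines $Q$; the difference equations play no part in its
      -- uniqueness.
      exact ⟨Q, ⟨rfl, (transfer_combine_iff hS hP le_rfl ht Q).mp h⟩, fun Q' hQ' =>
        (combine_injective hS hP le_rfl ρ hQ'.1).symm⟩
    · exact omPow_injective (smul_left_injective ℂ hΦ (hσ.1.symm.trans hρ))
  · have h1 := combine_sepProd_ne_zero hS hP le_rfl ρ fun k => (hq k).1
    have h2 := combine_sepProd_mem_jointEigenspace hS hP le_rfl hE fun k => (hq k).2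
    simp only [sepProd_apply] at h1 h2
    exact ⟨h1, h2⟩
  · have h1 := jointEigenspace_eq_span hS hP le_rfl hE
    simp only [sepProd_apply] at h1
    exact h1
  · have h1 := exists_eq_combine_sepProd hS hP le_rfl hE hM h hΦ
    simp only [sepProd_apply] at h1
    exact h1
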